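/- Let $L>0$, $0<\delta<K$, $h\ge 0$, $I>0$, let $\mathcal R=(-L,L)\times(-K,K)$, and call the two boundary segments $\{x=\pm L,\ |y|<\delta\}$ the leads. Let $A_0=(-y,0)$, and let $\phi^0:\mathcal R\to\mathbb R$ be the (weak, $H^1$) solution with $\int_{\mathcal R}\phi^0=0$ of $$\Delta\phi^0=0\ \text{in }\mathcal R,\qquad \phi^0_x(\pm L,y)=\begin{cases}-1,&|y|<\delta,\\ 0,&\delta<|y|<K,\end{cases}\qquad \phi^0_y(x,\pm K)=0 .$$ Let $\mathcal L$ be the operator in $L^2(\mathcal R;\mathbb C)$ $$\mathcal L u=(\nabla-ihA_0)^2u-iI\phi^0u$$ with the boundary conditions $u(\pm L,y)=0$ for $|y|<\delta$, $\ u_x(\pm L,y)+ihy\,u(\pm L,y)=0$ for $\delta<|y|\le K$, $\ u_y(x,\pm K)=0$ for $|x|\le L$. These are understood weakly: with $V=\{v\in H^1(\mathcal R;\mathbb C): v=0 \text{ on the leads}\}$, $(\nabla-ihA_0)^2u=w$ means that $u\in V$, $w\in L^2$ and $-\int_{\mathcal R}(\nabla-ihA_0)u\cdot\overline{(\nabla-ihA_0)v}=\int_{\mathcal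 R}w\,\overline v$ for all $v\in V$. An eigenpair is a pair $(\lambda,u)$ with $u\ne0$ in the domain of $\mathcal L$ and $\mathcal L u=-\lambda u$; then $\lambda$ is called an eigenvalue. Then: 1. The spectrum of $\mathcal L$ consists only of point spectrum. 2. $\phi^0\in L^\infty(\mathcal R)$, and every eigenvalue $\lambda$ satisfies $\operatorname{Re}\lambda>0$ and $|\operatorname{Im}\lambda|<\|\phi^0\|_{L^\infty}I$. 3. The distinct eigenvalues can be listed as an infinite sequence $\lambda_1,\lambda_2,\dots$ ordered by real part: $0<\operatorname{Re}\lambda_1\le\operatorname{Re}\lambda_2\le\cdots$. 4. If $(\lambda,u)$ is an eigenpair, then so is $(\lambda^*,u^\dagger)$, where $u^\dagger(x,y)=u^*(-x,y)$ and $^*$ denotes complex conjugation. -/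

import Mathlib

open MeasureTheory Set
open scoped ContDiff ENNReal ComplexConjugate

noncomputable section

namespace GinzburgLandau

/-! ### The rectangle and its boundary portions -/

/-- The open rectangle `(-L, L) × (-K, K)`. -/
def rect (L K : ℝ) : Set (ℝ × ℝ) := Ioo (-L) L ×ˢ Ioo (-K) K

/-- Lebesgue measure on the rectangle. -/
abbrev rectMeasure (L K : ℝ) : Measure (ℝ × ℝ) := volume.restrict (rect L K)

/-- The complex Hilbert space `L²` of the rectangle. -/
abbrev L2 (L K : ℝ) : Type := Lp ℂ 2 (rectMeasure L K)

/-- The leads: the two boundary segments `x = ± L`, `|y| < δ`. -/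
def leads (L δ : ℝ) : Set (ℝ × ℝ) := {p | |p.1| = L ∧ |p.2| < δ}

/-- The part of the boundary of the rectangle that carries no lead. -/
def insulated (L K δ : ℝ) : Set (ℝ × ℝ) := frontier (rect L K) \ leads L δ

/-- Real test functions: smooth, with compact support contained in `U`. -/
structure IsTestFunction (U : Set (ℝ × ℝ)) (ψ : ℝ × ℝ → ℝ) : Prop where
  smooth : ContDiff ℝ ∞ ψ
  compact : HasCompactSupport ψ
  subset : tsupport ψ ⊆ U

/-! ### The Sobolev space `H¹` of the rectangle -/

/-- `u` belongs to `H¹` of the rectangle and `(g₁, g₂)` is its weak gradient. -/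
structure HasWeakGradient (L K : ℝ) {E : Type*} [NormedAddCommGroup E] [NormedSpace ℝ E]
    (u g₁ g₂ : ℝ × ℝ → E) : Prop where
  memLp : MemLp u 2 (rectMeasure L K)
  memLp_x : MemLp g₁ 2 (rectMeasure L K)
  memLp_y : MemLp g₂ 2 (rectMeasure L K)
  weak_x : ∀ ψ, IsTestFunction (rect L K) ψ →
    ∫ p in rect L K, fderiv ℝ ψ p (1, 0) • u p = - ∫ p in rect L K, ψ p • g₁ p
  weak_y : ∀ ψ, IsTestFunction (rect L K) ψ →
    ∫ p in rect L K, fderiv ℝ ψ p (0, 1) • u p = - ∫ p in rect L K, ψ p • g₂ p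

/-- `u ∈ H¹` has weak gradient `(g₁, g₂)`, and its trace vanishes on the leads. The trace
condition is expressed through Green's formula: for a test function `ψ` on the plane whose support
does not meet the rest of the boundary, `∫ (u ∂ₓψ + ψ ∂ₓu)` over the rectangle equals the integral
of `ν₁ ψ u` over the leads, where the normal is `(± 1, 0)`; it vanishes for all these `ψ` exactly
when `u` has zero trace on the leads. -/
structure InFormDomain (L K δ : ℝ) (u g₁ g₂ : ℝ × ℝ → ℂ) : Prop where
  grad : HasWeakGradient L K u g₁ g₂
  trace : ∀ ψ, IsTestFunction (insulated L K δ)ᶜ ψ →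
    ∫ p in rect L K, fderiv ℝ ψ p (1, 0) • u p = - ∫ p in rect L K, ψ p • g₁ p

/-! ### The electric potential of the normal state -/

/-- `φ` is the potential `φ⁰`: the weak (`H¹`) solution, of mean zero, of the Neumann problem
`Δφ = 0` in the rectangle, `φ_x(± L, y) = -1` for `|y| < δ` and `φ_x(± L, y) = 0` for
`δ < |y| < K`, `φ_y(x, ± K) = 0`. -/
def IsNormalPotential (L K δ : ℝ) (φ : ℝ × ℝ → ℝ) : Prop :=
  (∃ g₁ g₂ : ℝ × ℝ → ℝ, HasWeakGradient L K φ g₁ g₂ ∧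
    ∀ η : ℝ × ℝ → ℝ, ContDiff ℝ ∞ η →
      ∫ p in rect L K, (g₁ p * fderiv ℝ η p (1, 0) + g₂ p * fderiv ℝ η p (0, 1)) =
        ∫ y in (-δ)..δ, (η (-L, y) - η (L, y))) ∧
  ∫ p in rect L K, φ p = 0

/-! ### Helper facts -/

section Helpers

variable {L K δ : ℝ}

lemma measurableSet_rect : MeasurableSet (rect L K) := measurableSet_Ioo.prod measurableSet_Ioo

lemma isOpen_rect : IsOpen (rect L K) := isOpen_Ioo.prod isOpen_Ioo

lemma IsTestFunction.memLp_two {U : Set (ℝ × ℝ)} {ψ : ℝ × ℝ → ℝ} (hψ : IsTestFunction U ψ) :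
    MemLp ψ 2 (rectMeasure L K) :=
  (hψ.smooth.continuous.memLp_of_hasCompactSupport hψ.compact).restrict _

lemma IsTestFunction.continuous_fderiv {U : Set (ℝ × ℝ)} {ψ : ℝ × ℝ → ℝ}
    (hψ : IsTestFunction U ψ) (e : ℝ × ℝ) : Continuous fun p => fderiv ℝ ψ p e :=
  (hψ.smooth.continuous_fderiv (by simp)).clm_apply continuous_const

lemma IsTestFunction.memLp_fderiv {U : Set (ℝ × ℝ)} {ψ : ℝ × ℝ → ℝ}
    (hψ : IsTestFunction U ψ) (e : ℝ × ℝ) :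
    MemLp (fun p => fderiv ℝ ψ p e) 2 (rectMeasure L K) :=
  ((hψ.continuous_fderiv e).memLp_of_hasCompactSupport
    (hψ.compact.fderiv_apply ℝ e)).restrict _

lemma integrable_smul {f : ℝ × ℝ → ℝ} {g : ℝ × ℝ → ℂ} (hf : MemLp f 2 (rectMeasure L K))
    (hg : MemLp g 2 (rectMeasure L K)) : Integrable (fun p => f p • g p) (rectMeasure L K) :=
  memLp_one_iff_integrable.1 (hg.smul hf)

/-- A linear relation between integrals, closed under linear combinations. -/
lemma integral_comb {f₁ f₂ : ℝ × ℝ → ℝ} {u u' g g' : ℝ × ℝ → ℂ}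
    (hf₁ : MemLp f₁ 2 (rectMeasure L K)) (hf₂ : MemLp f₂ 2 (rectMeasure L K))
    (hu : MemLp u 2 (rectMeasure L K)) (hu' : MemLp u' 2 (rectMeasure L K))
    (hg : MemLp g 2 (rectMeasure L K)) (hg' : MemLp g' 2 (rectMeasure L K)) (c : ℂ)
    (h : ∫ p in rect L K, f₁ p • u p = - ∫ p in rect L K, f₂ p • g p)
    (h' : ∫ p in rect L K, f₁ p • u' p = - ∫ p in rect L K, f₂ p • g' p) :
    ∫ p in rect L K, f₁ p • (c * u p + u' p) =
      - ∫ p in rect L K, f₂ p • (c * g p + g' p) := by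
  have key : ∀ {f : ℝ × ℝ → ℝ} {a b : ℝ × ℝ → ℂ}, MemLp f 2 (rectMeasure L K) →
      MemLp a 2 (rectMeasure L K) → MemLp b 2 (rectMeasure L K) →
      ∫ p in rect L K, f p • (c * a p + b p) =
        c * (∫ p in rect L K, f p • a p) + ∫ p in rect L K, f p • b p := by
    intro f a b hf ha hb
    rw [← integral_const_mul, ← integral_add ((integrable_smul hf ha).const_mul c)
      (integrable_smul hf hb)]
    refine integral_congr_ae (Filter.Eventually.of_forall fun p => ?_)
    simp only [Complex.real_smul]
    ring
  rw [key hf₁ hu hu', key hf₂ hg hg', h, h']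
  ring

lemma InFormDomain.comb {u g₁ g₂ u' g₁' g₂' : ℝ × ℝ → ℂ} (hu : InFormDomain L K δ u g₁ g₂)
    (hu' : InFormDomain L K δ u' g₁' g₂') (c : ℂ) :
    InFormDomain L K δ (fun p => c * u p + u' p) (fun p => c * g₁ p + g₁' p)
      (fun p => c * g₂ p + g₂' p) where
  grad :=
    { memLp := (hu.grad.memLp.const_mul c).add hu'.grad.memLp
      memLp_x := (hu.grad.memLp_x.const_mul c).add hu'.grad.memLp_x
      memLp_y := (hu.grad.memLp_y.const_mul c).add hu'.grad.memLp_y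
      weak_x := fun ψ hψ => integral_comb (hψ.memLp_fderiv _) hψ.memLp_two hu.grad.memLp
        hu'.grad.memLp hu.grad.memLp_x hu'.grad.memLp_x c (hu.grad.weak_x ψ hψ)
        (hu'.grad.weak_x ψ hψ)
      weak_y := fun ψ hψ => integral_comb (hψ.memLp_fderiv _) hψ.memLp_two hu.grad.memLp
        hu'.grad.memLp hu.grad.memLp_y hu'.grad.memLp_y c (hu.grad.weak_y ψ hψ)
        (hu'.grad.weak_y ψ hψ) }
  trace := fun ψ hψ => integral_comb (hψ.memLp_fderiv _) hψ.memLp_two hu.grad.memLp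
    hu'.grad.memLp hu.grad.memLp_x hu'.grad.memLp_x c (hu.trace ψ hψ) (hu'.trace ψ hψ)

lemma InFormDomain.congr {u u' g₁ g₂ : ℝ × ℝ → ℂ} (hu : InFormDomain L K δ u g₁ g₂)
    (h : u =ᵐ[rectMeasure L K] u') : InFormDomain L K δ u' g₁ g₂ := by
  have key : ∀ f : ℝ × ℝ → ℝ, ∫ p in rect L K, f p • u' p = ∫ p in rect L K, f p • u p :=
    fun f => integral_congr_ae (h.mono fun p hp => by simp only [hp])
  exact
    { grad :=
        { memLp := hu.grad.memLp.ae_eq h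
          memLp_x := hu.grad.memLp_x
          memLp_y := hu.grad.memLp_y
          weak_x := fun ψ hψ => (key _).trans (hu.grad.weak_x ψ hψ)
          weak_y := fun ψ hψ => (key _).trans (hu.grad.weak_y ψ hψ) }
      trace := fun ψ hψ => (key _).trans (hu.trace ψ hψ) }

/-- Test functions supported in the open rectangle lie in the form domain. -/
lemma IsTestFunction.inFormDomain {η : ℝ × ℝ → ℝ} (hη : IsTestFunction (rect L K) η) :
    InFormDomain L K δ (fun p => (η p : ℂ)) (fun p => ((fderiv ℝ η p (1, 0) : ℝ) : ℂ))
      (fun p => ((fderiv ℝ η p (0, 1) : ℝ) : ℂ)) := by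
  have key : ∀ (U : Set (ℝ × ℝ)) (ψ : ℝ × ℝ → ℝ) (e : ℝ × ℝ), IsTestFunction U ψ →
      ∫ p in rect L K, fderiv ℝ ψ p e • (η p : ℂ) =
        - ∫ p in rect L K, ψ p • ((fderiv ℝ η p e : ℝ) : ℂ) := by
    intro U ψ e hψ
    have hη0 : ∀ p ∉ rect L K, η p = 0 := fun p hp =>
      image_eq_zero_of_notMem_tsupport fun h => hp (hη.subset h)
    have hη1 : ∀ p ∉ rect L K, fderiv ℝ η p e = 0 := fun p hp => by
      rw [fderiv_of_notMem_tsupport ℝ (fun h => hp (hη.subset h))]; rfl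
    rw [setIntegral_eq_integral_of_forall_compl_eq_zero (fun p hp => by simp [hη0 p hp]),
      setIntegral_eq_integral_of_forall_compl_eq_zero (fun p hp => by simp [hη1 p hp])]
    have h := integral_mul_fderiv_eq_neg_fderiv_mul_of_integrable (μ := (volume : Measure (ℝ × ℝ)))
      (f := ψ) (g := η) (v := e)
      (((hψ.continuous_fderiv e).mul hη.smooth.continuous).integrable_of_hasCompactSupport
        (hη.compact.mul_left))
      ((hψ.smooth.continuous.mul (hη.continuous_fderiv e)).integrable_of_hasCompactSupport
        (hψ.compact.mul_right))
      ((hψ.smooth.continuous.mul hη.smooth.continuous).integrable_of_hasCompactSupport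
        (hψ.compact.mul_right))
      (fun x _ => (hψ.smooth.differentiable (by simp)).differentiableAt)
      (fun x _ => (hη.smooth.differentiable (by simp)).differentiableAt)
    simp only [Complex.real_smul, ← Complex.ofReal_mul]
    rw [integral_complex_ofReal, integral_complex_ofReal, h]
    simp
  exact
    { grad :=
        { memLp := hη.memLp_two.ofReal
          memLp_x := (hη.memLp_fderiv _).ofReal
          memLp_y := (hη.memLp_fderiv _).ofReal
          weak_x := fun ψ hψ => key _ ψ _ hψ
          weak_y := fun ψ hψ => key _ ψ _ hψ }
      trace := fun ψ hψ => key _ ψ _ hψ }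

/-- An `L²` function orthogonal to all test functions vanishes. -/
lemma ae_eq_zero_of_test {f : ℝ × ℝ → ℂ} (hf : MemLp f 2 (rectMeasure L K))
    (h : ∀ ψ, IsTestFunction (rect L K) ψ → ∫ p in rect L K, ψ p • f p = 0) :
    f =ᵐ[rectMeasure L K] 0 := by
  have hfin : IsFiniteMeasure (rectMeasure L K) := by
    refine ⟨?_⟩
    rw [Measure.restrict_apply_univ]
    exact ((Metric.isBounded_Ioo _ _).prod (Metric.isBounded_Ioo _ _)).measure_lt_top
  have hint : IntegrableOn f (rect L K) := hf.integrable (by norm_num)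
  have := isOpen_rect.ae_eq_zero_of_integral_contDiff_smul_eq_zero (μ := volume)
    hint.locallyIntegrableOn (fun g h1 h2 h3 => by
      rw [← h g ⟨h1, h2, h3⟩, setIntegral_eq_integral_of_forall_compl_eq_zero]
      intro p hp
      rw [image_eq_zero_of_notMem_tsupport fun h => hp (h3 h), zero_smul])
  exact (ae_restrict_iff' measurableSet_rect).2 this

end Helpers

/-! ### The magnetic Laplacian with mixed boundary conditions -/

/-- The magnetic sesquilinear form `∫ (D₁u conj(D₁v) + D₂u conj(D₂v))`, with
`∇ - i h A₀ = (D₁, D₂) = (∂ₓ + i h y, ∂_y)` because `A₀ = (-y, 0)`; here `(g₁, g₂)` and `(k₁, k₂)`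
are the weak gradients of `u` and `v`. -/
def magneticForm (L K h : ℝ) (u g₁ g₂ v k₁ k₂ : ℝ × ℝ → ℂ) : ℂ :=
  ∫ p in rect L K,
    ((g₁ p + Complex.I * h * p.2 * u p) * conj (k₁ p + Complex.I * h * p.2 * v p) +
      g₂ p * conj (k₂ p))

section Helpers

variable {L K δ : ℝ}

lemma memLp_magnetic (h : ℝ) {u g : ℝ × ℝ → ℂ} (hu : MemLp u 2 (rectMeasure L K))
    (hg : MemLp g 2 (rectMeasure L K)) :
    MemLp (fun p => g p + Complex.I * h * p.2 * u p) 2 (rectMeasure L K) := by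
  refine hg.add (hu.of_le_mul (c := |h| * |K|) ?_ ?_)
  · exact (Continuous.aestronglyMeasurable (by fun_prop)).mul hu.1
  · refine (ae_restrict_iff' measurableSet_rect).2 (Filter.Eventually.of_forall fun p hp => ?_)
    have hp2 : |p.2| ≤ |K| := by
      have := hp.2
      exact (abs_le.2 ⟨this.1.le, this.2.le⟩).trans (le_abs_self K)
    simp only [norm_mul, Complex.norm_I, Complex.norm_real, Real.norm_eq_abs, one_mul]
    gcongr

lemma integrable_mul_conj {f g : ℝ × ℝ → ℂ} (hf : MemLp f 2 (rectMeasure L K))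
    (hg : MemLp g 2 (rectMeasure L K)) :
    Integrable (fun p => f p * conj (g p)) (rectMeasure L K) :=
  hf.integrable_mul hg.star

lemma magneticForm_comb (h : ℝ) {u g₁ g₂ u' g₁' g₂' v k₁ k₂ : ℝ × ℝ → ℂ}
    (hu : InFormDomain L K δ u g₁ g₂) (hu' : InFormDomain L K δ u' g₁' g₂')
    (hv : InFormDomain L K δ v k₁ k₂) (c : ℂ) :
    magneticForm L K h (fun p => c * u p + u' p) (fun p => c * g₁ p + g₁' p)
      (fun p => c * g₂ p + g₂' p) v k₁ k₂ =
    c * magneticForm L K h u g₁ g₂ v k₁ k₂ + magneticForm L K h u' g₁' g₂' v k₁ k₂ := by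
  have hi : ∀ {u g₁ g₂ : ℝ × ℝ → ℂ}, InFormDomain L K δ u g₁ g₂ →
      Integrable (fun p => (g₁ p + Complex.I * h * p.2 * u p) *
        conj (k₁ p + Complex.I * h * p.2 * v p) + g₂ p * conj (k₂ p)) (rectMeasure L K) :=
    fun hu => (integrable_mul_conj (memLp_magnetic h hu.grad.memLp hu.grad.memLp_x)
      (memLp_magnetic h hv.grad.memLp hv.grad.memLp_x)).add
        (integrable_mul_conj hu.grad.memLp_y hv.grad.memLp_y)
  unfold magneticForm
  rw [← integral_const_mul, ← integral_add ((hi hu).const_mul c) (hi hu')]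
  refine integral_congr_ae (Filter.Eventually.of_forall fun p => ?_)
  simp only
  ring

lemma magneticForm_congr (h : ℝ) {u u' g₁ g₂ v k₁ k₂ : ℝ × ℝ → ℂ}
    (hu : u =ᵐ[rectMeasure L K] u') :
    magneticForm L K h u g₁ g₂ v k₁ k₂ = magneticForm L K h u' g₁ g₂ v k₁ k₂ :=
  integral_congr_ae (hu.mono fun p hp => by simp only [hp])

end Helpers

/-- `u` lies in the form domain and `(∇ - i h A₀)² u = w` weakly: `-∫ D u · conj(D v) = ∫ w conj(v)`
for every `v` in the form domain. This contains the differential equation and, as natural boundary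
conditions, `u_x + i h y u = 0` on the part `δ < |y| ≤ K` of the sides `x = ± L` and `u_y = 0` on
the sides `y = ± K`; the condition `u = 0` on the leads is part of the form domain. -/
def IsMagneticLaplacian (L K δ h : ℝ) (u w : L2 L K) : Prop :=
  ∃ g₁ g₂ : ℝ × ℝ → ℂ, InFormDomain L K δ u g₁ g₂ ∧
    ∀ v k₁ k₂ : ℝ × ℝ → ℂ, InFormDomain L K δ v k₁ k₂ →
      - magneticForm L K h u g₁ g₂ v k₁ k₂ = ∫ p in rect L K, w p * conj (v p)

lemma isMagneticLaplacian_comb {L K δ h : ℝ} {u w u' w' : L2 L K} (c : ℂ)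
    (H : IsMagneticLaplacian L K δ h u w) (H' : IsMagneticLaplacian L K δ h u' w') :
    IsMagneticLaplacian L K δ h (c • u + u') (c • w + w') := by
  obtain ⟨g₁, g₂, hu, e⟩ := H
  obtain ⟨g₁', g₂', hu', e'⟩ := H'
  have hcoe : ∀ a b : L2 L K, (fun p => c * a p + b p) =ᵐ[rectMeasure L K] ⇑(c • a + b) := by
    intro a b
    filter_upwards [Lp.coeFn_add (c • a) b, Lp.coeFn_smul c a] with p h1 h2
    simp only [h1, h2, Pi.add_apply, Pi.smul_apply, smul_eq_mul]
  refine ⟨_, _, (hu.comb hu' c).congr (hcoe u u'), fun v k₁ k₂ hv => ?_⟩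
  rw [← magneticForm_congr h (hcoe u u'), magneticForm_comb h hu hu' hv c, neg_add, ← mul_neg,
    e v k₁ k₂ hv, e' v k₁ k₂ hv, ← integral_const_mul,
    ← integral_add ((integrable_mul_conj (Lp.memLp w) hv.grad.memLp).const_mul c)
      (integrable_mul_conj (Lp.memLp w') hv.grad.memLp)]
  refine integral_congr_ae ((hcoe w w').mono fun p hp => ?_)
  simp only [← hp]
  ring

lemma isMagneticLaplacian_zero (L K δ h : ℝ) : IsMagneticLaplacian L K δ h 0 0 := by
  have h0 : InFormDomain L K δ (fun _ => 0) (fun _ => 0) (fun _ => 0) := by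
    refine ⟨⟨MemLp.zero', MemLp.zero', MemLp.zero', ?_, ?_⟩, ?_⟩ <;> simp
  have hc : (fun _ => (0 : ℂ)) =ᵐ[rectMeasure L K] ⇑(0 : L2 L K) :=
    (Lp.coeFn_zero ℂ 2 (rectMeasure L K)).symm
  refine ⟨_, _, h0.congr hc, fun v k₁ k₂ _ => ?_⟩
  rw [← magneticForm_congr h hc]
  have : ∫ p in rect L K, (0 : L2 L K) p * conj (v p) = ∫ p in rect L K, (0 : ℂ) :=
    integral_congr_ae (hc.mono fun p hp => by simp only [← hp, zero_mul])
  rw [this]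
  simp [magneticForm]

/-- The graph of the magnetic Laplacian. -/
def magneticLaplacianGraph (L K δ h : ℝ) : Submodule ℂ (L2 L K × L2 L K) where
  carrier := {q | IsMagneticLaplacian L K δ h q.1 q.2}
  zero_mem' := isMagneticLaplacian_zero L K δ h
  add_mem' {a b} ha hb := by
    have := isMagneticLaplacian_comb (1 : ℂ) ha hb
    rw [one_smul, one_smul] at this
    exact this
  smul_mem' c a ha := by
    have := isMagneticLaplacian_comb c ha (isMagneticLaplacian_zero L K δ h)
    rw [add_zero, add_zero] at this
    exact this

/-- The graph is single-valued. -/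
lemma magneticLaplacianGraph_single (L K δ h : ℝ) (q : L2 L K × L2 L K)
    (hq : q ∈ magneticLaplacianGraph L K δ h) (hq0 : q.1 = 0) : q.2 = 0 := by
  obtain ⟨u, w⟩ := q
  obtain ⟨g₁, g₂, hu, e⟩ := hq
  simp only at hq0 e hu
  subst hq0
  have hc : ⇑(0 : L2 L K) =ᵐ[rectMeasure L K] fun _ => (0 : ℂ) :=
    Lp.coeFn_zero ℂ 2 (rectMeasure L K)
  have hz : ∀ f : ℝ × ℝ → ℝ, ∫ p in rect L K, f p • (0 : L2 L K) p = 0 := fun f => by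
    rw [integral_congr_ae (g := fun _ => (0 : ℂ)) (hc.mono fun p hp => by simp only [hp, smul_zero])]
    simp
  have h1 : g₁ =ᵐ[rectMeasure L K] 0 := ae_eq_zero_of_test hu.grad.memLp_x fun ψ hψ => by
    have := hu.grad.weak_x ψ hψ
    rw [hz] at this
    exact neg_eq_zero.1 this.symm
  have h2 : g₂ =ᵐ[rectMeasure L K] 0 := ae_eq_zero_of_test hu.grad.memLp_y fun ψ hψ => by
    have := hu.grad.weak_y ψ hψ
    rw [hz] at this
    exact neg_eq_zero.1 this.symm
  have h3 : ⇑w =ᵐ[rectMeasure L K] 0 := ae_eq_zero_of_test (Lp.memLp w) fun ψ hψ => by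
    have hm := e _ _ _ hψ.inFormDomain
    have hm0 : magneticForm L K h (0 : L2 L K) g₁ g₂ (fun p => (ψ p : ℂ))
        (fun p => ((fderiv ℝ ψ p (1, 0) : ℝ) : ℂ)) (fun p => ((fderiv ℝ ψ p (0, 1) : ℝ) : ℂ)) =
        ∫ p in rect L K, (0 : ℂ) := by
      refine integral_congr_ae ?_
      filter_upwards [hc, h1, h2] with p a b c
      simp only [a, b, c, Pi.zero_apply, mul_zero, zero_mul, add_zero]
    rw [hm0, integral_zero, neg_zero] at hm
    rw [hm]
    refine integral_congr_ae (Filter.Eventually.of_forall fun p => ?_)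
    simp [mul_comm]
  exact (Lp.eq_zero_iff_ae_eq_zero).2 h3

/-- The operator `(∇ - i h A₀)²` in `L²` of the rectangle, with the Dirichlet condition on the leads
and the magnetic Neumann condition on the rest of the boundary. -/
def magneticLaplacian (L K δ h : ℝ) : L2 L K →ₗ.[ℂ] L2 L K :=
  (magneticLaplacianGraph L K δ h).toLinearPMap

/-- The definition of `magneticLaplacian` never falls back on a default value. -/
lemma magneticLaplacian_graph (L K δ h : ℝ) :
    (magneticLaplacian L K δ h).graph = magneticLaplacianGraph L K δ h :=
  Submodule.toLinearPMap_graph_eq _ (magneticLaplacianGraph_single L K δ h)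

/-! ### The operator `𝓛` -/

/-- The functions `u ∈ L²` for which `φ u ∈ L²`. -/
def potentialDomain (L K : ℝ) (φ : ℝ × ℝ → ℝ) : Submodule ℂ (L2 L K) where
  carrier := {u | MemLp (fun p => (φ p : ℂ) * u p) 2 (rectMeasure L K)}
  zero_mem' := by
    refine MemLp.ae_eq ?_ (MemLp.zero (ε := ℂ))
    filter_upwards [Lp.coeFn_zero ℂ 2 (rectMeasure L K)] with p hp
    simp only [hp, Pi.zero_apply, mul_zero]
  add_mem' {u v} hu hv := by
    refine MemLp.ae_eq ?_ (hu.add hv)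
    filter_upwards [Lp.coeFn_add u v] with p hp
    simp only [hp, Pi.add_apply, mul_add]
  smul_mem' c u hu := by
    refine MemLp.ae_eq ?_ (hu.const_mul c)
    filter_upwards [Lp.coeFn_smul c u] with p hp
    simp only [hp, Pi.smul_apply, smul_eq_mul]
    ring

/-- The operator of multiplication by `φ` in `L²`. -/
def potentialMul (L K : ℝ) (φ : ℝ × ℝ → ℝ) : L2 L K →ₗ.[ℂ] L2 L K where
  domain := potentialDomain L K φ
  toFun :=
    { toFun := fun u => MemLp.toLp (fun p => (φ p : ℂ) * (u : L2 L K) p) u.2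
      map_add' := fun u v => by
        refine Eq.trans ?_ (MemLp.toLp_add u.2 v.2)
        refine (MemLp.toLp_eq_toLp_iff _ _).2 ?_
        filter_upwards [Lp.coeFn_add (u : L2 L K) v] with p hp
        simp only [Submodule.coe_add, hp, Pi.add_apply, mul_add]
      map_smul' := fun c u => by
        refine Eq.trans ?_ (MemLp.toLp_const_smul c u.2)
        refine (MemLp.toLp_eq_toLp_iff _ _).2 ?_
        filter_upwards [Lp.coeFn_smul c (u : L2 L K)] with p hp
        simp only [Submodule.coe_smul, hp, Pi.smul_apply, smul_eq_mul]
        ring }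

/-- The operator `𝓛 u = (∇ - i h A₀)² u - i I φ u` in `L²` of the rectangle, with the mixed boundary
conditions. Its domain consists of the `u` in the domain of the magnetic Laplacian with
`φ u ∈ L²`. -/
def linearOp (L K δ h I : ℝ) (φ : ℝ × ℝ → ℝ) : L2 L K →ₗ.[ℂ] L2 L K :=
  magneticLaplacian L K δ h - (Complex.I * (I : ℂ)) • potentialMul L K φ

/-! ### Spectrum of an unbounded operator -/

/-- `z` is in the resolvent set of `T` when `z - T` has a bounded everywhere defined inverse. -/
def resolventSet {H : Type*} [NormedAddCommGroup H] [NormedSpace ℂ H] (T : H →ₗ.[ℂ] H) : Set ℂ :=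
  {z | ∃ R : H →L[ℂ] H, (∀ f : H, ∃ hf : R f ∈ T.domain, z • R f - T ⟨R f, hf⟩ = f) ∧
    ∀ u : T.domain, R (z • (u : H) - T u) = u}

/-- The spectrum of an unbounded operator. -/
def opSpectrum {H : Type*} [NormedAddCommGroup H] [NormedSpace ℂ H] (T : H →ₗ.[ℂ] H) : Set ℂ :=
  (resolventSet T)ᶜ

/-- The point spectrum: `T u = z u` for some nonzero `u` in the domain. -/
def pointSpectrum {H : Type*} [NormedAddCommGroup H] [NormedSpace ℂ H] (T : H →ₗ.[ℂ] H) : Set ℂ :=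
  {z | ∃ u : T.domain, (u : H) ≠ 0 ∧ T u = z • (u : H)}

/-- `(lam, u)` is an eigenpair of the problem `𝓛 u = -lam u`, with this sign convention. -/
def IsEigenpair (L K δ h I : ℝ) (φ : ℝ × ℝ → ℝ) (lam : ℂ) (u : L2 L K) : Prop :=
  u ≠ 0 ∧ ∃ hu : u ∈ (linearOp L K δ h I φ).domain, linearOp L K δ h I φ ⟨u, hu⟩ = -lam • u

/-! ### The PT reflection -/

lemma memLp_ptReflection {L K : ℝ} (u : L2 L K) :
    MemLp (fun p : ℝ × ℝ => conj (u (-p.1, p.2))) 2 (rectMeasure L K) := by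
  have hmp : MeasurePreserving (fun p : ℝ × ℝ => (-p.1, p.2)) (rectMeasure L K)
      (rectMeasure L K) := by
    have h := (Measure.measurePreserving_neg (volume : Measure ℝ)).prod
      (MeasurePreserving.id (volume : Measure ℝ))
    have h' := h.restrict_preimage (measurableSet_rect (L := L) (K := K))
    have hs : (Prod.map Neg.neg id) ⁻¹' rect L K = rect L K := by
      ext p
      simp only [rect, mem_preimage, mem_prod, Prod.map_fst, Prod.map_snd, id, mem_Ioo]
      constructor <;> rintro ⟨⟨a, b⟩, c⟩ <;> exact ⟨⟨by linarith, by linarith⟩, c⟩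
    rw [hs] at h'
    exact h'
  exact ((Lp.memLp u).comp_measurePreserving hmp).star

/-- The reflection `u†(x, y) = conj (u (-x, y))`. -/
def ptReflection {L K : ℝ} (u : L2 L K) : L2 L K :=
  MemLp.toLp (fun p : ℝ × ℝ => conj (u (-p.1, p.2))) (memLp_ptReflection u)

end GinzburgLandau

end

noncomputable section

open Matrix

namespace GinzburgLandau

/-! ### Schur triangularization -/

/-! Write `D = ∇ - i h A₀`. Give the form domain the inner product `⟨u, v⟩ + ∫ Du · conj (Dv)`, and
let `J` be its inclusion into `L²`. Then `T = J J*` (`magneticResolvent`) is the inverse of `1 -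
D²`. With `B` the bounded operator of multiplication by `i I φ⁰`, the equation `𝓛 u = -λ u` reads `T
(ρ u - B u) = u` with `ρ = 1 + λ` (`exists_isEigenpair_iff`). So `ρ` is an eigenvalue of `T⁻¹ + B`,
and the spectral claims concern this pencil. Since `T` is compact, the Fredholm alternative shows
that the spectrum is point spectrum (`opSpectrum_eq_pointSpectrum`) and that each disc contains
finitely many eigenvalues (`finite_pencilEigenvalues_inter`).

The hard point is that there are infinitely many eigenvalues, because `T⁻¹ + B` is not self-adjoint
(`infinite_pencilEigenvalues`). Let `t n` be the eigenvalues of `T`. Suppose all eigenvalues of the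
pencil lie in a disc. The eigenvalues of a large truncation to the first `N` eigenvectors of `T`
then lie in the same disc or extremely far out (`eventually_truncation_eigenvalue_notMem`). Compare
two values of the trace of `(A + s)⁻⁴` for the truncation `A` and a large shift `s`. As `B` is small
relative to `s`, the trace is at least half of `∑ ((t i)⁻¹ + s)⁻⁴`, which exceeds `m / (16 s⁴)` up
to a factor `1 / 2` for any prescribed `m`. As a sum over eigenvalues of `A`, it is at most a
constant over `s⁴`: Schur's inequality bounds the number of eigenvalues in the disc, and the far
ones contribute little. This is a contradiction for large `m`.

The argument needs `∑ t n ^ 2 < ∞`. It comes from comparing the form with the Neumann form in the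
cosine basis of the rectangle (`exists_hilbertBasis_eigenvectors_summable`,
`sum_inv_neumannWeight_mul_le`); in dimension two the weights `(1 + ξ² + η²)⁻¹` are square summable.
The cosine basis is complete by Stone–Weierstrass.

Testing the eigenvalue equation with `u` itself gives the bounds (`exists_energy_identity`). The
real part is positive because a function with zero magnetic gradient and zero trace on the leads
vanishes (`InFormDomain.eq_zero_of_gradient`). The bound on the imaginary part is strict because
`φ⁰` does not attain its supremum norm inside, by the strong maximum principle
(`WeaklyHarmonic.eq_of_isMax`). The explicit cosine coefficients of `φ⁰` are absolutely summable, so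
`φ⁰` is bounded and continuous; only odd modes in `x` occur, so it is odd in `x`, which yields the
PT symmetry. The eigenvalues lie in a horizontal strip, so each left half plane contains finitely
many and they can be listed by real part. -/

theorem exists_orthonormalBasis_triangular (n : ℕ) : ∀ {E : Type} [NormedAddCommGroup E]
    [InnerProductSpace ℂ E] [FiniteDimensional ℂ E], Module.finrank ℂ E = n →
    ∀ f : E →ₗ[ℂ] E, ∃ b : OrthonormalBasis (Fin n) ℂ E,
      ∀ i j, i < j → inner ℂ (b j) (f (b i)) = 0 := by
  induction n with
  | zero =>
    intro E _ _ _ h f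
    exact ⟨(stdOrthonormalBasis ℂ E).reindex (finCongr h), fun i => i.elim0⟩
  | succ n ih =>
    intro E _ _ _ h f
    have : Nontrivial E := Module.nontrivial_of_finrank_pos (R := ℂ) (by omega)
    -- An eigenvector of the adjoint rather than of `f`: its orthogonal complement is invariant
    -- under `f`, so the induction applies there and the eigenvector goes last.
    obtain ⟨μ, hμ⟩ := Module.End.exists_eigenvalue (LinearMap.adjoint f)
    obtain ⟨w, hw⟩ := hμ.exists_hasEigenvector
    set v : E := (‖w‖⁻¹ : ℂ) • w with hv
    have hvn : ‖v‖ = 1 := by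
      have := norm_ne_zero_iff.2 hw.2
      rw [hv, norm_smul, norm_inv, Complex.norm_real, norm_norm, inv_mul_cancel₀ this]
    have hv0 : v ≠ 0 := by rintro h0; simp [h0] at hvn
    have hvf : LinearMap.adjoint f v = μ • v := by
      rw [hv, map_smul, hw.apply_eq_smul, smul_comm]
    have hinv : ∀ x ∈ (ℂ ∙ v)ᗮ, f x ∈ (ℂ ∙ v)ᗮ := by
      intro x hx
      rw [Submodule.mem_orthogonal_singleton_iff_inner_right] at hx ⊢
      rw [← LinearMap.adjoint_inner_left, hvf, inner_smul_left, hx, mul_zero]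
    have : Fact (Module.finrank ℂ E = n + 1) := ⟨h⟩
    obtain ⟨b, hb⟩ := ih (Submodule.finrank_orthogonal_span_singleton hv0) (f.restrict hinv)
    set c : Fin (n + 1) → E := Fin.snoc (fun i => (b i : E)) v with hc
    have hbv : ∀ i, inner ℂ v (b i : E) = 0 := fun i =>
      (Submodule.mem_orthogonal_singleton_iff_inner_right).1 (b i).2
    have hcs : ∀ i : Fin n, c i.castSucc = b i := fun i => by simp [hc]
    have hcl : c (Fin.last n) = v := by simp [hc]
    have hco : Orthonormal ℂ c := by
      refine ⟨fun i => ?_, fun i j hij => ?_⟩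
      · induction i using Fin.lastCases with
        | last => rw [hcl, hvn]
        | cast i => rw [hcs]; exact b.orthonormal.1 i
      · induction i using Fin.lastCases with
        | last =>
          induction j using Fin.lastCases with
          | last => exact absurd rfl hij
          | cast j => rw [hcl, hcs]; exact hbv j
        | cast i =>
          induction j using Fin.lastCases with
          | last => rw [hcl, hcs]; exact inner_eq_zero_symm.1 (hbv i)
          | cast j =>
            rw [hcs, hcs]
            exact b.orthonormal.2 (fun h => hij (by rw [h]))
    have hcard : Fintype.card (Fin (n + 1)) = Module.finrank ℂ E := by simp [h]
    refine ⟨(basisOfOrthonormalOfCardEqFinrank hco hcard).toOrthonormalBasis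
      (by simpa using hco), fun i j hij => ?_⟩
    simp only [Module.Basis.coe_toOrthonormalBasis, coe_basisOfOrthonormalOfCardEqFinrank]
    induction i using Fin.lastCases with
    | last => exact absurd hij (not_lt.2 (Fin.le_last j))
    | cast i =>
      induction j using Fin.lastCases with
      | last =>
        rw [hcl, hcs]
        exact (Submodule.mem_orthogonal_singleton_iff_inner_right).1 (hinv _ (b i).2)
      | cast j =>
        rw [hcs, hcs]
        exact hb i j (by simpa using hij)

theorem exists_unitary_blockTriangular {n : ℕ} (A : Matrix (Fin n) (Fin n) ℂ) :
    ∃ U ∈ unitaryGroup (Fin n) ℂ, BlockTriangular (star U * A * U) id := by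
  obtain ⟨b, hb⟩ := exists_orthonormalBasis_triangular n
    (E := EuclideanSpace ℂ (Fin n)) (by simp) (toEuclideanLin A)
  refine ⟨(EuclideanSpace.basisFun (Fin n) ℂ).toBasis.toMatrix b,
    OrthonormalBasis.toMatrix_orthonormalBasis_mem_unitary _ _, fun j i hij => ?_⟩
  rw [← hb i j hij, Matrix.mul_assoc, Matrix.mul_apply, PiLp.inner_apply]
  refine Finset.sum_congr rfl fun k _ => ?_
  have : ((A * (EuclideanSpace.basisFun (Fin n) ℂ).toBasis.toMatrix b) k i) =
      (toEuclideanLin A (b i)) k := by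
    rw [Matrix.mul_apply]
    simp [Matrix.toLpLin_apply, Matrix.mulVec, dotProduct, Module.Basis.toMatrix_apply]
  rw [this, star_apply]
  simp [Module.Basis.toMatrix_apply, mul_comm]

theorem blockTriangular_smul_one {n : ℕ} (c : ℂ) :
    BlockTriangular (c • (1 : Matrix (Fin n) (Fin n) ℂ)) id := fun i j h => by
  rw [Matrix.smul_apply, one_apply_ne (show i ≠ j from ne_of_gt (show j < i from h)), smul_zero]

theorem blockTriangular_mul_diag {n : ℕ} {M N : Matrix (Fin n) (Fin n) ℂ}
    (hM : BlockTriangular M id) (hN : BlockTriangular N id) (j : Fin n) :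
    (M * N) j j = M j j * N j j := by
  rw [Matrix.mul_apply]
  refine Finset.sum_eq_single j (fun k _ hk => ?_) (by simp)
  rcases lt_or_gt_of_ne hk with h | h
  · rw [hM h, zero_mul]
  · rw [hN h, mul_zero]

/-! ### Frobenius norm estimates and the fourth trace of an inverse -/

section Frobenius

open scoped Matrix.Norms.Frobenius

theorem frobenius_norm_sq {n : ℕ} (X : Matrix (Fin n) (Fin n) ℂ) :
    ‖X‖ ^ 2 = ∑ i, ∑ j, ‖X i j‖ ^ 2 := by
  rw [frobenius_norm_def]
  have h0 : (0 : ℝ) ≤ ∑ i, ∑ j, ‖X i j‖ ^ (2 : ℝ) := by positivity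
  rw [← Real.rpow_natCast, ← Real.rpow_mul h0]
  norm_num

theorem frobenius_norm_sq_eq_trace {n : ℕ} (X : Matrix (Fin n) (Fin n) ℂ) :
    ((‖X‖ ^ 2 : ℝ) : ℂ) = trace (star X * X) := by
  rw [frobenius_norm_sq, trace, Finset.sum_comm]
  push_cast
  refine Finset.sum_congr rfl fun i _ => ?_
  rw [diag_apply, Matrix.mul_apply]
  refine Finset.sum_congr rfl fun j _ => ?_
  rw [star_apply, RCLike.star_def, ← Complex.normSq_eq_conj_mul_self, Complex.normSq_eq_norm_sq]
  simp

theorem norm_trace_mul_le {n : ℕ} (X Y : Matrix (Fin n) (Fin n) ℂ) :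
    ‖trace (X * Y)‖ ≤ ‖X‖ * ‖Y‖ := by
  have h1 : ‖trace (X * Y)‖ ≤ ∑ p : Fin n × Fin n, ‖X p.1 p.2‖ * ‖Y p.2 p.1‖ := by
    rw [trace, Fintype.sum_prod_type]
    refine (norm_sum_le _ _).trans (Finset.sum_le_sum fun i _ => ?_)
    rw [diag_apply, Matrix.mul_apply]
    refine (norm_sum_le _ _).trans (Finset.sum_le_sum fun j _ => (norm_mul _ _).le)
  refine h1.trans (abs_le_of_sq_le_sq' ?_ (by positivity)).2
  rw [mul_pow, frobenius_norm_sq, frobenius_norm_sq]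
  refine (Finset.sum_mul_sq_le_sq_mul_sq _ _ _).trans (le_of_eq ?_)
  rw [Fintype.sum_prod_type, Fintype.sum_prod_type]
  congr 1
  rw [Finset.sum_comm]

/-- `α` is the diagonal of a Schur form of `A`. Frobenius norm and trace are unitarily invariant,
and the inverse of a triangular matrix is triangular with reciprocal diagonal; hence Schur's
inequality and the trace formula. One list serves all shifts `s`, because a shift does not change
the Schur basis. -/
theorem exists_eigenvalue_list {n : ℕ} (A : Matrix (Fin n) (Fin n) ℂ) :
    ∃ α : Fin n → ℂ, (∀ j, ∃ v : Fin n → ℂ, v ≠ 0 ∧ A *ᵥ v = α j • v) ∧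
      ∀ (s : ℂ) (X : Matrix (Fin n) (Fin n) ℂ), (A + s • 1) * X = 1 →
        (∀ j, α j + s ≠ 0) ∧ ∑ j, ‖(α j + s)⁻¹‖ ^ 2 ≤ ‖X‖ ^ 2 ∧
          trace (X ^ 4) = ∑ j, ((α j + s)⁻¹) ^ 4 := by
  obtain ⟨U, hU, hT⟩ := exists_unitary_blockTriangular A
  set T := star U * A * U with hTdef
  have hUU : star U * U = 1 := mem_unitaryGroup_iff'.1 hU
  have hUU' : U * star U = 1 := mem_unitaryGroup_iff.1 hU
  have hA : A = U * T * star U := by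
    rw [hTdef]
    calc A = (U * star U) * A * (U * star U) := by rw [hUU']; simp
      _ = _ := by noncomm_ring
  refine ⟨fun j => T j j, fun j => ?_, fun s X hX => ?_⟩
  · have hdet : (T - (T j j) • (1 : Matrix (Fin n) (Fin n) ℂ)).det = 0 := by
      rw [det_of_isUpperTriangular (hT.sub (blockTriangular_smul_one _))]
      exact Finset.prod_eq_zero (Finset.mem_univ j) (by simp)
    obtain ⟨w, hw0, hw⟩ := exists_mulVec_eq_zero_iff.2 hdet
    refine ⟨U *ᵥ w, fun h => hw0 ?_, ?_⟩
    · rw [← one_mulVec w, ← hUU, ← mulVec_mulVec, h, mulVec_zero]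
    · rw [sub_mulVec, sub_eq_zero, smul_mulVec, one_mulVec] at hw
      rw [hA, ← mulVec_mulVec, ← mulVec_mulVec, mulVec_mulVec w (star U) U, hUU, one_mulVec, hw,
        mulVec_smul]
  · set Y := star U * X * U with hY
    have hTY : (T + s • 1) * Y = 1 := by
      have : T + s • 1 = star U * (A + s • 1) * U := by
        rw [mul_add, add_mul, hTdef]
        simp [hUU]
      rw [this, hY]
      calc _ = star U * (A + s • 1) * (U * star U) * X * U := by noncomm_ring
        _ = star U * ((A + s • 1) * X) * U := by rw [hUU']; noncomm_ring
        _ = 1 := by rw [hX, mul_one, hUU]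
    have hTs : BlockTriangular (T + s • 1) id := hT.add (blockTriangular_smul_one _)
    have hYT : BlockTriangular Y id := by
      let := invertibleOfRightInverse _ _ hTY
      have := blockTriangular_inv_of_blockTriangular hTs
      rwa [inv_eq_right_inv hTY] at this
    have hd : ∀ j, (T j j + s) * Y j j = 1 := fun j => by
      have := blockTriangular_mul_diag hTs hYT j
      rw [hTY] at this
      simpa using this.symm
    have hd' : ∀ j, (T j j + s)⁻¹ = Y j j := fun j => inv_eq_of_mul_eq_one_right (hd j)
    refine ⟨fun j h => by simpa [h] using hd j, ?_, ?_⟩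
    · have hXY : ‖X‖ ^ 2 = ‖Y‖ ^ 2 := by
        have : trace (star Y * Y) = trace (star X * X) := by
          rw [hY]
          simp only [star_mul, star_star]
          calc _ = trace (star U * (star X * (U * star U) * X * U)) := by
                simp only [mul_assoc]
            _ = trace (star X * X * (U * star U)) := by
                rw [trace_mul_comm, hUU', mul_one]
                simp only [mul_assoc, hUU', mul_one]
            _ = _ := by rw [hUU', mul_one]
        have h2 : ((‖Y‖ ^ 2 : ℝ) : ℂ) = ((‖X‖ ^ 2 : ℝ) : ℂ) := by
          rw [frobenius_norm_sq_eq_trace, frobenius_norm_sq_eq_trace, this]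
        exact (Complex.ofReal_injective h2).symm
      rw [hXY, frobenius_norm_sq]
      refine Finset.sum_le_sum fun j _ => ?_
      rw [hd']
      exact Finset.single_le_sum (f := fun k => ‖Y j k‖ ^ 2) (fun _ _ => by positivity)
        (Finset.mem_univ j)
    · have h4 : Y ^ 4 = star U * X ^ 4 * U := by
        have : Y ^ 4 = star U * X * (U * star U) * X * (U * star U) * X * (U * star U) * X * U := by
          rw [hY]; noncomm_ring
        rw [this, hUU']
        noncomm_ring
      have htr : trace (X ^ 4) = trace (Y ^ 4) := by
        rw [h4, trace_mul_comm, ← mul_assoc, hUU', one_mul]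
      rw [htr, trace]
      refine Finset.sum_congr rfl fun j _ => ?_
      have hY2 := hYT.mul hYT
      rw [diag_apply, hd', show Y ^ 4 = (Y * Y) * (Y * Y) by noncomm_ring,
        blockTriangular_mul_diag hY2 hY2, blockTriangular_mul_diag hYT hYT]
      ring

theorem frobenius_norm_sq_diagonal {n : ℕ} (g : Fin n → ℝ) :
    ‖diagonal fun i => (g i : ℂ)‖ ^ 2 = ∑ i, g i ^ 2 := by
  rw [frobenius_norm_sq]
  refine Finset.sum_congr rfl fun i _ => ?_
  rw [Finset.sum_eq_single i (fun j _ hj => by simp [diagonal_apply_ne _ hj.symm]) (by simp)]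
  simp

theorem frobenius_norm_diagonal_mul_le {n : ℕ} {g : Fin n → ℝ} {σ : ℝ} (hg : ∀ i, 0 < g i)
    (hσ : ∀ i, g i ≤ σ) (hσ0 : 0 ≤ σ) (M : Matrix (Fin n) (Fin n) ℂ) :
    ‖diagonal (fun i => (g i : ℂ)) * M‖ ≤ σ * ‖M‖ := by
  refine (abs_le_of_sq_le_sq' ?_ (by positivity)).2
  rw [mul_pow, frobenius_norm_sq, frobenius_norm_sq, Finset.mul_sum]
  refine Finset.sum_le_sum fun i _ => ?_
  rw [Finset.mul_sum]
  refine Finset.sum_le_sum fun j _ => ?_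
  rw [diagonal_mul, norm_mul, mul_pow, Complex.norm_real, Real.norm_of_nonneg (hg i).le]
  have := hg i
  have := hσ i
  gcongr

theorem frobenius_norm_mul_diagonal_le {n : ℕ} {g : Fin n → ℝ} {σ : ℝ} (hg : ∀ i, 0 < g i)
    (hσ : ∀ i, g i ≤ σ) (hσ0 : 0 ≤ σ) (M : Matrix (Fin n) (Fin n) ℂ) :
    ‖M * diagonal (fun i => (g i : ℂ))‖ ≤ σ * ‖M‖ := by
  refine (abs_le_of_sq_le_sq' ?_ (by positivity)).2
  rw [mul_pow, frobenius_norm_sq, frobenius_norm_sq, Finset.mul_sum]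
  refine Finset.sum_le_sum fun i _ => ?_
  rw [Finset.mul_sum]
  refine Finset.sum_le_sum fun j _ => ?_
  rw [mul_diagonal, norm_mul, mul_pow, Complex.norm_real, Real.norm_of_nonneg (hg j).le, mul_comm]
  have := hg j
  have := hσ j
  gcongr

/-- Two-sided weighting of a matrix by a positive diagonal is controlled by the one-sided ones. -/
theorem frobenius_norm_diagonal_mul_mul_diagonal_le {n : ℕ} {g : Fin n → ℝ} {ε : ℝ}
    (hε : 0 ≤ ε) {E : Matrix (Fin n) (Fin n) ℂ} (hl : ∀ M, ‖E * M‖ ≤ ε * ‖M‖)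
    (hr : ∀ M, ‖M * E‖ ≤ ε * ‖M‖) :
    ‖diagonal (fun i => (g i : ℂ)) * E * diagonal (fun i => (g i : ℂ))‖ ≤
      ε * ‖diagonal fun i => ((g i ^ 2 : ℝ) : ℂ)‖ := by
  refine (abs_le_of_sq_le_sq' ?_ (by positivity)).2
  have h1 := pow_le_pow_left₀ (norm_nonneg _) (hl (diagonal fun i => ((g i ^ 2 : ℝ) : ℂ))) 2
  have h2 := pow_le_pow_left₀ (norm_nonneg _) (hr (diagonal fun i => ((g i ^ 2 : ℝ) : ℂ))) 2
  have h3 : 2 * ‖diagonal (fun i => (g i : ℂ)) * E * diagonal (fun i => (g i : ℂ))‖ ^ 2 ≤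
      ‖E * diagonal fun i => ((g i ^ 2 : ℝ) : ℂ)‖ ^ 2 +
        ‖(diagonal fun i => ((g i ^ 2 : ℝ) : ℂ)) * E‖ ^ 2 := by
    rw [frobenius_norm_sq, frobenius_norm_sq, frobenius_norm_sq, Finset.mul_sum,
      ← Finset.sum_add_distrib]
    refine Finset.sum_le_sum fun i _ => ?_
    rw [Finset.mul_sum, ← Finset.sum_add_distrib]
    refine Finset.sum_le_sum fun j _ => ?_
    rw [mul_diagonal, mul_diagonal, diagonal_mul, diagonal_mul]
    simp only [norm_mul, Complex.norm_real, mul_pow, Real.norm_eq_abs, sq_abs]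
    -- This is `2 a² b² ≤ a⁴ + b⁴` for `a = g i`, `b = g j`, weighted by `‖E i j‖ ^ 2`.
    nlinarith [mul_nonneg (sq_nonneg ‖E i j‖) (sq_nonneg (g i ^ 2 - g j ^ 2))]
  linarith

/-- With `G = diagonal g`, the inverse of `G⁻¹ + B` is `G (1 + B G)⁻¹ = G (1 - E)`, where
multiplication by `E` is small from either side. So the square of the inverse is close to `G²`
relative to `‖G²‖`, and the trace of its fourth power is close to that of `G⁴`, which is `‖G²‖ ^ 2`.
The hypotheses on `B` are multiplication bounds because, for truncations of a bounded operator,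
these do not grow with `n`. -/
theorem exists_inverse_trace_pow_four_ge {n : ℕ} {g : Fin n → ℝ} {σ c : ℝ}
    (hg : ∀ i, 0 < g i) (hσ : ∀ i, g i ≤ σ) (hσ0 : 0 ≤ σ) (hc : 0 ≤ c) (hcσ : c * σ ≤ 1 / 50)
    {B : Matrix (Fin n) (Fin n) ℂ} (hl : ∀ M, ‖B * M‖ ≤ c * ‖M‖) (hr : ∀ M, ‖M * B‖ ≤ c * ‖M‖) :
    ∃ X, (diagonal (fun i => (((g i)⁻¹ : ℝ) : ℂ)) + B) * X = 1 ∧ ‖X‖ ^ 2 ≤ 4 * ∑ i, g i ^ 2 ∧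
      1 / 2 * ∑ i, g i ^ 4 ≤ ‖trace (X ^ 4)‖ := by
  set G : Matrix (Fin n) (Fin n) ℂ := diagonal fun i => (g i : ℂ) with hG
  have hBGl : ∀ M, ‖B * G * M‖ ≤ c * σ * ‖M‖ := fun M => by
    rw [mul_assoc, mul_assoc c]
    exact (hl _).trans (by gcongr; exact frobenius_norm_diagonal_mul_le hg hσ hσ0 M)
  have hBGr : ∀ M, ‖M * (B * G)‖ ≤ c * σ * ‖M‖ := fun M => by
    rw [← mul_assoc, mul_comm c, mul_assoc σ]
    exact (frobenius_norm_mul_diagonal_le hg hσ hσ0 _).trans (by gcongr; exact hr M)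
  obtain ⟨Y, hY⟩ : ∃ Y, (1 + B * G) * Y = 1 := by
    have hinj : Function.Injective (LinearMap.mulLeft ℂ (1 + B * G)) := by
      rw [injective_iff_map_eq_zero]
      intro M hM
      rw [LinearMap.mulLeft_apply, add_mul, one_mul] at hM
      have h1 := hBGl M
      rw [← norm_neg, ← eq_neg_of_add_eq_zero_left hM] at h1
      have h2 : ‖M‖ ≤ 1 / 50 * ‖M‖ := h1.trans (by gcongr)
      exact norm_eq_zero.1 (le_antisymm (by linarith) (norm_nonneg M))
    exact (LinearMap.injective_iff_surjective.1 hinj) 1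
  have hY' : Y * (1 + B * G) = 1 := mul_eq_one_comm.1 hY
  set E := B * G * Y with hE
  have hYE : Y = 1 - E := by rw [hE, eq_sub_iff_add_eq]; rw [add_mul, one_mul] at hY; exact hY
  have hE' : E = Y * (B * G) := by
    rw [mul_add, mul_one] at hY'
    rw [← sub_eq_iff_eq_add'.2 hY'.symm, hYE]
    abel
  -- `1 / 49` is the solution of `x = (1 + x) / 50`.
  have hEl : ∀ M, ‖E * M‖ ≤ 1 / 49 * ‖M‖ := fun M => by
    have h1 : ‖E * M‖ ≤ c * σ * ‖Y * M‖ := by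
      rw [hE, mul_assoc]; exact hBGl _
    have h2 : ‖Y * M‖ ≤ ‖M‖ + ‖E * M‖ := by
      rw [hYE, sub_mul, one_mul]; exact norm_sub_le _ _
    have h3 : c * σ * ‖Y * M‖ ≤ 1 / 50 * (‖M‖ + ‖E * M‖) := by gcongr
    linarith
  have hEr : ∀ M, ‖M * E‖ ≤ 1 / 49 * ‖M‖ := fun M => by
    have h1 : ‖M * E‖ ≤ c * σ * ‖M * Y‖ := by
      rw [hE', ← mul_assoc]; exact hBGr _
    have h2 : ‖M * Y‖ ≤ ‖M‖ + ‖M * E‖ := by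
      rw [hYE, mul_sub, mul_one]; exact norm_sub_le _ _
    have h3 : c * σ * ‖M * Y‖ ≤ 1 / 50 * (‖M‖ + ‖M * E‖) := by gcongr
    linarith
  have hGG : G * G = diagonal fun i => ((g i ^ 2 : ℝ) : ℂ) := by
    rw [hG, diagonal_mul_diagonal]; congr 1; ext i; push_cast; ring
  have hGinv : diagonal (fun i => (((g i)⁻¹ : ℝ) : ℂ)) * G = 1 := by
    rw [hG, diagonal_mul_diagonal, ← diagonal_one]
    congr 1; ext i
    rw [← Complex.ofReal_mul, inv_mul_cancel₀ (hg i).ne', Complex.ofReal_one]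
  have hX : G * Y = G - G * E := by rw [hYE, mul_sub, mul_one]
  refine ⟨G * Y, ?_, ?_, ?_⟩
  · rw [add_mul, ← mul_assoc, hGinv, ← mul_assoc, ← add_mul, hY]
  · have h1 : ‖G * Y‖ ≤ 2 * ‖G‖ := by
      rw [hX]
      have := hEr G
      have := norm_sub_le G (G * E)
      have := norm_nonneg G
      linarith
    have h2 := pow_le_pow_left₀ (norm_nonneg _) h1 2
    rw [mul_pow, hG, frobenius_norm_sq_diagonal] at h2
    linarith
  · set Q := G * G with hQ
    set P := (G * Y) * (G * Y) with hP
    have hq : ∑ i, g i ^ 4 = ‖Q‖ ^ 2 := by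
      rw [hGG, frobenius_norm_sq_diagonal]
      exact Finset.sum_congr rfl fun i _ => by ring
    have htq : ‖trace (Q * Q)‖ = ‖Q‖ ^ 2 := by
      have : star Q = Q := by
        rw [hGG, star_eq_conjTranspose, diagonal_conjTranspose]
        congr 1; ext i; simp
      have h := frobenius_norm_sq_eq_trace Q
      rw [this] at h
      rw [← h, Complex.norm_real, Real.norm_of_nonneg (by positivity)]
    -- Bounding one factor `G` by `σ` would leave a multiple of `σ * ‖G‖`, which `‖Q‖` does not
    -- control; hence the two-sided weighting lemma.
    have hGEG : ‖G * E * G‖ ≤ 1 / 49 * ‖Q‖ := by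
      rw [hGG]
      exact frobenius_norm_diagonal_mul_mul_diagonal_le (by norm_num) hEl hEr
    have hPQ : ‖P - Q‖ ≤ 3 / 49 * ‖Q‖ := by
      have : P - Q = G * E * G * E - Q * E - G * E * G := by
        rw [hP, hX, hQ]; noncomm_ring
      rw [this]
      have h1 := hEr (G * E * G)
      have h2 := hEr Q
      have h3 := norm_sub_le (G * E * G * E - Q * E) (G * E * G)
      have h4 := norm_sub_le (G * E * G * E) (Q * E)
      have := norm_nonneg Q
      linarith
    have hPn : ‖P‖ ≤ 52 / 49 * ‖Q‖ := by
      have : P = (P - Q) + Q := by abel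
      rw [this]
      refine (norm_add_le _ _).trans (by linarith)
    have hd : trace ((G * Y) ^ 4) = trace (Q * Q) + (trace (P * (P - Q)) + trace ((P - Q) * Q)) := by
      rw [← trace_add, ← trace_add, hP]
      congr 1
      noncomm_ring
    have h1 := norm_trace_mul_le P (P - Q)
    have h2 := norm_trace_mul_le (P - Q) Q
    have h3 : ‖P‖ * ‖P - Q‖ ≤ (52 / 49 * ‖Q‖) * (3 / 49 * ‖Q‖) := by gcongr
    have h4 : ‖P - Q‖ * ‖Q‖ ≤ (3 / 49 * ‖Q‖) * ‖Q‖ := by gcongr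
    have h5 : ‖trace (Q * Q)‖ ≤ ‖trace ((G * Y) ^ 4)‖ +
        (‖trace (P * (P - Q))‖ + ‖trace ((P - Q) * Q)‖) := by
      have : trace (Q * Q) = trace ((G * Y) ^ 4) - (trace (P * (P - Q)) + trace ((P - Q) * Q)) := by
        rw [hd]; ring
      rw [this]
      exact (norm_sub_le _ _).trans (by gcongr; exact norm_add_le _ _)
    rw [hq]
    nlinarith [sq_nonneg ‖Q‖]

end Frobenius
end GinzburgLandau

end

noncomputable section

open Matrix Filter Topology

namespace GinzburgLandau

/-! ### Finite truncations of the pencil and limits of their eigenvalues -/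

section Pencil

variable {H : Type*} [NormedAddCommGroup H] [InnerProductSpace ℂ H]

/-- The eigenvalues of the operator `T⁻¹ + B`, for an injective operator `T`. -/
def pencilEigenvalues (T B : H →L[ℂ] H) : Set ℂ := {ρ | ∃ u : H, u ≠ 0 ∧ T (ρ • u - B u) = u}

theorem norm_sq_sum_smul {ι : Type*} {b : ι → H} (hb : Orthonormal ℂ b) {κ : Type*} [Fintype κ]
    {f : κ → ι} (hf : Function.Injective f) (w : κ → ℂ) :
    ‖∑ i, w i • b (f i)‖ ^ 2 = ∑ i, ‖w i‖ ^ 2 := by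
  have h := (hb.comp f hf).inner_sum w w Finset.univ
  simp only [Function.comp_apply] at h
  have h2 := inner_self_eq_norm_sq_to_K (𝕜 := ℂ) (∑ i, w i • b (f i))
  rw [h] at h2
  have h3 : ((∑ i, ‖w i‖ ^ 2 : ℝ) : ℂ) = ((‖∑ i, w i • b (f i)‖ ^ 2 : ℝ) : ℂ) := by
    push_cast
    rw [← Complex.coe_algebraMap] at *
    rw [← h2]
    refine Finset.sum_congr rfl fun i _ => ?_
    rw [← Complex.normSq_eq_conj_mul_self, Complex.normSq_eq_norm_sq]
    simp
  exact (Complex.ofReal_injective h3).symm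

theorem norm_sum_inner_smul_le {b : ℕ → H} (hb : Orthonormal ℂ b) (N : ℕ) (z : H) :
    ‖∑ i : Fin N, inner ℂ (b i) z • b i‖ ≤ ‖z‖ := by
  refine (abs_le_of_sq_le_sq' ?_ (norm_nonneg _)).2
  rw [norm_sq_sum_smul hb Fin.val_injective]
  exact (hb.comp (fun i : Fin N => (i : ℕ)) Fin.val_injective).sum_inner_products_le z
    (s := Finset.univ)

/-- The truncation of an operator to the first `N` vectors of an orthonormal system. -/
noncomputable def truncation (b : ℕ → H) (B : H →L[ℂ] H) (N : ℕ) : Matrix (Fin N) (Fin N) ℂ :=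
  Matrix.of fun i j => inner ℂ (b i) (B (b j))

theorem truncation_mulVec (b : ℕ → H) (B : H →L[ℂ] H) (N : ℕ) (w : Fin N → ℂ) (i : Fin N) :
    (truncation b B N *ᵥ w) i = inner ℂ (b i) (B (∑ j, w j • b j)) := by
  simp only [mulVec, dotProduct, truncation, of_apply, map_sum, map_smul, inner_sum,
    inner_smul_right]
  exact Finset.sum_congr rfl fun j _ => mul_comm _ _

theorem tendsto_sum_inner_smul [CompleteSpace H] (b : HilbertBasis ℕ ℂ H) (z : H) :
    Tendsto (fun N : ℕ => ∑ i : Fin N, inner ℂ (b i) z • b i) atTop (𝓝 z) := by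
  have := (b.hasSum_repr z).tendsto_sum_nat
  simp only [b.repr_apply_apply] at this
  refine this.congr fun N => ?_
  rw [Finset.sum_range]

section Frobenius

open scoped Matrix.Norms.Frobenius

/-- Bessel's inequality in each column: the entries are the coefficients of `B` applied to the
vector that the column of `M` represents. -/
theorem truncation_mul_norm_le {b : ℕ → H} (hb : Orthonormal ℂ b) (B : H →L[ℂ] H) (N : ℕ)
    (M : Matrix (Fin N) (Fin N) ℂ) : ‖truncation b B N * M‖ ≤ ‖B‖ * ‖M‖ := by
  refine (abs_le_of_sq_le_sq' ?_ (by positivity)).2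
  rw [mul_pow, frobenius_norm_sq, frobenius_norm_sq, Finset.sum_comm,
    Finset.sum_comm (f := fun i j => ‖M i j‖ ^ 2), Finset.mul_sum]
  refine Finset.sum_le_sum fun j _ => ?_
  have h1 : ∀ i, (truncation b B N * M) i j =
      inner ℂ (b i) (B (∑ k, M k j • b k)) := fun i =>
    truncation_mulVec b B N (fun k => M k j) i
  simp only [h1]
  rw [← norm_sq_sum_smul hb Fin.val_injective (fun k => M k j), ← mul_pow]
  refine ((hb.comp (fun i : Fin N => (i : ℕ)) Fin.val_injective).sum_inner_products_le _
    (s := Finset.univ)).trans ?_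
  gcongr
  exact B.le_opNorm _

theorem mul_truncation_norm_le [CompleteSpace H] {b : ℕ → H} (hb : Orthonormal ℂ b)
    (B : H →L[ℂ] H) (N : ℕ) (M : Matrix (Fin N) (Fin N) ℂ) :
    ‖M * truncation b B N‖ ≤ ‖B‖ * ‖M‖ := by
  have h1 : (truncation b B N)ᴴ = truncation b (ContinuousLinearMap.adjoint B) N := by
    ext i j
    simp only [truncation, conjTranspose_apply, of_apply, RCLike.star_def, inner_conj_symm,
      ContinuousLinearMap.adjoint_inner_right]
  have h2 := truncation_mul_norm_le hb (ContinuousLinearMap.adjoint B) N Mᴴ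
  rwa [← h1, ← conjTranspose_mul, frobenius_norm_conjTranspose, frobenius_norm_conjTranspose,
    LinearIsometryEquiv.norm_map] at h2

end Frobenius

/-- Eigenvalues of the truncations of `T⁻¹ + B` do not lie in a compact set free of eigenvalues of
`T⁻¹ + B`, as soon as the truncation is large enough. -/
theorem eventually_truncation_eigenvalue_notMem [CompleteSpace H] {T B : H →L[ℂ] H}
    (hT : IsCompactOperator T) (b : HilbertBasis ℕ ℂ H) {t : ℕ → ℝ} (ht : ∀ n, 0 < t n)
    (hTb : ∀ n y, inner ℂ (b n) (T y) = t n * inner ℂ (b n) y) {S : Set ℂ} (hS : IsCompact S)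
    (hST : Disjoint S (pencilEigenvalues T B)) :
    ∃ N₀, ∀ N ≥ N₀, ∀ α ∈ S, ∀ v : Fin N → ℂ,
      (diagonal (fun i : Fin N => (((t i)⁻¹ : ℝ) : ℂ)) + truncation b B N) *ᵥ v = α • v →
        v = 0 := by
  by_contra! hcon
  choose N hN α hα v hv hv0 using hcon
  -- With `P` the projection onto the first `N k` basis vectors, a truncated eigenvector solves `x =
  -- P T (α x - B x)`. In this form compactness of `T` and of `S` yields a limit.
  have key : ∀ k, ∃ x : H, ‖x‖ = 1 ∧
      x = ∑ i : Fin (N k), inner ℂ (b i) (T (α k • x - B x)) • b i := by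
    intro k
    obtain ⟨x', hx'⟩ : ∃ x' : H, x' = ∑ i, v k i • b i := ⟨_, rfl⟩
    -- Row `i` of the eigenvalue equation, multiplied by `t i`.
    have hi : ∀ i : Fin (N k), v k i = inner ℂ (b i) (T (α k • x' - B x')) := by
      intro i
      have h1 := congrFun (hv k) i
      rw [add_mulVec, Pi.add_apply, mulVec_diagonal, truncation_mulVec, Pi.smul_apply,
        smul_eq_mul, ← hx'] at h1
      have h2 : inner ℂ (b i) x' = v k i :=
        hx' ▸ (b.orthonormal.comp (fun i : Fin (N k) => (i : ℕ)) Fin.val_injective).inner_right_fintype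
          (v k) i
      rw [hTb, inner_sub_right, inner_smul_right, h2]
      have h3 : (t i : ℂ) ≠ 0 := Complex.ofReal_ne_zero.2 (ht i).ne'
      push_cast at h1
      field_simp at h1
      linear_combination h1
    have hx0 : x' ≠ 0 := by
      intro h0
      have h4 := norm_sq_sum_smul b.orthonormal (Fin.val_injective (n := N k)) (v k)
      rw [← hx', h0, norm_zero] at h4
      refine hv0 k (funext fun i => ?_)
      have h5 := (Finset.sum_eq_zero_iff_of_nonneg (fun i _ => by positivity)).1
        (h4.symm.trans (by norm_num)) i (Finset.mem_univ i)
      simpa using h5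
    have hsc : ∀ c : ℂ, c • x' =
        ∑ i : Fin (N k), inner ℂ (b i) (T (α k • c • x' - B (c • x'))) • b i := by
      intro c
      conv_lhs => rw [hx']
      rw [Finset.smul_sum]
      refine Finset.sum_congr rfl fun i _ => ?_
      rw [hi i, smul_comm (α k), map_smul, ← smul_sub, map_smul, inner_smul_right, smul_smul]
    refine ⟨(‖x'‖⁻¹ : ℂ) • x', ?_, hsc _⟩
    rw [norm_smul, norm_inv, Complex.norm_real, norm_norm, inv_mul_cancel₀ (norm_ne_zero_iff.2 hx0)]
  choose x hx1 hx2 using key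
  obtain ⟨R, hR⟩ := hS.isBounded.exists_norm_le
  obtain ⟨C, hC, hC'⟩ := hT.image_closedBall_subset_compact (R + ‖B‖)
  have hmem : ∀ k, T (α k • x k - B (x k)) ∈ C := fun k => hC' ⟨_, by
    rw [mem_closedBall_zero_iff]
    refine (norm_sub_le _ _).trans (add_le_add ?_ ?_)
    · rw [norm_smul, hx1, mul_one]; exact hR _ (hα k)
    · simpa [hx1] using B.le_opNorm (x k), rfl⟩
  obtain ⟨⟨y, a⟩, hy, φ, hφ, hlim⟩ := (hC.prod hS).tendsto_subseq
    (x := fun k => (T (α k • x k - B (x k)), α k)) (fun k => ⟨hmem k, hα k⟩)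
  have hy1 := (continuous_fst.tendsto _).comp hlim
  have ha := (continuous_snd.tendsto _).comp hlim
  have hNφ : Tendsto (fun k => N (φ k)) atTop atTop :=
    tendsto_atTop_mono (fun k => (hφ.le_apply).trans (hN (φ k))) tendsto_id
  -- `x (φ k)` is the projection of a sequence tending to `y`; the projections are contractions and
  -- converge strongly to the identity.
  have hxy : Tendsto (fun k => x (φ k)) atTop (𝓝 y) := by
    have h1 := (tendsto_sum_inner_smul b y).comp hNφ
    have h2 : Tendsto (fun k => x (φ k) - ∑ i : Fin (N (φ k)), inner ℂ (b i) y • b i) atTop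
        (𝓝 0) := by
      refine squeeze_zero_norm (a := fun k => ‖T (α (φ k) • x (φ k) - B (x (φ k))) - y‖)
        (fun k => ?_) ?_
      · conv_lhs => rw [hx2 (φ k)]
        rw [← Finset.sum_sub_distrib]
        simp only [← sub_smul, ← inner_sub_right]
        exact norm_sum_inner_smul_le b.orthonormal _ _
      · exact tendsto_iff_norm_sub_tendsto_zero.1 hy1
    simpa using h2.add h1
  refine Set.disjoint_left.1 hST hy.2 ⟨y, ?_, ?_⟩
  · rintro h0
    have h1 := hxy.norm
    simp only [hx1] at h1
    have h2 := tendsto_nhds_unique h1 tendsto_const_nhds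
    rw [show y = 0 from h0, norm_zero] at h2
    exact zero_ne_one h2
  · refine tendsto_nhds_unique ?_ hy1
    have : Tendsto (fun k => T (α (φ k) • x (φ k) - B (x (φ k)))) atTop (𝓝 (T (a • y - B y))) :=
      (T.continuous.tendsto _).comp ((ha.smul hxy).sub ((B.continuous.tendsto _).comp hxy))
    exact this

end Pencil
end GinzburgLandau

end

noncomputable section

open Matrix Filter Topology

namespace GinzburgLandau
-- Infinitely many eigenvalues of the pencil
section Pencil
variable {H : Type*} [NormedAddCommGroup H] [InnerProductSpace ℂ H]

/-- Near eigenvalues satisfy `‖α + s‖ ≥ s / 2`, and the factor `(R₀ + s₀) ^ 2 * ‖(α + s₀)⁻¹‖ ^ 2`,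
which is at least `1`, counts them with a weight independent of `s`. For far eigenvalues, two of the
four inverse factors are traded for `1 / r`. -/
theorem norm_inv_pow_four_le {R₀ s₀ s r : ℝ} (hs₀0 : 0 < s₀) (hs0 : 0 < s) (hsR : 2 * R₀ ≤ s)
    (hr1 : 1 ≤ r) {α : ℂ} (hne : α + s₀ ≠ 0) (h : ‖α‖ < R₀ ∨ s + r < ‖α‖) :
    ‖((α + s)⁻¹) ^ 4‖ ≤
      16 / s ^ 4 * (R₀ + s₀) ^ 2 * ‖(α + s₀)⁻¹‖ ^ 2 + 1 / r * ‖(α + s)⁻¹‖ ^ 2 := by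
  rw [norm_pow]
  rcases h with h | h
  · have h1 : s / 2 ≤ ‖α + s‖ := by
      have := norm_sub_norm_le (s : ℂ) (-α)
      rw [sub_neg_eq_add, norm_neg, Complex.norm_real, Real.norm_of_nonneg hs0.le, add_comm] at this
      linarith
    have h2 : ‖α + s₀‖ ≤ R₀ + s₀ := by
      refine (norm_add_le _ _).trans ?_
      rw [Complex.norm_real, Real.norm_of_nonneg hs₀0.le]
      linarith
    have h3 : 1 ≤ (R₀ + s₀) ^ 2 * ‖(α + s₀)⁻¹‖ ^ 2 := by
      rw [← mul_pow]
      refine one_le_pow₀ ?_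
      rw [norm_inv, ← div_eq_mul_inv, one_le_div (norm_pos_iff.2 (hne))]
      exact h2
    have h4 : ‖(α + s)⁻¹‖ ≤ (s / 2)⁻¹ := by
      rw [norm_inv]; exact inv_anti₀ (by positivity) h1
    have h5 : ‖(α + s)⁻¹‖ ^ 4 ≤ 16 / s ^ 4 := by
      calc _ ≤ ((s / 2)⁻¹) ^ 4 := by gcongr
        _ = _ := by field_simp; norm_num
    have h6 : 16 / s ^ 4 ≤ 16 / s ^ 4 * ((R₀ + s₀) ^ 2 * ‖(α + s₀)⁻¹‖ ^ 2) :=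
      le_mul_of_one_le_right (by positivity) h3
    have h7 : 0 ≤ 1 / r * ‖(α + s)⁻¹‖ ^ 2 := by positivity
    rw [mul_assoc]
    linarith
  · have h1 : r ≤ ‖α + s‖ := by
      have := norm_sub_norm_le (α) (-s : ℂ)
      rw [sub_neg_eq_add, norm_neg, Complex.norm_real, Real.norm_of_nonneg hs0.le] at this
      linarith
    have h2 : ‖(α + s)⁻¹‖ ≤ 1 := by
      rw [norm_inv]; exact inv_le_one_of_one_le₀ (hr1.trans h1)
    have h3 : ‖(α + s)⁻¹‖ ≤ 1 / r := by
      rw [norm_inv, one_div]; exact inv_anti₀ (by linarith) h1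
    have h4 : ‖(α + s)⁻¹‖ ^ 2 ≤ 1 / r := by
      rw [sq]
      calc _ ≤ 1 / r * 1 := by gcongr
        _ = _ := mul_one _
    have h5 : 0 ≤ 16 / s ^ 4 * (R₀ + s₀) ^ 2 * ‖(α + s₀)⁻¹‖ ^ 2 := by positivity
    have h6 : ‖(α + s)⁻¹‖ ^ 4 = ‖(α + s)⁻¹‖ ^ 2 * ‖(α + s)⁻¹‖ ^ 2 := by ring
    have h7 : ‖(α + s)⁻¹‖ ^ 2 * ‖(α + s)⁻¹‖ ^ 2 ≤ 1 / r * ‖(α + s)⁻¹‖ ^ 2 := by gcongr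
    linarith

-- The order of the choices matters: `R₀` encloses all supposed eigenvalues, `s₀` fixes a counting
-- shift, `M` bounds the number of truncated eigenvalues in the disc, and only then come `m`, the
-- shift `s`, the outer radius `s + r` and the truncation size `N`. The fourth power of the inverse
-- leaves a square to be summed after the factor `1 / r` has been split off.
open scoped Matrix.Norms.Frobenius in
theorem infinite_pencilEigenvalues [CompleteSpace H] {T : H →L[ℂ] H} (B : H →L[ℂ] H)
    (hT : IsCompactOperator T) (b : HilbertBasis ℕ ℂ H) {t : ℕ → ℝ} (ht : ∀ n, 0 < t n)
    (hTb : ∀ n y, inner ℂ (b n) (T y) = t n * inner ℂ (b n) y)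
    (hsum : Summable fun n => t n ^ 2) : (pencilEigenvalues T B).Infinite := by
  intro hfin
  obtain ⟨R₁, hR₁⟩ := hfin.isBounded.exists_norm_le
  set R₀ : ℝ := |R₁| + 1 with hR₀
  have hR₀0 : 0 < R₀ := by positivity
  have hEV : ∀ ρ ∈ pencilEigenvalues T B, ‖ρ‖ < R₀ := fun ρ hρ =>
    lt_of_le_of_lt ((hR₁ ρ hρ).trans (le_abs_self _)) (lt_add_one _)
  set c := ‖B‖ with hc
  have hc0 : 0 ≤ c := norm_nonneg _
  -- The factor `50` meets the smallness condition `c * s₀⁻¹ ≤ 1 / 50` of the trace estimate, and so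
  -- for every larger shift.
  set s₀ : ℝ := 50 * c + 1 with hs₀
  have hs₀0 : 0 < s₀ := by positivity
  set S₂ : ℝ := ∑' n, t n ^ 2 with hS₂
  have hS₂0 : 0 ≤ S₂ := tsum_nonneg fun n => sq_nonneg _
  set M : ℝ := (R₀ + s₀) ^ 2 * (4 * S₂) with hM
  -- `M` does not involve `s`, so `s` may be chosen after `m`, above the first `m` numbers `(t
  -- n)⁻¹`.
  obtain ⟨m, hm⟩ := exists_nat_gt (32 * (16 * M + 1))
  set s : ℝ := s₀ + 2 * R₀ + ∑ n ∈ Finset.range m, (t n)⁻¹ with hs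
  have hsn : 0 ≤ ∑ n ∈ Finset.range m, (t n)⁻¹ :=
    Finset.sum_nonneg fun n _ => (inv_pos.2 (ht n)).le
  have hs0 : 0 < s := by positivity
  have hsR : 2 * R₀ ≤ s := by linarith
  have hst : ∀ n < m, (t n)⁻¹ ≤ s := fun n hn => by
    have := Finset.single_le_sum (f := fun n => (t n)⁻¹) (fun n _ => (inv_pos.2 (ht n)).le)
      (Finset.mem_range.2 hn)
    linarith
  -- Chosen so that the far eigenvalues contribute at most `4 * S₂ / r ≤ 1 / s ^ 4`.
  set r : ℝ := 1 + 4 * S₂ * s ^ 4 with hr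
  have hr1 : 1 ≤ r := by rw [hr]; linarith [show 0 ≤ 4 * S₂ * s ^ 4 by positivity]
  obtain ⟨N₀, hN₀⟩ := eventually_truncation_eigenvalue_notMem (B := B) hT b ht hTb
    (S := {z | R₀ ≤ ‖z‖ ∧ ‖z‖ ≤ s + r})
    (by
      have : {z : ℂ | R₀ ≤ ‖z‖ ∧ ‖z‖ ≤ s + r} = Metric.closedBall 0 (s + r) ∩ {z | R₀ ≤ ‖z‖} := by
        ext z; simp [and_comm]
      rw [this]
      exact (isCompact_closedBall _ _).inter_right (isClosed_le continuous_const continuous_norm))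
    (Set.disjoint_left.2 fun z hz hz' => absurd (hEV z hz') (not_lt.2 hz.1))
  set N := max N₀ m with hN
  set A : Matrix (Fin N) (Fin N) ℂ :=
    diagonal (fun i : Fin N => (((t i)⁻¹ : ℝ) : ℂ)) + truncation b B N with hA
  obtain ⟨α, hα1, hα2⟩ := exists_eigenvalue_list A
  have hαj : ∀ j, ‖α j‖ < R₀ ∨ s + r < ‖α j‖ := by
    intro j
    by_contra! h
    obtain ⟨v, hv0, hv⟩ := hα1 j
    exact hv0 (hN₀ N (le_max_left _ _) (α j) h v hv)
  have key : ∀ a : ℝ, 50 * c ≤ a → 0 < a → ∃ X, (A + (a : ℂ) • 1) * X = 1 ∧ ‖X‖ ^ 2 ≤ 4 * S₂ ∧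
      1 / 2 * ∑ i : Fin N, (((t i)⁻¹ + a)⁻¹) ^ 4 ≤ ‖trace (X ^ 4)‖ := by
    intro a ha ha0
    have hg : ∀ i : Fin N, 0 < ((t i)⁻¹ + a)⁻¹ := fun i => by have := ht i; positivity
    have hga : ∀ i : Fin N, ((t i)⁻¹ + a)⁻¹ ≤ a⁻¹ := fun i => by
      have := ht i
      exact inv_anti₀ ha0 (by linarith [inv_pos.2 this])
    have hca : c * a⁻¹ ≤ 1 / 50 := by
      rw [← div_eq_mul_inv, div_le_iff₀ ha0]; linarith
    obtain ⟨X, hX1, hX2, hX3⟩ := exists_inverse_trace_pow_four_ge hg hga (inv_pos.2 ha0).le hc0 hca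
      (truncation_mul_norm_le b.orthonormal B N) (mul_truncation_norm_le b.orthonormal B N)
    refine ⟨X, ?_, hX2.trans ?_, hX3⟩
    · refine Eq.trans ?_ hX1
      rw [hA]
      congr 1
      rw [smul_one_eq_diagonal, add_right_comm, diagonal_add]
      congr 2
      ext i
      rw [inv_inv]; push_cast; rfl
    · have h1 : ∑ i : Fin N, (((t i)⁻¹ + a)⁻¹) ^ 2 ≤ ∑ i : Fin N, t i ^ 2 := by
        refine Finset.sum_le_sum fun i _ => ?_
        have := ht i
        have h2 : ((t i)⁻¹ + a)⁻¹ ≤ t i := inv_le_of_inv_le₀ this (by linarith)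
        have := hg i
        gcongr
      have h2 : ∑ i : Fin N, t i ^ 2 ≤ S₂ := by
        rw [← Finset.sum_range (fun i => t i ^ 2)]
        exact hsum.sum_le_tsum _ fun n _ => sq_nonneg _
      linarith
  obtain ⟨X₀, hX₀1, hX₀2, -⟩ := key s₀ (by linarith) hs₀0
  obtain ⟨X, hX1, hX2, hX3⟩ := key s (by linarith) hs0
  obtain ⟨h₀ne, h₀sum, -⟩ := hα2 s₀ X₀ hX₀1
  obtain ⟨hne, hsumX, htr⟩ := hα2 s X hX1
  have hterm : ∀ j, ‖((α j + s)⁻¹) ^ 4‖ ≤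
      16 / s ^ 4 * (R₀ + s₀) ^ 2 * ‖(α j + s₀)⁻¹‖ ^ 2 + 1 / r * ‖(α j + s)⁻¹‖ ^ 2 := by
    exact fun j => norm_inv_pow_four_le hs₀0 hs0 hsR hr1 (h₀ne j) (hαj j)
  have hupper : ‖trace (X ^ 4)‖ ≤ (16 * M + 1) / s ^ 4 := by
    rw [htr]
    refine (norm_sum_le _ _).trans ((Finset.sum_le_sum fun j _ => hterm j).trans ?_)
    rw [Finset.sum_add_distrib, ← Finset.mul_sum, ← Finset.mul_sum]
    have h1 : 16 / s ^ 4 * (R₀ + s₀) ^ 2 * ∑ j, ‖(α j + s₀)⁻¹‖ ^ 2 ≤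
        16 / s ^ 4 * (R₀ + s₀) ^ 2 * (4 * S₂) := by
      gcongr; exact h₀sum.trans hX₀2
    have h2 : 1 / r * ∑ j, ‖(α j + s)⁻¹‖ ^ 2 ≤ 1 / r * (4 * S₂) := by
      gcongr; exact hsumX.trans hX2
    have h3 : 1 / r * (4 * S₂) ≤ 1 / s ^ 4 := by
      rw [one_div_mul_eq_div, div_le_div_iff₀ (by positivity) (by positivity)]
      linarith
    have h4 : 16 / s ^ 4 * (R₀ + s₀) ^ 2 * (4 * S₂) + 1 / s ^ 4 = (16 * M + 1) / s ^ 4 := by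
      rw [hM]; ring
    linarith
  -- Each of the first `m` terms is at least `(2 * s)⁻¹ ^ 4`; this is where `N ≥ m` is used.
  have hlower : m / (32 * s ^ 4) ≤ 1 / 2 * ∑ i : Fin N, (((t i)⁻¹ + s)⁻¹) ^ 4 := by
    rw [← Finset.sum_range (fun i => (((t i)⁻¹ + s)⁻¹) ^ 4)]
    have h1 : ∑ i ∈ Finset.range m, ((2 * s)⁻¹) ^ 4 ≤
        ∑ i ∈ Finset.range m, (((t i)⁻¹ + s)⁻¹) ^ 4 := by
      refine Finset.sum_le_sum fun i hi => ?_
      have := ht i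
      have h2 := hst i (Finset.mem_range.1 hi)
      have h3 : (2 * s)⁻¹ ≤ ((t i)⁻¹ + s)⁻¹ := inv_anti₀ (by positivity) (by linarith)
      gcongr
    have h2 : ∑ i ∈ Finset.range m, (((t i)⁻¹ + s)⁻¹) ^ 4 ≤
        ∑ i ∈ Finset.range N, (((t i)⁻¹ + s)⁻¹) ^ 4 :=
      Finset.sum_le_sum_of_subset_of_nonneg
        (Finset.range_mono (le_max_right _ _)) fun i _ _ => by have := ht i; positivity
    rw [Finset.sum_const, Finset.card_range, nsmul_eq_mul] at h1
    have h3 : (m : ℝ) / (32 * s ^ 4) = 1 / 2 * (m * ((2 * s)⁻¹) ^ 4) := by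
      field_simp; norm_num
    rw [h3]
    linarith
  have hfinal := hlower.trans (hX3.trans hupper)
  rw [div_le_div_iff₀ (by positivity) (by positivity)] at hfinal
  have h5 : (m : ℝ) * s ^ 4 ≤ (32 * (16 * M + 1)) * s ^ 4 := by linarith
  exact absurd hm (not_lt.2 (le_of_mul_le_mul_right h5 (by positivity)))

end Pencil
end GinzburgLandau

end

noncomputable section

open Matrix Filter Topology

namespace GinzburgLandau

/-! ### Discreteness of the eigenvalues -/

section Discrete

variable {H : Type*} [NormedAddCommGroup H] [InnerProductSpace ℂ H]

-- The argument of Riesz. Gram–Schmidt applied to eigenvectors of infinitely many eigenvalues gives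
-- orthonormal `y n` with `T (y n) - κ n • y n` in the span of the earlier eigenvectors. The images
-- `T (y n)` are then `ε`-separated, against compactness.
open InnerProductSpace in
theorem finite_eigenvalues_of_isCompactOperator {T : H →L[ℂ] H} (hT : IsCompactOperator T)
    {ε : ℝ} (hε : 0 < ε) : {κ : ℂ | ε ≤ ‖κ‖ ∧ ∃ u, u ≠ 0 ∧ T u = κ • u}.Finite := by
  by_contra hinf
  set κ := Set.Infinite.natEmbedding _ hinf with hκ
  have hκε : ∀ n, ε ≤ ‖(κ n : ℂ)‖ := fun n => (κ n).2.1
  choose u hu0 hu using fun n => (κ n).2.2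
  have hlin : LinearIndependent ℂ u := Module.End.eigenvectors_linearIndependent'
    (T : Module.End ℂ H) (fun n => (κ n : ℂ)) (Subtype.val_injective.comp κ.injective) u
    fun n => ⟨Module.End.mem_eigenspace_iff.2 (hu n), hu0 n⟩
  set y := gramSchmidtNormed ℂ u with hy
  have hyo : Orthonormal ℂ y := gramSchmidtNormed_orthonormal hlin
  have hspan : ∀ s, Submodule.span ℂ (y '' s) = Submodule.span ℂ (gramSchmidt ℂ u '' s) :=
    span_gramSchmidtNormed u
  have hyIic : ∀ n, y n ∈ Submodule.span ℂ (u '' Set.Iic n) := fun n => by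
    rw [← span_gramSchmidt_Iic, ← hspan]
    exact Submodule.subset_span ⟨n, Set.self_mem_Iic, rfl⟩
  have horth : ∀ n, ∀ x ∈ Submodule.span ℂ (u '' Set.Iio n), inner ℂ (y n) x = 0 := by
    intro n x hx
    rw [← span_gramSchmidt_Iio, ← hspan] at hx
    induction hx using Submodule.span_induction with
    | mem x hx => obtain ⟨k, hk, rfl⟩ := hx; exact hyo.2 (ne_of_gt hk)
    | zero => simp
    | add a b _ _ ha hb => rw [inner_add_right, ha, hb, add_zero]
    | smul c a _ ha => rw [inner_smul_right, ha, mul_zero]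
  have hT1 : ∀ n, T (y n) - (κ n : ℂ) • y n ∈ Submodule.span ℂ (u '' Set.Iio n) := by
    intro n
    suffices ∀ x ∈ Submodule.span ℂ (u '' Set.Iic n),
        T x - (κ n : ℂ) • x ∈ Submodule.span ℂ (u '' Set.Iio n) from this _ (hyIic n)
    intro x hx
    induction hx using Submodule.span_induction with
    | mem x hx =>
      obtain ⟨k, hk, rfl⟩ := hx
      rw [hu, ← sub_smul]
      rcases eq_or_lt_of_le (Set.mem_Iic.1 hk) with h | h
      · subst h; simp
      · exact Submodule.smul_mem _ _ (Submodule.subset_span ⟨k, h, rfl⟩)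
    | zero => simp
    | add a b _ _ ha hb =>
      rw [map_add, smul_add, add_sub_add_comm]
      exact Submodule.add_mem _ ha hb
    | smul c a _ ha =>
      rw [map_smul, smul_comm, ← smul_sub]
      exact Submodule.smul_mem _ _ ha
  have hT2 : ∀ m n, m < n → T (y m) ∈ Submodule.span ℂ (u '' Set.Iio n) := by
    intro m n hmn
    have h1 : Submodule.span ℂ (u '' Set.Iic m) ≤ Submodule.span ℂ (u '' Set.Iio n) :=
      Submodule.span_mono (Set.image_mono fun k hk => lt_of_le_of_lt hk hmn)
    have h2 : Submodule.span ℂ (u '' Set.Iio m) ≤ Submodule.span ℂ (u '' Set.Iio n) :=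
      Submodule.span_mono (Set.image_mono fun k hk => lt_trans hk hmn)
    have := Submodule.add_mem _ (h2 (hT1 m)) (Submodule.smul_mem _ (κ m : ℂ) (h1 (hyIic m)))
    simpa using this
  have hsep : ∀ m n, m < n → ε ≤ ‖T (y n) - T (y m)‖ := by
    intro m n hmn
    have h1 : inner ℂ (y n) (T (y n) - T (y m)) = κ n := by
      have : T (y n) - T (y m) = (T (y n) - (κ n : ℂ) • y n) - T (y m) + (κ n : ℂ) • y n := by abel
      rw [this, inner_add_right, inner_sub_right, horth n _ (hT1 n), horth n _ (hT2 m n hmn),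
        inner_smul_right, inner_self_eq_norm_sq_to_K, hyo.1 n]
      simp
    have h2 := norm_inner_le_norm (𝕜 := ℂ) (y n) (T (y n) - T (y m))
    rw [h1, hyo.1 n, one_mul] at h2
    exact (hκε n).trans h2
  obtain ⟨C, hC, hC'⟩ := hT.image_closedBall_subset_compact 1
  obtain ⟨z, -, φ, hφ, hlim⟩ := hC.tendsto_subseq (x := fun n => T (y n))
    (fun n => hC' ⟨y n, by simp [hyo.1 n], rfl⟩)
  obtain ⟨N, hN⟩ := Metric.cauchySeq_iff'.1 hlim.cauchySeq ε hε
  have h1 := hN (N + 1) (Nat.le_succ _)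
  rw [dist_eq_norm] at h1
  exact absurd (hsep _ _ (hφ (Nat.lt_succ_self N))) (not_le.2 h1)

/-- Fredholm alternative: `1` is either an eigenvalue of the compact operator or in its resolvent
set. -/
theorem exists_inverse_of_isCompactOperator [CompleteSpace H] {K : H →L[ℂ] H}
    (hK : IsCompactOperator K) (h0 : ∀ u, K u = u → u = 0) :
    ∃ S : H →L[ℂ] H, (∀ u, S u - K (S u) = u) ∧ ∀ u, S (u - K u) = u := by
  have h1 : (1 : ℂ) ∈ _root_.resolventSet ℂ K := by
    refine (hK.hasEigenvalue_or_mem_resolventSet one_ne_zero).resolve_left fun h => ?_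
    obtain ⟨v, hv⟩ := h.exists_hasEigenvector
    refine hv.2 (h0 v ?_)
    have := hv.apply_eq_smul
    rwa [one_smul] at this
  rw [spectrum.mem_resolventSet_iff, map_one] at h1
  obtain ⟨S, hS⟩ := h1
  refine ⟨(S⁻¹ : (H →L[ℂ] H)ˣ), fun u => ?_, fun u => ?_⟩
  · have := congrArg (fun A : H →L[ℂ] H => A u) S.mul_inv
    rw [hS] at this
    simpa using this
  · have := congrArg (fun A : H →L[ℂ] H => A u) S.inv_mul
    rw [hS] at this
    simpa using this

/-- If `0` is no eigenvalue of the pencil, `1 + T B` has a bounded inverse `S`. The equation `T (ρ u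
- B u) = u` becomes `S T u = ρ⁻¹ u`, and the compact operator `S T` has finitely many eigenvalues
away from zero. -/
theorem finite_pencilEigenvalues_inter [CompleteSpace H] {T B : H →L[ℂ] H}
    (hT : IsCompactOperator T) (h0 : 0 ∉ pencilEigenvalues T B) (R : ℝ) :
    {ρ ∈ pencilEigenvalues T B | ‖ρ‖ ≤ R}.Finite := by
  have h1 : ∀ u, -(T (B u)) = u → u = 0 := fun u hu => by
    by_contra hu0
    exact h0 ⟨u, hu0, by simpa using hu⟩
  obtain ⟨S, -, hS⟩ := exists_inverse_of_isCompactOperator (K := -(T ∘L B))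
    (hT.comp_clm B).neg (fun u hu => h1 u (by simpa using hu))
  have hST : IsCompactOperator (S ∘L T) := hT.clm_comp S
  have hR : 0 < |R| + 1 := by positivity
  refine ((finite_eigenvalues_of_isCompactOperator hST (inv_pos.2 hR)).image (·⁻¹)).subset ?_
  rintro ρ ⟨⟨u, hu0, hu⟩, hρ⟩
  have hρ0 : ρ ≠ 0 := by rintro rfl; exact h0 ⟨u, hu0, hu⟩
  refine ⟨ρ⁻¹, ⟨?_, u, hu0, ?_⟩, inv_inv ρ⟩
  · rw [norm_inv]
    exact inv_anti₀ (norm_pos_iff.2 hρ0) (by linarith [le_abs_self R])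
  · rw [eq_inv_smul_iff₀ hρ0, ContinuousLinearMap.comp_apply, ← map_smul, ← map_smul]
    rw [map_sub, sub_eq_iff_eq_add] at hu
    conv_rhs => rw [← hS u]
    rw [hu]
    congr 1
    simp only [_root_.neg_apply, ContinuousLinearMap.comp_apply, sub_neg_eq_add]

end Discrete

/-- An infinite set of complex numbers with finitely many points in each left half plane can be
listed by increasing real parts. -/
theorem exists_enumeration_monotone_re {S : Set ℂ} (hS : S.Infinite)
    (hfin : ∀ r : ℝ, {z ∈ S | z.re ≤ r}.Finite) :
    ∃ e : ℕ → ℂ, Function.Injective e ∧ Set.range e = S ∧ Monotone fun n => (e n).re := by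
  -- The lexicographic order breaks ties between equal real parts. Its initial segments are finite
  -- and it has no maximum, so it is isomorphic to `ℕ`.
  have hinj : Function.Injective fun z : S => toLex ((z : ℂ).re, (z : ℂ).im) := fun z w h => by
    have h' := toLex.injective h
    simp only [Prod.mk.injEq] at h'
    exact Subtype.ext (Complex.ext h'.1 h'.2)
  let : LinearOrder S := LinearOrder.lift' _ hinj
  have hle : ∀ z w : S, z ≤ w → (z : ℂ).re ≤ (w : ℂ).re := fun z w h => by
    have h' : toLex ((z : ℂ).re, (z : ℂ).im) ≤ toLex ((w : ℂ).re, (w : ℂ).im) := h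
    rcases Prod.Lex.toLex_le_toLex.1 h' with h | h
    · exact h.le
    · exact h.1.le
  have hIic : ∀ w : S, (Set.Iic w).Finite := fun w =>
    Set.Finite.of_finite_image
      ((hfin (w : ℂ).re).subset (by rintro _ ⟨z, hz, rfl⟩; exact ⟨z.2, hle z w hz⟩))
      Subtype.val_injective.injOn
  have : Infinite S := hS.to_subtype
  let : LocallyFiniteOrder S :=
    LocallyFiniteOrder.ofFiniteIcc fun a b => (hIic b).subset fun z hz => hz.2
  let : SuccOrder S := LinearLocallyFiniteOrder.succOrder S
  let : PredOrder S := LinearLocallyFiniteOrder.predOrder S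
  have : NoMaxOrder S := ⟨fun a => by
    by_contra! h
    exact Set.infinite_univ ((hIic a).subset fun z _ => h z)⟩
  obtain ⟨m, hm⟩ : ∃ m : S, ∀ z, m ≤ z := by
    obtain ⟨a⟩ : Nonempty S := inferInstance
    obtain ⟨m, hm, hmin⟩ := Set.exists_min_image _ id (hIic a) ⟨a, le_refl a⟩
    refine ⟨m, fun z => ?_⟩
    rcases le_total z a with h | h
    · exact hmin z h
    · exact (show m ≤ a from hm).trans h
  let : OrderBot S := { bot := m, bot_le := hm }
  let f : S ≃o ℕ := orderIsoNatOfLinearSuccPredArch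
  refine ⟨fun n => f.symm n, fun a b h => f.symm.injective (Subtype.ext h), ?_, fun a b h =>
    hle _ _ (f.symm.monotone h)⟩
  ext z
  exact ⟨by rintro ⟨n, rfl⟩; exact (f.symm n).2, fun hz => ⟨f ⟨z, hz⟩, by simp⟩⟩

end GinzburgLandau

end

noncomputable section

open Matrix Filter Topology

namespace GinzburgLandau

/-! ### Compact form embeddings `J` and square summability of the eigenvalues of `J J*` -/

section FormOperator

variable {H : Type} [NormedAddCommGroup H] [InnerProductSpace ℂ H]

theorem norm_sq_sum_inner_smul {κ : Type*} {c : κ → H} (hc : Orthonormal ℂ c) (F : Finset κ)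
    (z : H) : ‖∑ j ∈ F, inner ℂ (c j) z • c j‖ ^ 2 = ∑ j ∈ F, ‖inner ℂ (c j) z‖ ^ 2 := by
  have := norm_sq_sum_smul hc (κ := F) Subtype.val_injective fun j => inner ℂ (c j) z
  rwa [Finset.sum_coe_sort F (fun j => inner ℂ (c j) z • c j),
    Finset.sum_coe_sort F (fun j => ‖inner ℂ (c j) z‖ ^ 2)] at this

variable {V : Type*} [NormedAddCommGroup V] [InnerProductSpace ℂ V]

/-- A map with weighted coefficient bounds, the weights tending to infinity, is compact. -/
theorem isCompactOperator_of_weighted_bound [CompleteSpace H] {J : V →L[ℂ] H} {κ : Type*}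
    (c : HilbertBasis κ ℂ H) {ν : κ → ℝ} (hν : ∀ j, 0 < ν j) (hν0 : Tendsto ν cofinite (𝓝 0))
    {C : ℝ} (hC : 0 ≤ C)
    (hJ : ∀ v, ∀ F : Finset κ, ∑ j ∈ F, (ν j)⁻¹ * ‖inner ℂ (c j) (J v)‖ ^ 2 ≤ C * ‖v‖ ^ 2) :
    IsCompactOperator J := by
  let P : Finset κ → V →L[ℂ] H := fun F =>
    ∑ j ∈ F, ((innerSL ℂ (c j)).smulRight (c j)) ∘L J
  have hPa : ∀ F v, P F v = ∑ j ∈ F, inner ℂ (c j) (J v) • c j := fun F v => by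
    simp [P]
  have hPc : ∀ F, IsCompactOperator (P F) := fun F => by
    have h1 : ∀ j, IsCompactOperator (((innerSL ℂ (c j)).smulRight (c j)) ∘L J) := fun j => by
      have h2 : IsCompactOperator ((innerSL ℂ (c j)) ∘L J) :=
        isCompactOperator_of_locallyCompactSpace_dom _
      exact h2.clm_comp ((ContinuousLinearMap.id ℂ ℂ).smulRight (c j))
    exact Submodule.sum_mem (compactOperator (RingHom.id ℂ) V H) fun j _ => h1 j
  refine isCompactOperator_of_tendsto (F := P) (l := atTop) ?_ (Eventually.of_forall hPc)
  rw [Metric.tendsto_nhds]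
  intro ε hε
  -- Beyond the finitely many indices with `ν j ≥ η`, the tail of `J v` has norm at most `√(η * C) *
  -- ‖v‖`. The `+ 1` covers `C = 0`.
  set η : ℝ := (ε / 2) ^ 2 / (C + 1) with hη
  have hη0 : 0 < η := by positivity
  have hfin : {j | η ≤ ν j}.Finite := by
    have := hν0.eventually (gt_mem_nhds hη0)
    rw [eventually_cofinite] at this
    simpa using this
  filter_upwards [eventually_ge_atTop hfin.toFinset] with F hF
  rw [dist_eq_norm]
  refine lt_of_le_of_lt (ContinuousLinearMap.opNorm_le_bound _ (half_pos hε).le fun v => ?_)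
    (half_lt_self hε)
  have hlim : Tendsto (fun G : Finset κ => ‖P F v - ∑ j ∈ G, inner ℂ (c j) (J v) • c j‖) atTop
      (𝓝 ‖P F v - J v‖) := by
    have := c.hasSum_repr (J v)
    simp only [c.repr_apply_apply] at this
    exact (tendsto_const_nhds.sub this).norm
  refine le_of_tendsto hlim ?_
  filter_upwards [eventually_ge_atTop F] with G hG
  classical
  rw [hPa, norm_sub_rev, ← Finset.sum_sdiff hG, add_sub_cancel_right]
  refine (abs_le_of_sq_le_sq' ?_ (by positivity)).2
  rw [norm_sq_sum_inner_smul c.orthonormal, mul_pow]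
  calc ∑ j ∈ G \ F, ‖inner ℂ (c j) (J v)‖ ^ 2
      ≤ ∑ j ∈ G \ F, η * ((ν j)⁻¹ * ‖inner ℂ (c j) (J v)‖ ^ 2) := by
        refine Finset.sum_le_sum fun j hj => ?_
        have h1 : ν j < η := by
          by_contra! h
          exact (Finset.mem_sdiff.1 hj).2 (hF (by simpa using h))
        rw [← mul_assoc]
        refine le_mul_of_one_le_left (by positivity) ?_
        rw [← div_eq_mul_inv, one_le_div (hν j)]
        exact h1.le
    _ ≤ η * (C * ‖v‖ ^ 2) := by
        rw [← Finset.mul_sum]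
        gcongr
        exact hJ v _
    _ ≤ (ε / 2) ^ 2 * ‖v‖ ^ 2 := by
        rw [← mul_assoc, hη]
        gcongr
        rw [div_mul_eq_mul_div, div_le_iff₀ (by positivity)]
        have := sq_nonneg (ε / 2)
        nlinarith

/-- By duality this is the form inequality `J J* ≤ C diag(ν)` in the basis `c`. With `v = J* f` one
has `‖v‖ ^ 2 = ⟨f, J v⟩`, and Cauchy–Schwarz with the weights `ν` and `ν⁻¹` bounds this by `√(S * C)
* ‖v‖`. -/
theorem norm_sq_adjoint_le [CompleteSpace H] [CompleteSpace V] {J : V →L[ℂ] H} {κ : Type*}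
    (c : HilbertBasis κ ℂ H) {ν : κ → ℝ} (hν : ∀ j, 0 < ν j) {C : ℝ} (hC : 0 ≤ C)
    (hJ : ∀ v, ∀ F : Finset κ, ∑ j ∈ F, (ν j)⁻¹ * ‖inner ℂ (c j) (J v)‖ ^ 2 ≤ C * ‖v‖ ^ 2)
    {f : H} {S : ℝ} (hS : ∀ F : Finset κ, ∑ j ∈ F, ν j * ‖inner ℂ (c j) f‖ ^ 2 ≤ S) :
    ‖ContinuousLinearMap.adjoint J f‖ ^ 2 ≤ C * S := by
  set v := ContinuousLinearMap.adjoint J f with hv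
  have hS0 : 0 ≤ S := by simpa using hS ∅
  have h1 : ‖v‖ ^ 2 = ‖inner ℂ f (J v)‖ := by
    rw [← ContinuousLinearMap.adjoint_inner_left, ← hv, inner_self_eq_norm_sq_to_K]
    simp
  have h2 : ‖inner ℂ f (J v)‖ ≤ √(S * (C * ‖v‖ ^ 2)) := by
    have hlim := (c.hasSum_inner_mul_inner f (J v)).norm
    refine le_of_tendsto hlim (Eventually.of_forall fun F => ?_)
    refine Real.le_sqrt_of_sq_le ?_
    have h3 : ‖∑ j ∈ F, inner ℂ f (c j) * inner ℂ (c j) (J v)‖ ≤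
        ∑ j ∈ F, (√(ν j) * ‖inner ℂ (c j) f‖) * ((√(ν j))⁻¹ * ‖inner ℂ (c j) (J v)‖) := by
      refine (norm_sum_le _ _).trans (Finset.sum_le_sum fun j _ => ?_)
      rw [norm_mul, norm_inner_symm]
      have := Real.sqrt_pos.2 (hν j)
      refine le_of_eq ?_
      field_simp
    refine (pow_le_pow_left₀ (norm_nonneg _) h3 2).trans
      ((Finset.sum_mul_sq_le_sq_mul_sq _ _ _).trans ?_)
    simp only [mul_pow, inv_pow, Real.sq_sqrt (hν _).le]
    have := hν
    exact mul_le_mul (hS F) (hJ v F) (Finset.sum_nonneg fun j _ => by have := hν j; positivity) hS0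
  rw [← h1] at h2
  have h4 := pow_le_pow_left₀ (by positivity) h2 2
  rw [Real.sq_sqrt (by positivity)] at h4
  rcases eq_or_ne (‖v‖ ^ 2) 0 with h | h
  · rw [h]; positivity
  · have h5 : 0 < ‖v‖ ^ 2 := lt_of_le_of_ne (by positivity) h.symm
    have h6 : ‖v‖ ^ 2 * ‖v‖ ^ 2 ≤ (C * S) * ‖v‖ ^ 2 := by nlinarith
    exact le_of_mul_le_mul_right h6 h5

/-- Eigenvector basis of a positive injective compact operator. -/
theorem exists_hilbertBasis_eigenvectors [CompleteSpace H] {T : H →L[ℂ] H}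
    (hT : IsCompactOperator T) (hsym : T.IsSymmetric) (hinj : ∀ x, T x = 0 → x = 0)
    (hpos : ∀ x, 0 ≤ (inner ℂ x (T x)).re) :
    ∃ (ι : Type) (b : HilbertBasis ι ℂ H) (t : ι → ℝ), (∀ i, 0 < t i) ∧
      ∀ i, T (b i) = (t i : ℂ) • b i := by
  have hcl : ∀ μ : ℂ, IsClosed (Module.End.eigenspace (T : Module.End ℂ H) μ : Set H) := by
    intro μ
    have : (Module.End.eigenspace (T : Module.End ℂ H) μ : Set H) = {x | T x = μ • x} := by
      ext x; simp
    rw [this]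
    exact isClosed_eq T.continuous (continuous_const_smul μ)
  have hco : ∀ μ : ℂ, CompleteSpace (Module.End.eigenspace (T : Module.End ℂ H) μ) := fun μ =>
    (hcl μ).completeSpace_coe
  -- Every complex `μ` is allowed as an index; a trivial eigenspace contributes an empty basis.
  choose w B hB using fun μ : ℂ =>
    exists_hilbertBasis ℂ (Module.End.eigenspace (T : Module.End ℂ H) μ)
  have hfam := hsym.orthogonalFamily_eigenspaces
  obtain ⟨y, hy⟩ : ∃ y : (Σ μ : ℂ, w μ) → H, ∀ a, y a = B a.1 a.2 := ⟨_, fun _ => rfl⟩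
  have hon : Orthonormal ℂ y := by
    have := hfam.orthonormal_sigma_orthonormal (v_family := fun μ => B μ)
      (fun μ => (B μ).orthonormal)
    rwa [show y = _ from funext hy]
  have hperp : (Submodule.span ℂ (Set.range y))ᗮ = ⊥ := by
    rw [eq_bot_iff, ← T.orthogonalComplement_iSup_eigenspaces_eq_bot hT hsym]
    intro x hx
    rw [Submodule.mem_orthogonal'] at hx ⊢
    intro z hz
    induction hz using Submodule.iSup_induction' with
    | mem μ z hz =>
      have h1 : HasSum (fun i => inner ℂ x ((inner ℂ (B μ i) ⟨z, hz⟩ • B μ i :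
          Module.End.eigenspace (T : Module.End ℂ H) μ) : H)) (inner ℂ x z) := by
        have h2 := (B μ).hasSum_repr ⟨z, hz⟩
        simp only [(B μ).repr_apply_apply] at h2
        exact h2.mapL ((innerSL ℂ x) ∘L (Submodule.subtypeL _))
      refine h1.unique ?_
      have h3 : ∀ i, inner ℂ x ((inner ℂ (B μ i) ⟨z, hz⟩ • B μ i :
          Module.End.eigenspace (T : Module.End ℂ H) μ) : H) = 0 := fun i => by
        rw [Submodule.coe_smul, inner_smul_right, ← hy ⟨μ, i⟩, hx _ (Submodule.subset_span ⟨⟨μ, i⟩, rfl⟩),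
          mul_zero]
      simp only [h3]
      exact hasSum_zero
    | zero => simp
    | add a b _ _ ha hb => rw [inner_add_right, ha, hb, add_zero]
  obtain ⟨b, hb⟩ : ∃ b : HilbertBasis (Σ μ : ℂ, w μ) ℂ H, ∀ a, b a = B a.1 a.2 :=
    ⟨HilbertBasis.mkOfOrthogonalEqBot hon hperp, fun a => by
      rw [HilbertBasis.coe_mkOfOrthogonalEqBot, hy]⟩
  refine ⟨_, b, fun a => a.1.re, ?_, ?_⟩
  all_goals
    intro a
    have h1 : T (B a.1 a.2 : H) = a.1 • (B a.1 a.2 : H) :=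
      Module.End.mem_eigenspace_iff.1 (B a.1 a.2).2
    have h2 : ‖(B a.1 a.2 : H)‖ = 1 := (B a.1).orthonormal.1 a.2
    have h3 : inner ℂ (B a.1 a.2 : H) (T (B a.1 a.2 : H)) = a.1 := by
      rw [h1, inner_smul_right, inner_self_eq_norm_sq_to_K, h2]
      simp
    have h4 : (a.1.re : ℂ) = a.1 := by
      rw [← Complex.conj_eq_iff_re, ← h3, inner_conj_symm]
      exact hsym _ _
  · have h5 := hpos (B a.1 a.2 : H)
    rw [h3] at h5
    refine lt_of_le_of_ne h5 fun h6 => ?_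
    rw [show (a.1.re : ℝ) = 0 from h6.symm, Complex.ofReal_zero] at h4
    rw [hinj _ (h1.trans (smul_eq_zero_of_left h4.symm _)), norm_zero] at h2
    exact zero_ne_one h2
  · rw [hb, h4]
    exact h1

/-- Let `J` be an embedding with weighted coefficient bounds. Then `J J*` has an eigenvector basis,
with square summable eigenvalues. -/
theorem exists_hilbertBasis_eigenvectors_summable [CompleteSpace H] [CompleteSpace V]
    (hH : ¬ FiniteDimensional ℂ H) {J : V →L[ℂ] H} (hJinj : ∀ f, ContinuousLinearMap.adjoint J f = 0 → f = 0)
    {κ : Type*} (c : HilbertBasis κ ℂ H) {ν : κ → ℝ} (hν : ∀ j, 0 < ν j) (hν1 : ∀ j, ν j ≤ 1)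
    (hνs : Summable fun j => ν j ^ 2) {C : ℝ} (hC : 0 ≤ C)
    (hJ : ∀ v, ∀ F : Finset κ, ∑ j ∈ F, (ν j)⁻¹ * ‖inner ℂ (c j) (J v)‖ ^ 2 ≤ C * ‖v‖ ^ 2) :
    IsCompactOperator (J ∘L ContinuousLinearMap.adjoint J) ∧
    ∃ (b : HilbertBasis ℕ ℂ H) (t : ℕ → ℝ), (∀ n, 0 < t n) ∧
      (∀ n y, inner ℂ (b n) ((J ∘L ContinuousLinearMap.adjoint J) y) = t n * inner ℂ (b n) y) ∧
      Summable fun n => t n ^ 2 := by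
  set T := J ∘L ContinuousLinearMap.adjoint J with hTdef
  have hν0 : Tendsto ν cofinite (𝓝 0) := by
    have := hνs.tendsto_cofinite_zero.sqrt
    simpa [Real.sqrt_sq (hν _).le] using this
  have hT : IsCompactOperator T :=
    (isCompactOperator_of_weighted_bound c hν hν0 hC hJ).comp_clm _
  have hsym : T.IsSymmetric := fun x y => by
    change inner ℂ (J (ContinuousLinearMap.adjoint J x)) y =
      inner ℂ x (J (ContinuousLinearMap.adjoint J y))
    exact (ContinuousLinearMap.adjoint_inner_right J _ y).symm.trans
      (ContinuousLinearMap.adjoint_inner_left J _ x)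
  have hTf : ∀ f, inner ℂ f (T f) = ((‖ContinuousLinearMap.adjoint J f‖ ^ 2 : ℝ) : ℂ) := fun f => by
    change inner ℂ f (J (ContinuousLinearMap.adjoint J f)) = _
    rw [← ContinuousLinearMap.adjoint_inner_left, inner_self_eq_norm_sq_to_K]
    simp
  refine ⟨hT, ?_⟩
  obtain ⟨ι, b, t, ht, hTb⟩ := exists_hilbertBasis_eigenvectors hT hsym
    (fun x hx => by
      have h1 := hTf x
      rw [hx, inner_zero_right] at h1
      refine hJinj x (norm_eq_zero.1 ?_)
      exact pow_eq_zero_iff (two_ne_zero) |>.1 (Complex.ofReal_eq_zero.1 h1.symm))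
    (fun x => by rw [hTf, Complex.ofReal_re]; positivity)
  have hTb' : ∀ i y, inner ℂ (b i) (T y) = t i * inner ℂ (b i) y := fun i y => by
    have := hsym (b i) y
    rw [show (T : H →ₗ[ℂ] H) (b i) = (t i : ℂ) • b i from hTb i, inner_smul_left,
      Complex.conj_ofReal] at this
    exact this.symm
  have hbessel : ∀ f, Summable fun j => ‖inner ℂ (c j) f‖ ^ 2 := fun f =>
    c.orthonormal.inner_products_summable f
  have hsν : ∀ f, Summable fun j => ν j * ‖inner ℂ (c j) f‖ ^ 2 := fun f =>
    (hbessel f).of_nonneg_of_le (fun j => by have := hν j; positivity)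
      fun j => mul_le_of_le_one_left (by positivity) (hν1 j)
  -- The form inequality is used twice, on the `b i` here and on the `c j` next. After exchanging
  -- the sums, `∑ t i ^ 2 ≤ C * ∑ ν j * ⟨c j, T (c j)⟩ ≤ C ^ 2 * ∑ ν j ^ 2`, with no min-max
  -- principle.
  have ht1 : ∀ i, t i ≤ C * ∑' j, ν j * ‖inner ℂ (c j) (b i)‖ ^ 2 := fun i => by
    have h1 := norm_sq_adjoint_le c hν hC hJ (f := b i)
      (fun F => (hsν (b i)).sum_le_tsum F fun j _ => by have := hν j; positivity)
    have h2 : ((t i : ℝ) : ℂ) = ((‖ContinuousLinearMap.adjoint J (b i)‖ ^ 2 : ℝ) : ℂ) := by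
      rw [← hTf, hTb, inner_smul_right, inner_self_eq_norm_sq_to_K, b.orthonormal.1 i]
      simp
    rwa [← Complex.ofReal_injective h2] at h1
  have ht2 : ∀ j, ∀ F : Finset ι, ∑ i ∈ F, t i * ‖inner ℂ (c j) (b i)‖ ^ 2 ≤ C * ν j := by
    intro j F
    have h1 : HasSum (fun i => t i * ‖inner ℂ (c j) (b i)‖ ^ 2)
        (‖ContinuousLinearMap.adjoint J (c j)‖ ^ 2) := by
      have h2 := b.hasSum_inner_mul_inner (c j) (T (c j))
      rw [hTf] at h2
      rw [← Complex.hasSum_ofReal]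
      have h3 : (fun i => inner ℂ (c j) (b i) * inner ℂ (b i) (T (c j))) =
          fun i => ((t i * ‖inner ℂ (c j) (b i)‖ ^ 2 : ℝ) : ℂ) := funext fun i => by
        rw [hTb', ← inner_conj_symm (b i), mul_left_comm, Complex.mul_conj,
          Complex.normSq_eq_norm_sq]
        push_cast
        rfl
      rwa [h3] at h2
    refine (sum_le_hasSum F (fun i _ => by have := ht i; positivity) h1).trans ?_
    refine norm_sq_adjoint_le c hν hC hJ fun G => ?_
    classical
    have h3 : ∀ k ∈ G, ν k * ‖inner ℂ (c k) (c j)‖ ^ 2 = if k = j then ν j else 0 := fun k _ => by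
      rw [orthonormal_iff_ite.1 c.orthonormal k j]
      split_ifs with h
      · simp [h]
      · simp
    rw [Finset.sum_congr rfl h3, Finset.sum_ite_eq']
    split_ifs
    · exact le_rfl
    · exact (hν j).le
  have hts : Summable fun i => t i ^ 2 := by
    refine summable_of_sum_le (c := C * (C * ∑' j, ν j ^ 2)) (fun i => by positivity) fun F => ?_
    calc ∑ i ∈ F, t i ^ 2 ≤ ∑ i ∈ F, t i * (C * ∑' j, ν j * ‖inner ℂ (c j) (b i)‖ ^ 2) := by
          refine Finset.sum_le_sum fun i _ => ?_
          rw [sq]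
          have := ht i
          gcongr
          exact ht1 i
      _ = C * ∑' j, ν j * ∑ i ∈ F, t i * ‖inner ℂ (c j) (b i)‖ ^ 2 := by
          simp only [mul_left_comm _ C]
          rw [← Finset.mul_sum]
          congr 1
          simp only [← tsum_mul_left]
          rw [← Summable.tsum_finsetSum fun i _ => (hsν (b i)).mul_left _]
          refine tsum_congr fun j => ?_
          rw [Finset.mul_sum]
          exact Finset.sum_congr rfl fun i _ => by ring
      _ ≤ C * (C * ∑' j, ν j ^ 2) := by
          gcongr
          rw [← tsum_mul_left]
          refine Summable.tsum_le_tsum (fun j => ?_) ?_ (hνs.mul_left C)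
          · have := hν j
            calc _ ≤ ν j * (C * ν j) := by gcongr; exact ht2 j F
              _ = _ := by ring
          · refine (hνs.mul_left C).of_nonneg_of_le (fun j => ?_) fun j => ?_
            · exact mul_nonneg (hν j).le (Finset.sum_nonneg fun i _ => by have := ht i; positivity)
            · have := hν j
              calc _ ≤ ν j * (C * ν j) := by gcongr; exact ht2 j F
                _ = _ := by ring
  -- A summable family of positive numbers has a countable index set, so separability of `H` need
  -- not be assumed.
  have hcount : Countable ι := by
    have := hts.countable_support
    have h1 : Function.support (fun i => t i ^ 2) = Set.univ := by
      ext i; simp [(ht i).ne']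
    rw [h1] at this
    exact Set.countable_univ_iff.1 this
  have hinf : Infinite ι := by
    by_contra hfin
    rw [not_infinite_iff_finite] at hfin
    have := Fintype.ofFinite ι
    exact hH (b.toOrthonormalBasis.toBasis.finiteDimensional_of_finite)
  obtain ⟨e⟩ := nonempty_equiv_of_countable (α := ℕ) (β := ι)
  have hsp : ⊤ ≤ (Submodule.span ℂ (Set.range (b ∘ e))).topologicalClosure := by
    rw [e.surjective.range_comp, b.dense_span]
  have hbe : ∀ n, HilbertBasis.mk (b.orthonormal.comp e e.injective) hsp n = b (e n) := fun n => by
    rw [HilbertBasis.coe_mk]; rfl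
  refine ⟨HilbertBasis.mk (b.orthonormal.comp e e.injective) hsp, fun n => t (e n),
    fun n => ht _, fun n y => ?_, (e.summable_iff (f := fun i => t i ^ 2)).2 hts⟩
  rw [hbe]
  exact hTb' (e n) y

end FormOperator
end GinzburgLandau

end

noncomputable section

open MeasureTheory Set Filter Topology
open scoped ContDiff ENNReal ComplexConjugate

namespace GinzburgLandau

/-! ### Cutoff functions and integration by parts on the rectangle -/

/-- A smooth cutoff function of the interval `(-a, a)`. -/
def cutoff (a : ℝ) (k : ℕ) (x : ℝ) : ℝ :=
  Real.smoothTransition (k * (a - x) - 1) * Real.smoothTransition (k * (a + x) - 1)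

theorem contDiff_cutoff (a : ℝ) (k : ℕ) : ContDiff ℝ ∞ (cutoff a k) := by
  unfold cutoff
  exact (Real.smoothTransition.contDiff.comp (by fun_prop)).mul
    (Real.smoothTransition.contDiff.comp (by fun_prop))

theorem cutoff_mem_Icc (a : ℝ) (k : ℕ) (x : ℝ) : cutoff a k x ∈ Icc (0 : ℝ) 1 :=
  ⟨mul_nonneg (Real.smoothTransition.nonneg _) (Real.smoothTransition.nonneg _),
    mul_le_one₀ (Real.smoothTransition.le_one _) (Real.smoothTransition.nonneg _)
      (Real.smoothTransition.le_one _)⟩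

theorem cutoff_eq_zero {a : ℝ} {k : ℕ} (hk : 0 < k) {x : ℝ} (hx : a - (k : ℝ)⁻¹ ≤ |x|) :
    cutoff a k x = 0 := by
  have hk' : (0 : ℝ) < k := by exact_mod_cast hk
  unfold cutoff
  rcases le_abs.1 hx with h | h
  · rw [Real.smoothTransition.zero_of_nonpos, zero_mul]
    have : a - x ≤ (k : ℝ)⁻¹ := by linarith
    have := mul_le_mul_of_nonneg_left this hk'.le
    rw [mul_inv_cancel₀ hk'.ne'] at this
    linarith
  · rw [Real.smoothTransition.zero_of_nonpos (x := k * (a + x) - 1), mul_zero]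
    have : a + x ≤ (k : ℝ)⁻¹ := by linarith
    have := mul_le_mul_of_nonneg_left this hk'.le
    rw [mul_inv_cancel₀ hk'.ne'] at this
    linarith

theorem eventually_cutoff_eventuallyEq_one {a x : ℝ} (hx : x ∈ Ioo (-a) a) :
    ∀ᶠ k : ℕ in atTop, cutoff a k =ᶠ[𝓝 x] fun _ => 1 := by
  have h1 : Tendsto (fun k : ℕ => (k : ℝ) * (a - x)) atTop atTop :=
    tendsto_natCast_atTop_atTop.atTop_mul_const (by linarith [hx.2])
  have h2 : Tendsto (fun k : ℕ => (k : ℝ) * (a + x)) atTop atTop :=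
    tendsto_natCast_atTop_atTop.atTop_mul_const (by linarith [hx.1])
  filter_upwards [h1.eventually_gt_atTop 2, h2.eventually_gt_atTop 2] with k hk1 hk2
  have c1 : ContinuousAt (fun z : ℝ => (k : ℝ) * (a - z)) x := by fun_prop
  have c2 : ContinuousAt (fun z : ℝ => (k : ℝ) * (a + z)) x := by fun_prop
  filter_upwards [c1.eventually_const_lt hk1, c2.eventually_const_lt hk2] with z hz1 hz2
  unfold cutoff
  rw [Real.smoothTransition.one_of_one_le (by linarith),
    Real.smoothTransition.one_of_one_le (by linarith), mul_one]

/-- The derivative lives on `[0, 1]`. The weight is `t + 1` because the cutoff evaluates the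
transition at `t = k * (a - x) - 1`, so that `t + 1` is `k` times the distance to an endpoint. -/
theorem exists_abs_deriv_smoothTransition_mul_le :
    ∃ C : ℝ, 0 ≤ C ∧ ∀ t : ℝ, |deriv Real.smoothTransition t * (t + 1)| ≤ C := by
  have hcont : Continuous fun t : ℝ => deriv Real.smoothTransition t * (t + 1) :=
    ((Real.smoothTransition.contDiff (n := 1)).continuous_deriv le_rfl).mul (by fun_prop)
  obtain ⟨C, hC⟩ := (isCompact_Icc (a := (0 : ℝ)) (b := 1)).exists_bound_of_continuousOn
    hcont.continuousOn
  refine ⟨|C|, abs_nonneg C, fun t => ?_⟩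
  by_cases ht : t ∈ Icc (0 : ℝ) 1
  · exact (hC t ht).trans (le_abs_self C)
  · have : deriv Real.smoothTransition t = 0 := by
      rcases lt_or_ge t 0 with h | h
      · have : Real.smoothTransition =ᶠ[𝓝 t] fun _ => 0 := by
          filter_upwards [Iio_mem_nhds h] with z hz
          exact Real.smoothTransition.zero_of_nonpos (le_of_lt hz)
        rw [this.deriv_eq, deriv_const]
      · have h1 : 1 < t := by
          by_contra! h2
          exact ht ⟨h, h2⟩
        have : Real.smoothTransition =ᶠ[𝓝 t] fun _ => 1 := by
          filter_upwards [Ioi_mem_nhds h1] with z hz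
          exact Real.smoothTransition.one_of_one_le (le_of_lt hz)
        rw [this.deriv_eq, deriv_const]
    rw [this, zero_mul, abs_zero]
    exact abs_nonneg C

/-- The derivative of the cutoff blows up with `k`, but not faster than the inverse distance to the
endpoints. Multiplied by a function vanishing linearly there, it stays bounded uniformly in `k`, as
dominated convergence requires. -/
theorem exists_abs_deriv_cutoff_mul_le :
    ∃ C : ℝ, 0 ≤ C ∧ ∀ (a : ℝ) (k : ℕ), ∀ x ∈ Ioo (-a) a,
      |deriv (cutoff a k) x| * (a - |x|) ≤ C := by
  obtain ⟨C, hC0, hC⟩ := exists_abs_deriv_smoothTransition_mul_le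
  refine ⟨C + C, by positivity, fun a k x hx => ?_⟩
  have hS : ∀ t, HasDerivAt Real.smoothTransition (deriv Real.smoothTransition t) t := fun t =>
    ((Real.smoothTransition.contDiff (n := 1)).differentiable one_ne_zero t).hasDerivAt
  have h1 : HasDerivAt (fun z : ℝ => (k : ℝ) * (a - z) - 1) (-k) x := by
    simpa using (((hasDerivAt_id x).const_sub a).const_mul (k : ℝ)).sub_const 1
  have h2 : HasDerivAt (fun z : ℝ => (k : ℝ) * (a + z) - 1) k x := by
    simpa using (((hasDerivAt_id x).const_add a).const_mul (k : ℝ)).sub_const 1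
  have h3 := ((hS _).comp x h1).mul ((hS _).comp x h2)
  have h4 : deriv (cutoff a k) x = _ := h3.deriv
  rw [h4]
  set p := (k : ℝ) * (a - x) - 1 with hp
  set q := (k : ℝ) * (a + x) - 1 with hq
  simp only [Function.comp_apply]
  have hd0 : 0 < a - |x| := by
    have := abs_lt.2 ⟨hx.1, hx.2⟩
    linarith
  have e1 : |Real.smoothTransition p| ≤ 1 := by
    rw [abs_of_nonneg (Real.smoothTransition.nonneg _)]; exact Real.smoothTransition.le_one _
  have e2 : |Real.smoothTransition q| ≤ 1 := by
    rw [abs_of_nonneg (Real.smoothTransition.nonneg _)]; exact Real.smoothTransition.le_one _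
  have hk0 : (0 : ℝ) ≤ k := Nat.cast_nonneg k
  have f1 : |deriv Real.smoothTransition p * -(k : ℝ)| * (a - |x|) ≤ C := by
    refine le_trans ?_ (hC p)
    rw [mul_neg, abs_neg, abs_mul, abs_mul, abs_of_nonneg hk0, mul_assoc]
    have : |p + 1| = k * (a - x) := by
      rw [hp, sub_add_cancel, abs_of_nonneg]
      have := hx.2
      exact mul_nonneg hk0 (by linarith)
    rw [this]
    gcongr
    linarith [le_abs_self x]
  have f2 : |deriv Real.smoothTransition q * (k : ℝ)| * (a - |x|) ≤ C := by
    refine le_trans ?_ (hC q)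
    rw [abs_mul, abs_mul, abs_of_nonneg hk0, mul_assoc]
    have : |q + 1| = k * (a + x) := by
      rw [hq, sub_add_cancel, abs_of_nonneg]
      have := hx.1
      exact mul_nonneg hk0 (by linarith)
    rw [this]
    gcongr
    linarith [neg_abs_le x]
  calc _ ≤ (|deriv Real.smoothTransition p * -(k : ℝ)| * 1 +
        1 * |deriv Real.smoothTransition q * (k : ℝ)|) * (a - |x|) := by
        gcongr
        refine (abs_add_le _ _).trans ?_
        rw [abs_mul, abs_mul (Real.smoothTransition p)]
        gcongr
    _ ≤ _ := by linarith

theorem hasFDerivAt_mul_prod {α β : ℝ → ℝ} {α' β' : ℝ} {p : ℝ × ℝ} (hα : HasDerivAt α α' p.1)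
    (hβ : HasDerivAt β β' p.2) :
    HasFDerivAt (fun p : ℝ × ℝ => α p.1 * β p.2)
      (α p.1 • β' • ContinuousLinearMap.snd ℝ ℝ ℝ + β p.2 • α' • ContinuousLinearMap.fst ℝ ℝ ℝ)
      p := by
  have h1 : HasFDerivAt (fun p : ℝ × ℝ => α p.1) (α' • ContinuousLinearMap.fst ℝ ℝ ℝ) p :=
    hα.comp_hasFDerivAt p hasFDerivAt_fst
  have h2 : HasFDerivAt (fun p : ℝ × ℝ => β p.2) (β' • ContinuousLinearMap.snd ℝ ℝ ℝ) p :=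
    hβ.comp_hasFDerivAt p hasFDerivAt_snd
  exact h1.mul h2

theorem fderiv_mul_prod_fst {α β : ℝ → ℝ} (hα : Differentiable ℝ α) (hβ : Differentiable ℝ β)
    (p : ℝ × ℝ) :
    fderiv ℝ (fun p : ℝ × ℝ => α p.1 * β p.2) p (1, 0) = deriv α p.1 * β p.2 := by
  rw [(hasFDerivAt_mul_prod (hα _).hasDerivAt (hβ _).hasDerivAt).fderiv]
  simp [mul_comm]

theorem fderiv_mul_prod_snd {α β : ℝ → ℝ} (hα : Differentiable ℝ α) (hβ : Differentiable ℝ β)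
    (p : ℝ × ℝ) :
    fderiv ℝ (fun p : ℝ × ℝ => α p.1 * β p.2) p (0, 1) = α p.1 * deriv β p.2 := by
  rw [(hasFDerivAt_mul_prod (hα _).hasDerivAt (hβ _).hasDerivAt).fderiv]
  simp

theorem isTestFunction_mul_prod {L K r s : ℝ} {α β : ℝ → ℝ} (hα : ContDiff ℝ ∞ α)
    (hβ : ContDiff ℝ ∞ β) (hr : r < L) (hs : s < K) (hαr : ∀ x, r ≤ |x| → α x = 0)
    (hβs : ∀ y, s ≤ |y| → β y = 0) :
    IsTestFunction (rect L K) (fun p : ℝ × ℝ => α p.1 * β p.2) := by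
  have hsub : tsupport (fun p : ℝ × ℝ => α p.1 * β p.2) ⊆ Icc (-r) r ×ˢ Icc (-s) s := by
    refine closure_minimal (fun p hp => ?_) (isClosed_Icc.prod isClosed_Icc)
    rw [Function.mem_support, mul_ne_zero_iff] at hp
    refine ⟨?_, ?_⟩
    · by_contra h
      exact hp.1 (hαr _ (by rw [mem_Icc, ← abs_le] at h; exact (not_le.1 h).le))
    · by_contra h
      exact hp.2 (hβs _ (by rw [mem_Icc, ← abs_le] at h; exact (not_le.1 h).le))
  refine ⟨(hα.comp contDiff_fst).mul (hβ.comp contDiff_snd), ?_, hsub.trans ?_⟩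
  · exact HasCompactSupport.of_support_subset_isCompact
      (isCompact_Icc.prod isCompact_Icc) (subset_closure.trans hsub)
  · exact prod_mono (Icc_subset_Ioo (by linarith) hr) (Icc_subset_Ioo (by linarith) hs)

section

variable {L K : ℝ} {E : Type*} [NormedAddCommGroup E] [NormedSpace ℝ E]

instance isFiniteMeasure_rectMeasure (L K : ℝ) : IsFiniteMeasure (rectMeasure L K) := by
  refine ⟨?_⟩
  rw [Measure.restrict_apply_univ]
  exact ((Metric.isBounded_Ioo _ _).prod (Metric.isBounded_Ioo _ _)).measure_lt_top

theorem tendsto_integral_mul_prod {u : ℝ × ℝ → E} (hu : Integrable u (rectMeasure L K))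
    {A B : ℕ → ℝ → ℝ} {A' B' : ℝ → ℝ} (hA : ∀ k, Continuous (A k)) (hB : ∀ k, Continuous (B k))
    {CA CB : ℝ} (hCA0 : 0 ≤ CA) (hCA : ∀ k, ∀ x ∈ Ioo (-L) L, |A k x| ≤ CA)
    (hCB : ∀ k, ∀ x ∈ Ioo (-K) K, |B k x| ≤ CB)
    (hAl : ∀ x ∈ Ioo (-L) L, Tendsto (fun k => A k x) atTop (𝓝 (A' x)))
    (hBl : ∀ x ∈ Ioo (-K) K, Tendsto (fun k => B k x) atTop (𝓝 (B' x))) :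
    Tendsto (fun k => ∫ p in rect L K, (A k p.1 * B k p.2) • u p) atTop
      (𝓝 (∫ p in rect L K, (A' p.1 * B' p.2) • u p)) := by
  refine tendsto_integral_of_dominated_convergence (fun p => (CA * CB) * ‖u p‖) (fun k => ?_)
    (hu.norm.const_mul _) (fun k => ?_) ?_
  · exact ((((hA k).comp continuous_fst).mul
      ((hB k).comp continuous_snd)).aestronglyMeasurable).smul hu.1
  · refine (ae_restrict_iff' measurableSet_rect).2 (Eventually.of_forall fun p hp => ?_)
    rw [norm_smul, norm_mul]
    gcongr
    · exact hCA k _ hp.1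
    · exact hCB k _ hp.2
  · refine (ae_restrict_iff' measurableSet_rect).2 (Eventually.of_forall fun p hp => ?_)
    exact ((hAl _ hp.1).mul (hBl _ hp.2)).smul_const _

theorem exists_bound_Ioo {f : ℝ → ℝ} (hf : Continuous f) (a : ℝ) :
    ∃ C, 0 ≤ C ∧ ∀ x ∈ Ioo (-a) a, |f x| ≤ C := by
  obtain ⟨C, hC⟩ := (isCompact_Icc (a := -a) (b := a)).exists_bound_of_continuousOn
    hf.continuousOn
  exact ⟨|C|, abs_nonneg C, fun x hx => (hC x (Ioo_subset_Icc_self hx)).trans (le_abs_self C)⟩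

theorem deriv_cutoff_mul (a : ℝ) (k : ℕ) {f : ℝ → ℝ} (hf : ContDiff ℝ ∞ f) (x : ℝ) :
    deriv (fun x => cutoff a k x * f x) x = deriv (cutoff a k) x * f x + cutoff a k x * deriv f x :=
  deriv_fun_mul ((contDiff_cutoff a k).differentiable (by simp) x) (hf.differentiable (by simp) x)

theorem abs_cutoff_mul_le (a : ℝ) (k : ℕ) (x y : ℝ) : |cutoff a k x * y| ≤ |y| := by
  rw [abs_mul, abs_of_nonneg (cutoff_mem_Icc a k x).1]
  exact mul_le_of_le_one_left (abs_nonneg _) (cutoff_mem_Icc a k x).2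

theorem tendsto_cutoff_mul {a x : ℝ} (hx : x ∈ Ioo (-a) a) (y : ℝ) :
    Tendsto (fun k => cutoff a k x * y) atTop (𝓝 y) := by
  refine tendsto_const_nhds.congr' ?_
  filter_upwards [eventually_cutoff_eventuallyEq_one hx] with k hk
  rw [hk.self_of_nhds, one_mul]

theorem exists_abs_deriv_cutoff_mul_le_of_le {a C : ℝ} {f : ℝ → ℝ} (hf : ContDiff ℝ ∞ f)
    (hfC : ∀ x ∈ Ioo (-a) a, |f x| ≤ C * (a - |x|)) :
    ∃ D, 0 ≤ D ∧ ∀ k, ∀ x ∈ Ioo (-a) a, |deriv (fun x => cutoff a k x * f x) x| ≤ D := by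
  obtain ⟨C₁, hC₁0, hC₁⟩ := exists_abs_deriv_cutoff_mul_le
  obtain ⟨C₂, hC₂0, hC₂⟩ := exists_bound_Ioo (hf.continuous_deriv (by simp)) a
  refine ⟨|C| * C₁ + C₂, by positivity, fun k x hx => ?_⟩
  rw [deriv_cutoff_mul a k hf]
  refine (abs_add_le _ _).trans (add_le_add ?_ ((abs_cutoff_mul_le _ _ _ _).trans (hC₂ x hx)))
  rw [abs_mul]
  have hd : 0 ≤ a - |x| := by
    have := abs_lt.2 ⟨hx.1, hx.2⟩
    linarith
  calc |deriv (cutoff a k) x| * |f x| ≤ |deriv (cutoff a k) x| * (|C| * (a - |x|)) := by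
        gcongr
        exact (hfC x hx).trans (by gcongr; exact le_abs_self C)
    _ = |C| * (|deriv (cutoff a k) x| * (a - |x|)) := by ring
    _ ≤ |C| * C₁ := by gcongr; exact hC₁ a k x hx

theorem tendsto_deriv_cutoff_mul {a x : ℝ} (hx : x ∈ Ioo (-a) a) {f : ℝ → ℝ}
    (hf : ContDiff ℝ ∞ f) :
    Tendsto (fun k => deriv (fun x => cutoff a k x * f x) x) atTop (𝓝 (deriv f x)) := by
  refine tendsto_const_nhds.congr' ?_
  filter_upwards [eventually_cutoff_eventuallyEq_one hx] with k hk
  rw [deriv_cutoff_mul a k hf, hk.deriv_eq, hk.self_of_nhds, deriv_const]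
  ring

theorem isTestFunction_cutoff_mul {α β : ℝ → ℝ} (hα : ContDiff ℝ ∞ α) (hβ : ContDiff ℝ ∞ β)
    {k : ℕ} (hk : 0 < k) :
    IsTestFunction (rect L K)
      (fun p : ℝ × ℝ => (cutoff L k p.1 * α p.1) * (cutoff K k p.2 * β p.2)) := by
  have hk' : (0 : ℝ) < (k : ℝ)⁻¹ := by positivity
  exact isTestFunction_mul_prod (α := fun x => cutoff L k x * α x)
    (β := fun y => cutoff K k y * β y) ((contDiff_cutoff L k).mul hα) ((contDiff_cutoff K k).mul hβ)
    (sub_lt_self L hk') (sub_lt_self K hk')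
    (fun x hx => by rw [cutoff_eq_zero hk hx, zero_mul])
    (fun x hx => by rw [cutoff_eq_zero hk hx, zero_mul])

/-- Integration by parts in `x`, against a product which vanishes at `x = ± L`. -/
theorem HasWeakGradient.integral_deriv_mul_x {u g₁ g₂ : ℝ × ℝ → E}
    (H : HasWeakGradient L K u g₁ g₂) {α β : ℝ → ℝ} (hα : ContDiff ℝ ∞ α) (hβ : ContDiff ℝ ∞ β)
    {C : ℝ} (hC : ∀ x ∈ Ioo (-L) L, |α x| ≤ C * (L - |x|)) :
    ∫ p in rect L K, (deriv α p.1 * β p.2) • u p = - ∫ p in rect L K, (α p.1 * β p.2) • g₁ p := by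
  have hcα : ∀ k, ContDiff ℝ ∞ fun x => cutoff L k x * α x := fun k => (contDiff_cutoff L k).mul hα
  have hcβ : ∀ k, ContDiff ℝ ∞ fun x => cutoff K k x * β x := fun k => (contDiff_cutoff K k).mul hβ
  obtain ⟨C₁, hC₁0, hC₁⟩ := exists_bound_Ioo hα.continuous L
  obtain ⟨C₂, hC₂0, hC₂⟩ := exists_bound_Ioo hβ.continuous K
  obtain ⟨C₃, hC₃0, hC₃⟩ := exists_abs_deriv_cutoff_mul_le_of_le hα hC
  -- Only the `x`-cutoff is differentiated, and `hC` controls that term. In `y` the cutoff tends to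
  -- `1` undifferentiated, so `β` needs no boundary condition.
  have t1 := tendsto_integral_mul_prod (H.memLp.integrable (by norm_num))
    (A := fun k => deriv fun x => cutoff L k x * α x) (B := fun k x => cutoff K k x * β x)
    (fun k => (hcα k).continuous_deriv (by simp)) (fun k => (hcβ k).continuous) hC₃0 hC₃
    (fun k x hx => (abs_cutoff_mul_le _ _ _ _).trans (hC₂ x hx))
    (fun x hx => tendsto_deriv_cutoff_mul hx hα) (fun x hx => tendsto_cutoff_mul hx _)
  have t2 := tendsto_integral_mul_prod (H.memLp_x.integrable (by norm_num))
    (A := fun k x => cutoff L k x * α x) (B := fun k x => cutoff K k x * β x)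
    (fun k => (hcα k).continuous) (fun k => (hcβ k).continuous) hC₁0
    (fun k x hx => (abs_cutoff_mul_le _ _ _ _).trans (hC₁ x hx))
    (fun k x hx => (abs_cutoff_mul_le _ _ _ _).trans (hC₂ x hx))
    (fun x hx => tendsto_cutoff_mul hx _) (fun x hx => tendsto_cutoff_mul hx _)
  refine tendsto_nhds_unique t1 (t2.neg.congr' ?_)
  filter_upwards [eventually_gt_atTop 0] with k hk
  rw [← H.weak_x _ (isTestFunction_cutoff_mul hα hβ hk)]
  simp only [fderiv_mul_prod_fst ((hcα k).differentiable (by simp))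
    ((hcβ k).differentiable (by simp))]

/-- Integration by parts in `y`, against a product which vanishes at `y = ± K`. -/
theorem HasWeakGradient.integral_deriv_mul_y {u g₁ g₂ : ℝ × ℝ → E}
    (H : HasWeakGradient L K u g₁ g₂) {α β : ℝ → ℝ} (hα : ContDiff ℝ ∞ α) (hβ : ContDiff ℝ ∞ β)
    {C : ℝ} (hC : ∀ x ∈ Ioo (-K) K, |β x| ≤ C * (K - |x|)) :
    ∫ p in rect L K, (α p.1 * deriv β p.2) • u p = - ∫ p in rect L K, (α p.1 * β p.2) • g₂ p := by
  have hcα : ∀ k, ContDiff ℝ ∞ fun x => cutoff L k x * α x := fun k => (contDiff_cutoff L k).mul hα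
  have hcβ : ∀ k, ContDiff ℝ ∞ fun x => cutoff K k x * β x := fun k => (contDiff_cutoff K k).mul hβ
  obtain ⟨C₁, hC₁0, hC₁⟩ := exists_bound_Ioo hα.continuous L
  obtain ⟨C₂, hC₂0, hC₂⟩ := exists_bound_Ioo hβ.continuous K
  obtain ⟨C₃, hC₃0, hC₃⟩ := exists_abs_deriv_cutoff_mul_le_of_le hβ hC
  have t1 := tendsto_integral_mul_prod (H.memLp.integrable (by norm_num))
    (A := fun k x => cutoff L k x * α x) (B := fun k => deriv fun x => cutoff K k x * β x)
    (fun k => (hcα k).continuous) (fun k => (hcβ k).continuous_deriv (by simp)) hC₁0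
    (fun k x hx => (abs_cutoff_mul_le _ _ _ _).trans (hC₁ x hx)) hC₃
    (fun x hx => tendsto_cutoff_mul hx _) (fun x hx => tendsto_deriv_cutoff_mul hx hβ)
  have t2 := tendsto_integral_mul_prod (H.memLp_y.integrable (by norm_num))
    (A := fun k x => cutoff L k x * α x) (B := fun k x => cutoff K k x * β x)
    (fun k => (hcα k).continuous) (fun k => (hcβ k).continuous) hC₁0
    (fun k x hx => (abs_cutoff_mul_le _ _ _ _).trans (hC₁ x hx))
    (fun k x hx => (abs_cutoff_mul_le _ _ _ _).trans (hC₂ x hx))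
    (fun x hx => tendsto_cutoff_mul hx _) (fun x hx => tendsto_cutoff_mul hx _)
  refine tendsto_nhds_unique t1 (t2.neg.congr' ?_)
  filter_upwards [eventually_gt_atTop 0] with k hk
  rw [← H.weak_y _ (isTestFunction_cutoff_mul hα hβ hk)]
  simp only [fderiv_mul_prod_snd ((hcα k).differentiable (by simp))
    ((hcβ k).differentiable (by simp))]

end

end GinzburgLandau

end

noncomputable section

open MeasureTheory Set Filter Topology
open scoped ContDiff ENNReal ComplexConjugate

namespace GinzburgLandau

/-! ### Trigonometric modes of an interval -/

/-- The frequencies of the Neumann eigenfunctions of `(-a, a)`. -/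
def freq (a : ℝ) (m : ℕ) : ℝ := m * Real.pi / (2 * a)

/-- The Neumann eigenfunctions of `(-a, a)`. -/
def cosMode (a : ℝ) (m : ℕ) (x : ℝ) : ℝ := Real.cos (freq a m * (x + a))

/-- The Dirichlet eigenfunctions of `(-a, a)`. -/
def sinMode (a : ℝ) (m : ℕ) (x : ℝ) : ℝ := Real.sin (freq a m * (x + a))

section Modes

variable {a : ℝ}

theorem freq_nonneg (ha : 0 < a) (m : ℕ) : 0 ≤ freq a m := by
  unfold freq; positivity

theorem freq_pos (ha : 0 < a) {m : ℕ} (hm : m ≠ 0) : 0 < freq a m := by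
  unfold freq; positivity

theorem freq_zero (a : ℝ) : freq a 0 = 0 := by simp [freq]

theorem freq_mul (ha : 0 < a) (m : ℕ) : freq a m * (2 * a) = m * Real.pi := by
  unfold freq; field_simp

theorem contDiff_cosMode (a : ℝ) (m : ℕ) : ContDiff ℝ ∞ (cosMode a m) := by
  unfold cosMode; fun_prop

theorem contDiff_sinMode (a : ℝ) (m : ℕ) : ContDiff ℝ ∞ (sinMode a m) := by
  unfold sinMode; fun_prop

theorem cosMode_zero (a x : ℝ) : cosMode a 0 x = 1 := by simp [cosMode, freq]

theorem hasDerivAt_cosMode (a : ℝ) (m : ℕ) (x : ℝ) :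
    HasDerivAt (cosMode a m) (-freq a m * sinMode a m x) x := by
  refine (((hasDerivAt_id' x).add_const a).const_mul (freq a m)).cos.congr_deriv ?_
  rw [sinMode]; ring

theorem hasDerivAt_sinMode (a : ℝ) (m : ℕ) (x : ℝ) :
    HasDerivAt (sinMode a m) (freq a m * cosMode a m x) x := by
  refine (((hasDerivAt_id' x).add_const a).const_mul (freq a m)).sin.congr_deriv ?_
  rw [cosMode]; ring

theorem abs_cosMode_le_one (a : ℝ) (m : ℕ) (x : ℝ) : |cosMode a m x| ≤ 1 := Real.abs_cos_le_one _

/-- `|sin t| ≤ |t|`, measured from either endpoint, since `freq a m * (2 * a)` is a multiple of `π`.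
This is the linear vanishing that integration by parts asks for. -/
theorem abs_sinMode_le (ha : 0 < a) (m : ℕ) {x : ℝ} (hx : x ∈ Ioo (-a) a) :
    |sinMode a m x| ≤ freq a m * (a - |x|) := by
  have hf := freq_nonneg ha m
  have h1 : |sinMode a m x| ≤ freq a m * (a + x) := by
    refine (Real.abs_sin_le_abs).trans (le_of_eq ?_)
    rw [abs_of_nonneg, add_comm]
    exact mul_nonneg hf (by linarith [hx.1])
  have h2 : |sinMode a m x| ≤ freq a m * (a - x) := by
    have : sinMode a m x = Real.sin (m * Real.pi - freq a m * (a - x)) := by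
      rw [← freq_mul ha, sinMode]
      congr 1; ring
    rw [this, Real.sin_nat_mul_pi_sub, abs_neg, abs_mul, abs_pow, abs_neg, abs_one, one_pow, one_mul]
    refine (Real.abs_sin_le_abs).trans (le_of_eq ?_)
    rw [abs_of_nonneg]
    exact mul_nonneg hf (by linarith [hx.2])
  rcases abs_cases x with ⟨h, _⟩ | ⟨h, _⟩
  · rw [h]; exact h2
  · rw [h, sub_neg_eq_add]; exact h1

theorem integral_cos_int_mul (ha : 0 < a) (j : ℤ) :
    ∫ x in (-a)..a, Real.cos (j * Real.pi / (2 * a) * (x + a)) = if j = 0 then 2 * a else 0 := by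
  split_ifs with hj
  · simp [hj]; ring
  · have hj' : (j : ℝ) ≠ 0 := by exact_mod_cast hj
    set w := (j : ℝ) * Real.pi / (2 * a) with hw
    have hw0 : w ≠ 0 := by rw [hw]; have := Real.pi_ne_zero; positivity
    have hd : ∀ x ∈ uIcc (-a) a,
        HasDerivAt (fun x => w⁻¹ * Real.sin (w * (x + a))) (Real.cos (w * (x + a))) x := by
      intro x _
      refine ((((hasDerivAt_id' x).add_const a).const_mul w).sin.const_mul w⁻¹).congr_deriv ?_
      field_simp
    rw [intervalIntegral.integral_eq_sub_of_hasDerivAt hd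
      (Continuous.intervalIntegrable (by fun_prop) _ _)]
    have : w * (a + a) = j * Real.pi := by rw [hw]; field_simp; ring
    rw [this, Real.sin_int_mul_pi]
    simp

theorem integral_cosMode_mul (ha : 0 < a) (m k : ℕ) :
    ∫ x in (-a)..a, cosMode a m x * cosMode a k x =
      if m = k then (if m = 0 then 2 * a else a) else 0 := by
  have h1 : ∀ x, cosMode a m x * cosMode a k x =
      1 / 2 * Real.cos (((m : ℤ) - k : ℤ) * Real.pi / (2 * a) * (x + a)) +
        1 / 2 * Real.cos (((m : ℤ) + k : ℤ) * Real.pi / (2 * a) * (x + a)) := by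
    intro x
    have e1 : (((m : ℤ) - k : ℤ) : ℝ) * Real.pi / (2 * a) * (x + a) =
        freq a m * (x + a) - freq a k * (x + a) := by unfold freq; push_cast; ring
    have e2 : (((m : ℤ) + k : ℤ) : ℝ) * Real.pi / (2 * a) * (x + a) =
        freq a m * (x + a) + freq a k * (x + a) := by unfold freq; push_cast; ring
    rw [e1, e2, Real.cos_sub, Real.cos_add, cosMode, cosMode]
    ring
  simp only [h1]
  rw [intervalIntegral.integral_add (Continuous.intervalIntegrable (by fun_prop) _ _)
    (Continuous.intervalIntegrable (by fun_prop) _ _), intervalIntegral.integral_const_mul,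
    intervalIntegral.integral_const_mul, integral_cos_int_mul ha, integral_cos_int_mul ha]
  by_cases h : m = k
  · subst h
    by_cases hm : m = 0
    · simp [hm]; ring
    · have : ¬ ((m : ℤ) + m = 0) := by omega
      simp [hm]
  · have e1 : ¬ ((m : ℤ) - k = 0) := by omega
    have e2 : ¬ ((m : ℤ) + k = 0) := by omega
    simp only [e1, e2, h, if_false]; ring

theorem integral_sinMode_mul (ha : 0 < a) (m k : ℕ) :
    ∫ x in (-a)..a, sinMode a (m + 1) x * sinMode a (k + 1) x = if m = k then a else 0 := by
  have h1 : ∀ x, sinMode a (m + 1) x * sinMode a (k + 1) x =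
      1 / 2 * Real.cos (((m : ℤ) - k : ℤ) * Real.pi / (2 * a) * (x + a)) -
        1 / 2 * Real.cos (((m : ℤ) + k + 2 : ℤ) * Real.pi / (2 * a) * (x + a)) := by
    intro x
    have e1 : (((m : ℤ) - k : ℤ) : ℝ) * Real.pi / (2 * a) * (x + a) =
        freq a (m + 1) * (x + a) - freq a (k + 1) * (x + a) := by unfold freq; push_cast; ring
    have e2 : (((m : ℤ) + k + 2 : ℤ) : ℝ) * Real.pi / (2 * a) * (x + a) =
        freq a (m + 1) * (x + a) + freq a (k + 1) * (x + a) := by unfold freq; push_cast; ring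
    rw [e1, e2, Real.cos_sub, Real.cos_add, sinMode, sinMode]
    ring
  simp only [h1]
  rw [intervalIntegral.integral_sub (Continuous.intervalIntegrable (by fun_prop) _ _)
    (Continuous.intervalIntegrable (by fun_prop) _ _), intervalIntegral.integral_const_mul,
    intervalIntegral.integral_const_mul, integral_cos_int_mul ha, integral_cos_int_mul ha]
  have e2 : ¬ ((m : ℤ) + k + 2 = 0) := by omega
  by_cases h : m = k
  · subst h
    simp [e2]
  · have e1 : ¬ ((m : ℤ) - k = 0) := by omega
    simp only [e1, e2, h, if_false]; ring

/-- Multiplication by the first mode only shifts indices, so it preserves the vanishing of all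
cosine coefficients. -/
theorem cosMode_one_mul (a : ℝ) (m : ℕ) (x : ℝ) :
    cosMode a 1 x * cosMode a (m + 1) x = 1 / 2 * cosMode a m x + 1 / 2 * cosMode a (m + 2) x := by
  have e1 : freq a m * (x + a) = freq a (m + 1) * (x + a) - freq a 1 * (x + a) := by
    unfold freq; push_cast; ring
  have e2 : freq a (m + 2) * (x + a) = freq a (m + 1) * (x + a) + freq a 1 * (x + a) := by
    unfold freq; push_cast; ring
  simp only [cosMode]
  rw [e1, e2, Real.cos_sub, Real.cos_add]
  ring

/-- The argument of the cosine runs through `[0, π]`. Injectivity on the closed interval gives the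
separation of points in Stone–Weierstrass. -/
theorem injOn_cosMode_one (ha : 0 < a) : InjOn (cosMode a 1) (Icc (-a) a) := by
  intro x hx y hy h
  have hf : freq a 1 * (2 * a) = Real.pi := by simpa using freq_mul ha 1
  have hf0 := freq_pos ha one_ne_zero
  have hmem : ∀ z ∈ Icc (-a) a, freq a 1 * (z + a) ∈ Icc 0 Real.pi := fun z hz =>
    ⟨mul_nonneg hf0.le (by linarith [hz.1]), by
      rw [← hf]
      exact mul_le_mul_of_nonneg_left (by linarith [hz.2]) hf0.le⟩
  have := mul_left_cancel₀ hf0.ne' (Real.injOn_cos (hmem x hx) (hmem y hy) h)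
  linarith

theorem cosMode_neg (ha : 0 < a) (m : ℕ) (x : ℝ) : cosMode a m (-x) = (-1) ^ m * cosMode a m x := by
  have : cosMode a m (-x) = Real.cos (m * Real.pi - freq a m * (x + a)) := by
    rw [← freq_mul ha, cosMode]
    congr 1; ring
  rw [this, Real.cos_nat_mul_pi_sub, cosMode]

end Modes

/-! ### The cosine basis of the rectangle -/

section Rect

variable {L K : ℝ}

theorem memLp_of_continuous {E : Type*} [NormedAddCommGroup E] [SecondCountableTopology E]
    {f : ℝ × ℝ → E} (hf : Continuous f) (p : ℝ≥0∞) : MemLp f p (rectMeasure L K) := by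
  obtain ⟨C, hC⟩ := ((isCompact_Icc (a := -L) (b := L)).prod
    (isCompact_Icc (a := -K) (b := K))).exists_bound_of_continuousOn hf.continuousOn
  refine MemLp.of_bound hf.aestronglyMeasurable C ((ae_restrict_iff' measurableSet_rect).2
    (Eventually.of_forall fun p hp => hC p ?_))
  exact prod_mono Ioo_subset_Icc_self Ioo_subset_Icc_self hp

/-- The element `α(x) β(y)` of `L²`. -/
def prodLp (L K : ℝ) {α β : ℝ → ℝ} (hα : Continuous α) (hβ : Continuous β) : L2 L K :=
  MemLp.toLp (fun p : ℝ × ℝ => ((α p.1 * β p.2 : ℝ) : ℂ)) (memLp_of_continuous (by fun_prop) 2)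

theorem inner_prodLp {α β : ℝ → ℝ} (hα : Continuous α) (hβ : Continuous β) (u : L2 L K) :
    inner ℂ (prodLp L K hα hβ) u = ∫ p in rect L K, (α p.1 * β p.2) • u p := by
  rw [L2.inner_def]
  refine integral_congr_ae ?_
  filter_upwards [MemLp.coeFn_toLp (memLp_of_continuous (L := L) (K := K)
    (f := fun p : ℝ × ℝ => ((α p.1 * β p.2 : ℝ) : ℂ)) (by fun_prop) 2)] with p hp
  rw [prodLp, hp, RCLike.inner_apply, Complex.conj_ofReal, Complex.real_smul, mul_comm]

theorem integral_prod_rect (hL : 0 < L) (hK : 0 < K) (α β : ℝ → ℝ) :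
    ∫ p in rect L K, α p.1 * β p.2 = (∫ x in (-L)..L, α x) * ∫ y in (-K)..K, β y := by
  rw [rect, Measure.volume_eq_prod, ← Measure.prod_restrict, integral_prod_mul,
    intervalIntegral.integral_of_le (by linarith), intervalIntegral.integral_of_le (by linarith),
    integral_Ioc_eq_integral_Ioo, integral_Ioc_eq_integral_Ioo]

theorem inner_prodLp_prodLp (hL : 0 < L) (hK : 0 < K) {α β α' β' : ℝ → ℝ} (hα : Continuous α)
    (hβ : Continuous β) (hα' : Continuous α') (hβ' : Continuous β') :
    inner ℂ (prodLp L K hα hβ) (prodLp L K hα' hβ') =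
      (((∫ x in (-L)..L, α x * α' x) * ∫ y in (-K)..K, β y * β' y : ℝ) : ℂ) := by
  rw [inner_prodLp, ← integral_prod_rect hL hK, ← integral_complex_ofReal]
  refine integral_congr_ae ?_
  filter_upwards [MemLp.coeFn_toLp (memLp_of_continuous (L := L) (K := K)
    (f := fun p : ℝ × ℝ => ((α' p.1 * β' p.2 : ℝ) : ℂ)) (by fun_prop) 2)] with p hp
  rw [prodLp, hp, Complex.real_smul]
  push_cast
  ring

/-- All cosine coefficients of the function vanish. -/
def CosineFree (L K : ℝ) (f : ℝ × ℝ → ℂ) : Prop :=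
  Integrable f (rectMeasure L K) ∧
    ∀ m n, ∫ p in rect L K, (cosMode L m p.1 * cosMode K n p.2) • f p = 0

theorem integrable_continuous_smul {f : ℝ × ℝ → ℂ} (hf : Integrable f (rectMeasure L K))
    {G : ℝ × ℝ → ℝ} (hG : Continuous G) : Integrable (fun p => G p • f p) (rectMeasure L K) := by
  obtain ⟨C, hC⟩ := ((isCompact_Icc (a := -L) (b := L)).prod
    (isCompact_Icc (a := -K) (b := K))).exists_bound_of_continuousOn hG.continuousOn
  refine hf.bdd_smul C hG.aestronglyMeasurable ((ae_restrict_iff' measurableSet_rect).2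
    (Eventually.of_forall fun p hp => hC p ?_))
  exact prod_mono Ioo_subset_Icc_self Ioo_subset_Icc_self hp

theorem continuous_cosMode_mul (L K : ℝ) (m n : ℕ) :
    Continuous fun p : ℝ × ℝ => cosMode L m p.1 * cosMode K n p.2 :=
  ((contDiff_cosMode L m).continuous.comp continuous_fst).mul
    ((contDiff_cosMode K n).continuous.comp continuous_snd)

theorem CosineFree.cosMode_one_fst {f : ℝ × ℝ → ℂ} (hf : CosineFree L K f) :
    CosineFree L K fun p => cosMode L 1 p.1 • f p := by
  refine ⟨integrable_continuous_smul hf.1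
    ((contDiff_cosMode L 1).continuous.comp continuous_fst), fun m n => ?_⟩
  have hi : ∀ m n, Integrable (fun p => (cosMode L m p.1 * cosMode K n p.2) • f p)
      (rectMeasure L K) := fun m n => integrable_continuous_smul hf.1 (continuous_cosMode_mul L K m n)
  rcases m with _ | m
  · rw [← hf.2 1 n]
    refine integral_congr_ae (Eventually.of_forall fun p => ?_)
    simp only [cosMode_zero, smul_smul]
    congr 1; ring
  · have : ∀ p : ℝ × ℝ, (cosMode L (m + 1) p.1 * cosMode K n p.2) • cosMode L 1 p.1 • f p =
        (1 / 2 : ℝ) • ((cosMode L m p.1 * cosMode K n p.2) • f p) +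
          (1 / 2 : ℝ) • ((cosMode L (m + 2) p.1 * cosMode K n p.2) • f p) := fun p => by
      simp only [smul_smul, ← add_smul]
      congr 1
      have := cosMode_one_mul L m p.1
      linear_combination cosMode K n p.2 * this
    simp only [this]
    rw [integral_add ((hi m n).fun_smul _) ((hi (m + 2) n).fun_smul _), integral_smul, integral_smul,
      hf.2, hf.2]
    simp

theorem CosineFree.cosMode_one_snd {f : ℝ × ℝ → ℂ} (hf : CosineFree L K f) :
    CosineFree L K fun p => cosMode K 1 p.2 • f p := by
  refine ⟨integrable_continuous_smul hf.1
    ((contDiff_cosMode K 1).continuous.comp continuous_snd), fun m n => ?_⟩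
  have hi : ∀ m n, Integrable (fun p => (cosMode L m p.1 * cosMode K n p.2) • f p)
      (rectMeasure L K) := fun m n => integrable_continuous_smul hf.1 (continuous_cosMode_mul L K m n)
  rcases n with _ | n
  · rw [← hf.2 m 1]
    refine integral_congr_ae (Eventually.of_forall fun p => ?_)
    simp only [cosMode_zero, smul_smul]
    congr 1; ring
  · have : ∀ p : ℝ × ℝ, (cosMode L m p.1 * cosMode K (n + 1) p.2) • cosMode K 1 p.2 • f p =
        (1 / 2 : ℝ) • ((cosMode L m p.1 * cosMode K n p.2) • f p) +
          (1 / 2 : ℝ) • ((cosMode L m p.1 * cosMode K (n + 2) p.2) • f p) := fun p => by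
      simp only [smul_smul, ← add_smul]
      congr 1
      have := cosMode_one_mul K n p.2
      linear_combination cosMode L m p.1 * this
    simp only [this]
    rw [integral_add ((hi m n).fun_smul _) ((hi m (n + 2)).fun_smul _), integral_smul, integral_smul,
      hf.2, hf.2]
    simp

/-- Stone–Weierstrass on the closed rectangle, for the algebra generated by the first mode in each
variable. Every element of this algebra maps cosine-free functions to cosine-free functions, so no
density of trigonometric polynomials has to be proved by hand. -/
theorem exists_multiplier_near (hL : 0 < L) (hK : 0 < K) {ψ : ℝ × ℝ → ℝ} (hψ : Continuous ψ)
    {ε : ℝ} (hε : 0 < ε) :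
    ∃ G : ℝ × ℝ → ℝ, Continuous G ∧ (∀ p ∈ rect L K, |ψ p - G p| ≤ ε) ∧
      ∀ f, CosineFree L K f → CosineFree L K fun p => G p • f p := by
  let X := (Icc (-L) L ×ˢ Icc (-K) K : Set (ℝ × ℝ))
  have hXc : CompactSpace X := isCompact_iff_compactSpace.1 (isCompact_Icc.prod isCompact_Icc)
  let X₁ : C(X, ℝ) := ⟨fun p => cosMode L 1 p.1.1,
    (contDiff_cosMode L 1).continuous.comp (continuous_fst.comp continuous_subtype_val)⟩
  let X₂ : C(X, ℝ) := ⟨fun p => cosMode K 1 p.1.2,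
    (contDiff_cosMode K 1).continuous.comp (continuous_snd.comp continuous_subtype_val)⟩
  let A : Subalgebra ℝ C(X, ℝ) := Algebra.adjoin ℝ {X₁, X₂}
  have hA : ∀ g ∈ A, ∃ G : ℝ × ℝ → ℝ, Continuous G ∧ (∀ p : X, G p = g p) ∧
      ∀ f, CosineFree L K f → CosineFree L K fun p => G p • f p := by
    intro g hg
    induction hg using Algebra.adjoin_induction with
    | mem g hg =>
      rcases hg with rfl | rfl
      · exact ⟨fun p => cosMode L 1 p.1, (contDiff_cosMode L 1).continuous.comp continuous_fst,
          fun _ => rfl, fun f hf => hf.cosMode_one_fst⟩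
      · exact ⟨fun p => cosMode K 1 p.2, (contDiff_cosMode K 1).continuous.comp continuous_snd,
          fun _ => rfl, fun f hf => hf.cosMode_one_snd⟩
    | algebraMap r =>
      refine ⟨fun _ => r, continuous_const, fun _ => rfl, fun f hf => ⟨hf.1.smul r, fun m n => ?_⟩⟩
      simp only [smul_comm _ r]
      rw [integral_smul, hf.2, smul_zero]
    | add g g' _ _ hg hg' =>
      obtain ⟨G, h1, h2, h3⟩ := hg
      obtain ⟨G', h1', h2', h3'⟩ := hg'
      refine ⟨fun p => G p + G' p, h1.add h1', fun p => by simp [h2, h2'], fun f hf => ?_⟩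
      simp only [add_smul]
      refine ⟨(h3 f hf).1.add (h3' f hf).1, fun m n => ?_⟩
      simp only [smul_add]
      rw [integral_add (integrable_continuous_smul (h3 f hf).1 (continuous_cosMode_mul L K m n))
        (integrable_continuous_smul (h3' f hf).1 (continuous_cosMode_mul L K m n)),
        (h3 f hf).2, (h3' f hf).2, add_zero]
    | mul g g' _ _ hg hg' =>
      obtain ⟨G, h1, h2, h3⟩ := hg
      obtain ⟨G', h1', h2', h3'⟩ := hg'
      refine ⟨fun p => G p * G' p, h1.mul h1', fun p => by simp [h2, h2'], fun f hf => ?_⟩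
      simp only [mul_smul]
      exact h3 _ (h3' f hf)
  have hsep : A.SeparatesPoints := by
    intro p q hpq
    by_cases h1 : p.1.1 = q.1.1
    · have h2 : p.1.2 ≠ q.1.2 := fun h => hpq (Subtype.ext (Prod.ext h1 h))
      exact ⟨X₂, ⟨X₂, Algebra.subset_adjoin (by simp), rfl⟩,
        fun h => h2 (injOn_cosMode_one hK p.2.2 q.2.2 h)⟩
    · exact ⟨X₁, ⟨X₁, Algebra.subset_adjoin (by simp), rfl⟩,
        fun h => h1 (injOn_cosMode_one hL p.2.1 q.2.1 h)⟩
  obtain ⟨⟨g, hgA⟩, hg⟩ := ContinuousMap.exists_mem_subalgebra_near_continuousMap_of_separatesPoints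
    A hsep ⟨fun p : X => ψ p, hψ.comp continuous_subtype_val⟩ ε hε
  obtain ⟨G, hG1, hG2, hG3⟩ := hA g hgA
  refine ⟨G, hG1, fun p hp => ?_, hG3⟩
  have hpX : p ∈ X := prod_mono Ioo_subset_Icc_self Ioo_subset_Icc_self hp
  have h2 := (ContinuousMap.norm_coe_le_norm _ ⟨p, hpX⟩).trans hg.le
  rw [abs_sub_comm]
  rw [hG2 ⟨p, hpX⟩]
  exact h2

/-- A test function is a uniform limit of multipliers `G`, and `∫ G f` is the coefficient of `G f`
at the constant mode, hence zero. -/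
theorem CosineFree.ae_eq_zero (hL : 0 < L) (hK : 0 < K) {f : ℝ × ℝ → ℂ}
    (hf2 : MemLp f 2 (rectMeasure L K)) (hf : CosineFree L K f) : f =ᵐ[rectMeasure L K] 0 := by
  refine ae_eq_zero_of_test hf2 fun ψ hψ => ?_
  have hψc := hψ.smooth.continuous
  refine norm_le_zero_iff.1 (le_of_forall_pos_le_add fun ε hε => ?_)
  set D := ∫ p in rect L K, ‖f p‖ with hD
  have hD0 : 0 ≤ D := integral_nonneg fun _ => norm_nonneg _
  obtain ⟨G, hG1, hG2, hG3⟩ := exists_multiplier_near hL hK hψc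
    (ε := ε / (D + 1)) (by positivity)
  have h0 : ∫ p in rect L K, G p • f p = 0 := by
    have := (hG3 f hf).2 0 0
    simpa [cosMode_zero] using this
  have h1 : ∫ p in rect L K, ψ p • f p = ∫ p in rect L K, (ψ p - G p) • f p := by
    simp only [sub_smul]
    rw [integral_sub (integrable_continuous_smul hf.1 hψc) (integrable_continuous_smul hf.1 hG1),
      h0, sub_zero]
  rw [h1, zero_add]
  calc ‖∫ p in rect L K, (ψ p - G p) • f p‖ ≤ ∫ p in rect L K, ε / (D + 1) * ‖f p‖ := by
        refine norm_integral_le_of_norm_le (hf.1.norm.const_mul _)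
          ((ae_restrict_iff' measurableSet_rect).2 (Eventually.of_forall fun p hp => ?_))
        rw [norm_smul]
        gcongr
        exact hG2 p hp
    _ = ε / (D + 1) * D := by rw [integral_const_mul]
    _ ≤ ε := by
        rw [div_mul_eq_mul_div, div_le_iff₀ (by positivity)]
        nlinarith

end Rect

end GinzburgLandau

end

noncomputable section

open MeasureTheory Set Filter Topology
open scoped ContDiff ENNReal ComplexConjugate

namespace GinzburgLandau

/-! ### Cosine Hilbert basis and Bessel estimates for weak gradients -/

section Basis

variable {L K : ℝ}

theorem orthonormal_normalize {H : Type*} [NormedAddCommGroup H] [InnerProductSpace ℂ H]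
    {κ : Type*} [DecidableEq κ] {f : κ → H} {N : κ → ℝ} (hN : ∀ q, 0 < N q)
    (h : ∀ q r, inner ℂ (f q) (f r) = if q = r then (N q : ℂ) else 0) :
    Orthonormal ℂ fun q => (((√(N q))⁻¹ : ℝ) : ℂ) • f q := by
  rw [orthonormal_iff_ite]
  intro q r
  rw [inner_smul_left, inner_smul_right, Complex.conj_ofReal, h]
  split_ifs with hqr
  · subst hqr
    rw [← Complex.ofReal_mul, ← Complex.ofReal_mul]
    have h1 : √(N q) ≠ 0 := (Real.sqrt_pos.2 (hN q)).ne'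
    have h2 : N q = √(N q) * √(N q) := (Real.mul_self_sqrt (hN q).le).symm
    conv_lhs => rw [h2]
    rw [← Complex.ofReal_one]
    congr 1
    rw [← h2]
    field_simp
    rw [Real.sq_sqrt (hN q).le]
  · simp

/-- The square of the `L²` norm of a cosine mode. -/
def modeNorm (a : ℝ) (m : ℕ) : ℝ := if m = 0 then 2 * a else a

theorem modeNorm_pos {a : ℝ} (ha : 0 < a) (m : ℕ) : 0 < modeNorm a m := by
  unfold modeNorm; split_ifs <;> positivity

theorem continuous_cosMode (a : ℝ) (m : ℕ) : Continuous (cosMode a m) :=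
  (contDiff_cosMode a m).continuous

theorem continuous_sinMode (a : ℝ) (m : ℕ) : Continuous (sinMode a m) :=
  (contDiff_sinMode a m).continuous

/-- The normalized products of cosine modes. -/
def cosVec (L K : ℝ) (q : ℕ × ℕ) : L2 L K :=
  (((√(modeNorm L q.1 * modeNorm K q.2))⁻¹ : ℝ) : ℂ) •
    prodLp L K (continuous_cosMode L q.1) (continuous_cosMode K q.2)

theorem orthonormal_cosVec (hL : 0 < L) (hK : 0 < K) : Orthonormal ℂ (cosVec L K) := by
  refine orthonormal_normalize (f := fun q : ℕ × ℕ => prodLp L K (continuous_cosMode L q.1)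
    (continuous_cosMode K q.2)) (fun q => mul_pos (modeNorm_pos hL _) (modeNorm_pos hK _))
    fun q r => ?_
  rw [inner_prodLp_prodLp hL hK, integral_cosMode_mul hL, integral_cosMode_mul hK]
  by_cases h1 : q.1 = r.1 <;> by_cases h2 : q.2 = r.2 <;> simp [h1, h2, Prod.ext_iff, modeNorm]

theorem inner_cosVec (q : ℕ × ℕ) (u : L2 L K) :
    inner ℂ (cosVec L K q) u = (((√(modeNorm L q.1 * modeNorm K q.2))⁻¹ : ℝ) : ℂ) *
      ∫ p in rect L K, (cosMode L q.1 p.1 * cosMode K q.2 p.2) • u p := by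
  rw [cosVec, inner_smul_left, Complex.conj_ofReal, inner_prodLp]

theorem eq_zero_of_inner_cosVec (hL : 0 < L) (hK : 0 < K) {u : L2 L K}
    (h : ∀ q, inner ℂ (cosVec L K q) u = 0) : u = 0 := by
  rw [Lp.eq_zero_iff_ae_eq_zero]
  refine CosineFree.ae_eq_zero hL hK (Lp.memLp u)
    ⟨(Lp.memLp u).integrable (by norm_num), fun m n => ?_⟩
  have h1 := h (m, n)
  rw [inner_cosVec] at h1
  refine (mul_eq_zero.1 h1).resolve_left ?_
  have := mul_pos (modeNorm_pos hL m) (modeNorm_pos hK n)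
  exact Complex.ofReal_ne_zero.2 (by positivity)

theorem orthogonal_span_cosVec (hL : 0 < L) (hK : 0 < K) :
    (Submodule.span ℂ (range (cosVec L K)))ᗮ = ⊥ := by
  rw [eq_bot_iff]
  intro u hu
  rw [Submodule.mem_orthogonal] at hu
  exact eq_zero_of_inner_cosVec hL hK fun q => hu _ (Submodule.subset_span ⟨q, rfl⟩)

/-- The cosine basis of `L²` of the rectangle. -/
def cosBasis (hL : 0 < L) (hK : 0 < K) : HilbertBasis (ℕ × ℕ) ℂ (L2 L K) :=
  HilbertBasis.mkOfOrthogonalEqBot (orthonormal_cosVec hL hK) (orthogonal_span_cosVec hL hK)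

theorem coe_cosBasis (hL : 0 < L) (hK : 0 < K) : ⇑(cosBasis hL hK) = cosVec L K :=
  HilbertBasis.coe_mkOfOrthogonalEqBot _ _

theorem not_finiteDimensional_L2 (hL : 0 < L) (hK : 0 < K) :
    ¬ FiniteDimensional ℂ (L2 L K) := fun _ =>
  not_finite_iff_infinite.2 (inferInstance : Infinite (ℕ × ℕ))
    (orthonormal_cosVec hL hK).linearIndependent.finite

theorem sum_inner_normalize_le {H : Type*} [NormedAddCommGroup H] [InnerProductSpace ℂ H]
    {P : ℕ × ℕ → Prop} {e : Subtype P → H} (he : Orthonormal ℂ e) {h : ℕ × ℕ → ℝ} {z : H}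
    (h0 : ∀ q, ¬ P q → h q = 0) (h1 : ∀ q : Subtype P, h q = ‖inner ℂ (e q) z‖ ^ 2)
    (F : Finset (ℕ × ℕ)) : ∑ q ∈ F, h q ≤ ‖z‖ ^ 2 := by
  classical
  rw [← Finset.sum_filter_add_sum_filter_not F P, Finset.sum_eq_zero (s := F.filter fun q => ¬ P q)
    (fun q hq => h0 q (Finset.mem_filter.1 hq).2), add_zero, ← Finset.sum_subtype_eq_sum_filter]
  simp only [h1]
  exact he.sum_inner_products_le z

/-- Integration by parts turns `freq L m` times a cosine coefficient of `u` into a sine-cosine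
coefficient of `g₁`, up to sign. Bessel's inequality for that orthonormal system finishes. The sines
vanish at the sides, so `u` needs no boundary condition. -/
theorem sum_freq_sq_mul_le_x (hL : 0 < L) (hK : 0 < K) {u g₁ g₂ : L2 L K}
    (H : HasWeakGradient L K u g₁ g₂) (F : Finset (ℕ × ℕ)) :
    ∑ q ∈ F, freq L q.1 ^ 2 * ‖inner ℂ (cosVec L K q) u‖ ^ 2 ≤ ‖g₁‖ ^ 2 := by
  have ho : Orthonormal ℂ fun q : {q : ℕ × ℕ // q.1 ≠ 0} =>
      (((√(L * modeNorm K q.1.2))⁻¹ : ℝ) : ℂ) •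
        prodLp L K (continuous_sinMode L q.1.1) (continuous_cosMode K q.1.2) := by
    refine orthonormal_normalize (f := fun q : {q : ℕ × ℕ // q.1 ≠ 0} => prodLp L K
      (continuous_sinMode L q.1.1) (continuous_cosMode K q.1.2))
      (fun q => mul_pos hL (modeNorm_pos hK _)) fun q r => ?_
    obtain ⟨⟨m, n⟩, hm⟩ := q
    obtain ⟨⟨m', n'⟩, hm'⟩ := r
    obtain ⟨m, rfl⟩ := Nat.exists_eq_succ_of_ne_zero hm
    obtain ⟨m', rfl⟩ := Nat.exists_eq_succ_of_ne_zero hm'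
    simp only [Nat.succ_eq_add_one]
    rw [inner_prodLp_prodLp hL hK, integral_sinMode_mul hL, integral_cosMode_mul hK]
    by_cases h1 : m = m' <;> by_cases h2 : n = n' <;> simp [h1, h2, modeNorm]
  refine sum_inner_normalize_le ho (fun q hq => ?_) (fun q => ?_) F
  · rw [not_not.1 hq, freq_zero]; simp
  · obtain ⟨⟨m, n⟩, hm⟩ := q
    have hibp := H.integral_deriv_mul_x (contDiff_sinMode L m) (contDiff_cosMode K n)
      (fun x hx => abs_sinMode_le hL m hx)
    -- For `m ≠ 0` the sine and cosine modes have the same norm, so the normalizing constants agree.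
    have hm' : modeNorm L m = L := if_neg hm
    rw [inner_smul_left, Complex.conj_ofReal, inner_prodLp, inner_cosVec]
    simp only [hm']
    rw [← norm_neg ((((√(L * modeNorm K n))⁻¹ : ℝ) : ℂ) * ∫ p in rect L K, (sinMode L m _ * _) • _),
      ← mul_neg, ← hibp]
    have : ∀ p : ℝ × ℝ, (deriv (sinMode L m) p.1 * cosMode K n p.2) • u p =
        freq L m • ((cosMode L m p.1 * cosMode K n p.2) • u p) := fun p => by
      rw [(hasDerivAt_sinMode L m p.1).deriv, smul_smul, mul_assoc]
    simp only [this]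
    rw [integral_smul, Complex.real_smul, norm_mul, norm_mul, norm_mul, Complex.norm_real (freq L m),
      mul_pow, mul_pow, mul_pow, Real.norm_eq_abs (freq L m), sq_abs]
    ring

theorem sum_freq_sq_mul_le_y (hL : 0 < L) (hK : 0 < K) {u g₁ g₂ : L2 L K}
    (H : HasWeakGradient L K u g₁ g₂) (F : Finset (ℕ × ℕ)) :
    ∑ q ∈ F, freq K q.2 ^ 2 * ‖inner ℂ (cosVec L K q) u‖ ^ 2 ≤ ‖g₂‖ ^ 2 := by
  have ho : Orthonormal ℂ fun q : {q : ℕ × ℕ // q.2 ≠ 0} =>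
      (((√(modeNorm L q.1.1 * K))⁻¹ : ℝ) : ℂ) •
        prodLp L K (continuous_cosMode L q.1.1) (continuous_sinMode K q.1.2) := by
    refine orthonormal_normalize (f := fun q : {q : ℕ × ℕ // q.2 ≠ 0} => prodLp L K
      (continuous_cosMode L q.1.1) (continuous_sinMode K q.1.2))
      (fun q => mul_pos (modeNorm_pos hL _) hK) fun q r => ?_
    obtain ⟨⟨m, n⟩, hn⟩ := q
    obtain ⟨⟨m', n'⟩, hn'⟩ := r
    obtain ⟨n, rfl⟩ := Nat.exists_eq_succ_of_ne_zero hn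
    obtain ⟨n', rfl⟩ := Nat.exists_eq_succ_of_ne_zero hn'
    simp only [Nat.succ_eq_add_one]
    rw [inner_prodLp_prodLp hL hK, integral_sinMode_mul hK, integral_cosMode_mul hL]
    by_cases h1 : m = m' <;> by_cases h2 : n = n' <;> simp [h1, h2, modeNorm]
  refine sum_inner_normalize_le ho (fun q hq => ?_) (fun q => ?_) F
  · rw [not_not.1 hq, freq_zero]; simp
  · obtain ⟨⟨m, n⟩, hn⟩ := q
    have hibp := H.integral_deriv_mul_y (contDiff_cosMode L m) (contDiff_sinMode K n)
      (fun x hx => abs_sinMode_le hK n hx)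
    have hn' : modeNorm K n = K := if_neg hn
    rw [inner_smul_left, Complex.conj_ofReal, inner_prodLp, inner_cosVec]
    simp only [hn']
    rw [← norm_neg ((((√(modeNorm L m * K))⁻¹ : ℝ) : ℂ) * ∫ p in rect L K, (_ * sinMode K n _) • _),
      ← mul_neg, ← hibp]
    have : ∀ p : ℝ × ℝ, (cosMode L m p.1 * deriv (sinMode K n) p.2) • u p =
        freq K n • ((cosMode L m p.1 * cosMode K n p.2) • u p) := fun p => by
      rw [(hasDerivAt_sinMode K n p.2).deriv, smul_smul]; congr 1; ring
    simp only [this]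
    rw [integral_smul, Complex.real_smul, norm_mul, norm_mul, norm_mul, Complex.norm_real (freq K n),
      mul_pow, mul_pow, mul_pow, Real.norm_eq_abs (freq K n), sq_abs]
    ring

/-- The eigenvalues of `(1 - Δ)⁻¹` with Neumann boundary conditions. -/
def neumannWeight (L K : ℝ) (q : ℕ × ℕ) : ℝ := (1 + freq L q.1 ^ 2 + freq K q.2 ^ 2)⁻¹

theorem neumannWeight_pos (q : ℕ × ℕ) : 0 < neumannWeight L K q := by
  unfold neumannWeight; positivity

theorem neumannWeight_le_one (q : ℕ × ℕ) : neumannWeight L K q ≤ 1 := by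
  unfold neumannWeight
  exact inv_le_one_of_one_le₀ (by nlinarith [sq_nonneg (freq L q.1), sq_nonneg (freq K q.2)])

theorem sum_inv_neumannWeight_mul_le (hL : 0 < L) (hK : 0 < K) {u g₁ g₂ : L2 L K}
    (H : HasWeakGradient L K u g₁ g₂) (F : Finset (ℕ × ℕ)) :
    ∑ q ∈ F, (neumannWeight L K q)⁻¹ * ‖inner ℂ (cosVec L K q) u‖ ^ 2 ≤
      ‖u‖ ^ 2 + ‖g₁‖ ^ 2 + ‖g₂‖ ^ 2 := by
  have h0 := (orthonormal_cosVec hL hK).sum_inner_products_le u (s := F)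
  have h1 := sum_freq_sq_mul_le_x hL hK H F
  have h2 := sum_freq_sq_mul_le_y hL hK H F
  refine le_trans (le_of_eq ?_) (add_le_add (add_le_add h0 h1) h2)
  rw [← Finset.sum_add_distrib, ← Finset.sum_add_distrib]
  refine Finset.sum_congr rfl fun q _ => ?_
  rw [neumannWeight, inv_inv]
  ring

theorem summable_inv_one_add_freq_sq {a : ℝ} (ha : 0 < a) :
    Summable fun m : ℕ => (1 + freq a m ^ 2)⁻¹ := by
  have h1 : Summable fun m : ℕ => ((freq a 1) ^ 2)⁻¹ * ((m : ℝ) ^ 2)⁻¹ :=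
    (Real.summable_nat_pow_inv.2 one_lt_two).mul_left _
  rw [← summable_nat_add_iff 1] at h1 ⊢
  refine h1.of_nonneg_of_le (fun m => by positivity) fun m => ?_
  have hf := freq_pos ha one_ne_zero
  rw [← mul_inv]
  refine inv_anti₀ (by positivity) ?_
  have : freq a (m + 1) = freq a 1 * ((m + 1 : ℕ) : ℝ) := by unfold freq; push_cast; ring
  rw [this, mul_pow]
  linarith

/-- `(1 + a + b) ^ 2 ≥ (1 + a) * (1 + b)` splits the double series into two convergent ones; the
first power of the weight would not be summable. -/
theorem summable_neumannWeight_sq (hL : 0 < L) (hK : 0 < K) :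
    Summable fun q => neumannWeight L K q ^ 2 := by
  refine ((summable_inv_one_add_freq_sq hL).mul_of_nonneg (summable_inv_one_add_freq_sq hK)
    (fun m => by positivity) fun m => by positivity).of_nonneg_of_le
    (fun q => by positivity) fun q => ?_
  unfold neumannWeight
  rw [sq]
  exact mul_le_mul
    (inv_anti₀ (by positivity) (by linarith [sq_nonneg (freq K q.2)]))
    (inv_anti₀ (by positivity) (by linarith [sq_nonneg (freq L q.1)]))
    (by positivity) (by positivity)

end Basis

end GinzburgLandau

end

noncomputable section

open MeasureTheory Set Filter Topology
open scoped ContDiff ENNReal ComplexConjugate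

namespace GinzburgLandau

/-! ### The form domain as a Hilbert space and the resolvent `J J*` -/

section FormSpace

variable {L K δ : ℝ}

theorem integral_smul_eq_inner {f : ℝ × ℝ → ℝ} (hf : MemLp f 2 (rectMeasure L K)) (u : L2 L K) :
    ∫ p in rect L K, f p • u p = inner ℂ (hf.ofReal (K := ℂ)).toLp u := by
  rw [L2.inner_def]
  refine integral_congr_ae ?_
  filter_upwards [(hf.ofReal (K := ℂ)).coeFn_toLp] with p hp
  rw [hp]
  simp [mul_comm]

theorem InFormDomain.congr_gradient {u u' g₁ g₁' g₂ g₂' : ℝ × ℝ → ℂ}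
    (hu : InFormDomain L K δ u g₁ g₂) (h : u =ᵐ[rectMeasure L K] u')
    (h₁ : g₁ =ᵐ[rectMeasure L K] g₁') (h₂ : g₂ =ᵐ[rectMeasure L K] g₂') :
    InFormDomain L K δ u' g₁' g₂' := by
  have key : ∀ (f : ℝ × ℝ → ℝ) {a b : ℝ × ℝ → ℂ}, a =ᵐ[rectMeasure L K] b →
      ∫ p in rect L K, f p • b p = ∫ p in rect L K, f p • a p :=
    fun f _ _ hab => integral_congr_ae (hab.mono fun p hp => by simp only [hp])
  exact
    { grad :=
        { memLp := hu.grad.memLp.ae_eq h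
          memLp_x := hu.grad.memLp_x.ae_eq h₁
          memLp_y := hu.grad.memLp_y.ae_eq h₂
          weak_x := fun ψ hψ => by rw [key _ h, key _ h₁]; exact hu.grad.weak_x ψ hψ
          weak_y := fun ψ hψ => by rw [key _ h, key _ h₂]; exact hu.grad.weak_y ψ hψ }
      trace := fun ψ hψ => by rw [key _ h, key _ h₁]; exact hu.trace ψ hψ }

theorem InFormDomain.zero : InFormDomain L K δ (fun _ => 0) (fun _ => 0) fun _ => 0 := by
  refine ⟨⟨MemLp.zero', MemLp.zero', MemLp.zero', ?_, ?_⟩, ?_⟩ <;> simp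

/-- Triples of square integrable functions. -/
abbrev L2Triple (L K : ℝ) : Type := PiLp 2 fun _ : Fin 3 => L2 L K

/-- The form domain of the magnetic Laplacian: the triples `(u, D₁u, D₂u)`. -/
def formSpace (L K δ h : ℝ) : Submodule ℂ (L2Triple L K) where
  -- Storing `D₁u` instead of the weak derivative makes the inherited inner product equal to the
  -- `L²` product plus the magnetic form.
  carrier := {q | InFormDomain L K δ (q 0) (fun p => q 1 p - Complex.I * h * p.2 * q 0 p) (q 2)}
  zero_mem' := by
    have hc : (fun _ => (0 : ℂ)) =ᵐ[rectMeasure L K] ⇑(0 : L2 L K) :=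
      (Lp.coeFn_zero ℂ 2 (rectMeasure L K)).symm
    refine InFormDomain.zero.congr_gradient hc ?_ hc
    filter_upwards [hc] with p hp
    simp only [PiLp.zero_apply, ← hp, mul_zero, sub_zero]
  add_mem' {q r} hq hr := by
    refine (InFormDomain.comb hq hr 1).congr_gradient ?_ ?_ ?_
    · filter_upwards [Lp.coeFn_add (q 0) (r 0)] with p hp
      simp only [PiLp.add_apply, hp, Pi.add_apply, one_mul]
    · filter_upwards [Lp.coeFn_add (q 0) (r 0), Lp.coeFn_add (q 1) (r 1)] with p hp hp'
      simp only [PiLp.add_apply, hp, hp', Pi.add_apply, one_mul]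
      ring
    · filter_upwards [Lp.coeFn_add (q 2) (r 2)] with p hp
      simp only [PiLp.add_apply, hp, Pi.add_apply, one_mul]
  smul_mem' c q hq := by
    refine (InFormDomain.comb hq InFormDomain.zero c).congr_gradient ?_ ?_ ?_
    · filter_upwards [Lp.coeFn_smul c (q 0)] with p hp
      simp only [PiLp.smul_apply, hp, Pi.smul_apply, smul_eq_mul, add_zero]
    · filter_upwards [Lp.coeFn_smul c (q 0), Lp.coeFn_smul c (q 1)] with p hp hp'
      simp only [PiLp.smul_apply, hp, hp', Pi.smul_apply, smul_eq_mul, add_zero]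
      ring
    · filter_upwards [Lp.coeFn_smul c (q 2)] with p hp
      simp only [PiLp.smul_apply, hp, Pi.smul_apply, smul_eq_mul, add_zero]

theorem memLp_sub_magnetic (h : ℝ) {u g : ℝ × ℝ → ℂ} (hu : MemLp u 2 (rectMeasure L K))
    (hg : MemLp g 2 (rectMeasure L K)) :
    MemLp (fun p => g p - Complex.I * h * p.2 * u p) 2 (rectMeasure L K) := by
  have := memLp_magnetic (-h) hu hg
  refine this.congr_norm (hg.1.sub ((Continuous.aestronglyMeasurable (by fun_prop)).mul hu.1))
    (Eventually.of_forall fun p => ?_)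
  push_cast
  congr 1
  ring

theorem integral_smul_sub_magnetic (h : ℝ) {ψ : ℝ × ℝ → ℝ} (hψ : Continuous ψ) (u d : L2 L K) :
    ∫ p in rect L K, ψ p • (d p - Complex.I * h * p.2 * u p) =
      (∫ p in rect L K, ψ p • d p) - Complex.I * h * ∫ p in rect L K, (ψ p * p.2) • u p := by
  rw [← integral_const_mul, ← integral_sub]
  · refine integral_congr_ae (Eventually.of_forall fun p => ?_)
    simp only [Complex.real_smul]
    push_cast
    ring
  · exact integrable_smul (memLp_of_continuous hψ 2) (Lp.memLp d)
  · exact (integrable_smul (memLp_of_continuous (by fun_prop) 2) (Lp.memLp u)).const_mul _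

/-- For fixed `ψ`, each weak identity equates two continuous functionals of the triple once the
magnetic term has been moved onto `ψ`. The trace condition, being of the same form, passes to limits
as well. -/
theorem isClosed_formSpace (L K δ h : ℝ) : IsClosed (formSpace L K δ h : Set (L2Triple L K)) := by
  have hc : ∀ {f : ℝ × ℝ → ℝ} (i : Fin 3), MemLp f 2 (rectMeasure L K) →
      Continuous fun q : L2Triple L K => ∫ p in rect L K, f p • q i p := fun {f} i hf => by
    simp only [integral_smul_eq_inner hf]
    exact continuous_const.inner (PiLp.continuous_apply 2 _ i)
  let SX : (ℝ × ℝ → ℝ) → Set (L2Triple L K) := fun ψ =>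
    {q | ∫ p in rect L K, fderiv ℝ ψ p (1, 0) • q 0 p = -((∫ p in rect L K, ψ p • q 1 p) -
      Complex.I * h * ∫ p in rect L K, (ψ p * p.2) • q 0 p)}
  let SY : (ℝ × ℝ → ℝ) → Set (L2Triple L K) := fun ψ =>
    {q | ∫ p in rect L K, fderiv ℝ ψ p (0, 1) • q 0 p = -∫ p in rect L K, ψ p • q 2 p}
  have hx : ∀ (U : Set (ℝ × ℝ)) ψ, IsTestFunction U ψ → IsClosed (SX ψ) := fun U ψ hψ =>
    isClosed_eq (hc 0 (hψ.memLp_fderiv _)) (((hc 1 hψ.memLp_two).sub (continuous_const.mul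
      (hc 0 (memLp_of_continuous (hψ.smooth.continuous.mul continuous_snd) 2)))).neg)
  have hy : ∀ ψ, IsTestFunction (rect L K) ψ → IsClosed (SY ψ) := fun ψ hψ =>
    isClosed_eq (hc 0 (hψ.memLp_fderiv _)) (hc 2 hψ.memLp_two).neg
  have : (formSpace L K δ h : Set (L2Triple L K)) =
      (⋂ ψ, ⋂ _ : IsTestFunction (rect L K) ψ, SX ψ) ∩
        (⋂ ψ, ⋂ _ : IsTestFunction (rect L K) ψ, SY ψ) ∩
        ⋂ ψ, ⋂ _ : IsTestFunction (insulated L K δ)ᶜ ψ, SX ψ := by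
    refine Set.ext fun q => ⟨fun H => ⟨⟨?_, ?_⟩, ?_⟩, fun H => ?_⟩
    rotate_left 3
    · obtain ⟨⟨H1, H2⟩, H3⟩ := H
      exact ⟨⟨Lp.memLp _, memLp_sub_magnetic h (Lp.memLp _) (Lp.memLp _), Lp.memLp _,
        fun ψ hψ => (mem_iInter₂.1 H1 ψ hψ : q ∈ SX ψ).trans
          (by rw [integral_smul_sub_magnetic h hψ.smooth.continuous]),
        fun ψ hψ => (mem_iInter₂.1 H2 ψ hψ : q ∈ SY ψ)⟩,
        fun ψ hψ => (mem_iInter₂.1 H3 ψ hψ : q ∈ SX ψ).trans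
          (by rw [integral_smul_sub_magnetic h hψ.smooth.continuous])⟩
    · exact mem_iInter₂.2 fun ψ hψ => (H.grad.weak_x ψ hψ).trans
        (by rw [integral_smul_sub_magnetic h hψ.smooth.continuous])
    · exact mem_iInter₂.2 fun ψ hψ => H.grad.weak_y ψ hψ
    · exact mem_iInter₂.2 fun ψ hψ => (H.trace ψ hψ).trans
        (by rw [integral_smul_sub_magnetic h hψ.smooth.continuous])
  rw [this]
  exact ((isClosed_iInter fun ψ => isClosed_iInter fun hψ => hx _ ψ hψ).inter
    (isClosed_iInter fun ψ => isClosed_iInter fun hψ => hy ψ hψ)).inter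
    (isClosed_iInter fun ψ => isClosed_iInter fun hψ => hx _ ψ hψ)

instance completeSpace_formSpace (L K δ h : ℝ) : CompleteSpace (formSpace L K δ h) :=
  (isClosed_formSpace L K δ h).completeSpace_coe

/-- The embedding of the form domain into `L²`. -/
def formEmbedding (L K δ h : ℝ) : formSpace L K δ h →L[ℂ] L2 L K :=
  (PiLp.proj 2 (fun _ : Fin 3 => L2 L K) 0).comp (formSpace L K δ h).subtypeL

/-- The element `(u, D₁u, D₂u)` of the form space. -/
def InFormDomain.toFormSpace {u g₁ g₂ : ℝ × ℝ → ℂ} (hu : InFormDomain L K δ u g₁ g₂) (h : ℝ) :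
    formSpace L K δ h :=
  ⟨WithLp.toLp 2 ![hu.grad.memLp.toLp, (memLp_magnetic h hu.grad.memLp hu.grad.memLp_x).toLp,
    hu.grad.memLp_y.toLp], by
    refine hu.congr_gradient hu.grad.memLp.coeFn_toLp.symm ?_ hu.grad.memLp_y.coeFn_toLp.symm
    filter_upwards [hu.grad.memLp.coeFn_toLp,
      (memLp_magnetic h hu.grad.memLp hu.grad.memLp_x).coeFn_toLp] with p h1 h2
    simp only [Matrix.cons_val_zero, Matrix.cons_val_one]
    rw [h1, h2]
    ring⟩

theorem InFormDomain.formEmbedding_toFormSpace {u g₁ g₂ : ℝ × ℝ → ℂ}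
    (hu : InFormDomain L K δ u g₁ g₂) (h : ℝ) :
    formEmbedding L K δ h (hu.toFormSpace h) = hu.grad.memLp.toLp := rfl

theorem inner_toLp {f g : ℝ × ℝ → ℂ} (hf : MemLp f 2 (rectMeasure L K))
    (hg : MemLp g 2 (rectMeasure L K)) :
    inner ℂ (hf.toLp : L2 L K) hg.toLp = ∫ p in rect L K, g p * conj (f p) := by
  rw [L2.inner_def]
  refine integral_congr_ae ?_
  filter_upwards [hf.coeFn_toLp, hg.coeFn_toLp] with p h1 h2
  rw [h1, h2]
  rfl

theorem InFormDomain.inner_toFormSpace {u g₁ g₂ v k₁ k₂ : ℝ × ℝ → ℂ}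
    (hu : InFormDomain L K δ u g₁ g₂) (hv : InFormDomain L K δ v k₁ k₂) (h : ℝ) :
    inner ℂ (hv.toFormSpace h) (hu.toFormSpace h) =
      (∫ p in rect L K, u p * conj (v p)) + magneticForm L K h u g₁ g₂ v k₁ k₂ := by
  have : inner ℂ (hv.toFormSpace h) (hu.toFormSpace h) =
      inner ℂ (hv.toFormSpace h : L2Triple L K) (hu.toFormSpace h : L2Triple L K) := rfl
  rw [this, PiLp.inner_apply, Fin.sum_univ_three]
  simp only [InFormDomain.toFormSpace, Matrix.cons_val_zero, Matrix.cons_val_one, Matrix.cons_val]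
  rw [inner_toLp, inner_toLp, inner_toLp, magneticForm, add_assoc, ← integral_add]
  · exact integrable_mul_conj (memLp_magnetic h hu.grad.memLp hu.grad.memLp_x)
      (memLp_magnetic h hv.grad.memLp hv.grad.memLp_x)
  · exact integrable_mul_conj hu.grad.memLp_y hv.grad.memLp_y

/-- Every element of the form space is a triple `(u, D₁u, D₂u)`. -/
theorem exists_toFormSpace_eq {h : ℝ} (q : formSpace L K δ h) :
    ∃ (g₁ g₂ : ℝ × ℝ → ℂ) (hq : InFormDomain L K δ (formEmbedding L K δ h q) g₁ g₂),
      hq.toFormSpace h = q := by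
  refine ⟨_, _, q.2, Subtype.ext ?_⟩
  ext i : 1
  fin_cases i
  · exact Lp.toLp_coeFn _ (Lp.memLp _)
  · refine Lp.ext ?_
    refine (memLp_magnetic h q.2.grad.memLp q.2.grad.memLp_x).coeFn_toLp.trans (Eventually.of_forall fun p => ?_)
    exact sub_add_cancel _ _
  · exact Lp.toLp_coeFn _ (Lp.memLp _)

open ContinuousLinearMap in
/-- The resolvent `(1 - (∇ - i h A₀)²)⁻¹`. -/
def magneticResolvent (L K δ h : ℝ) : L2 L K →L[ℂ] L2 L K :=
  formEmbedding L K δ h ∘L adjoint (formEmbedding L K δ h)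

/-- Adding `⟨u, v⟩` to the weak equation makes its left side the form inner product of `u` and `v`,
and its right side `⟨u - w, J v⟩`. This says that the adjoint of the embedding sends `u - w` to the
triple of `u`. -/
theorem isMagneticLaplacian_iff {h : ℝ} {u w : L2 L K} :
    IsMagneticLaplacian L K δ h u w ↔ magneticResolvent L K δ h (u - w) = u := by
  have hw : ∀ {v : ℝ × ℝ → ℂ} (hv : MemLp v 2 (rectMeasure L K)) (w : L2 L K),
      ∫ p in rect L K, w p * conj (v p) = inner ℂ hv.toLp w := fun hv w => by
    conv_rhs => rw [← Lp.toLp_coeFn w (Lp.memLp w)]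
    rw [inner_toLp]
  constructor
  · rintro ⟨g₁, g₂, hu, e⟩
    have : ContinuousLinearMap.adjoint (formEmbedding L K δ h) (u - w) = hu.toFormSpace h := by
      refine ext_inner_left ℂ fun v => ?_
      obtain ⟨k₁, k₂, hv, hvq⟩ := exists_toFormSpace_eq v
      have he := e _ _ _ hv
      rw [ContinuousLinearMap.adjoint_inner_right, ← hvq, hu.inner_toFormSpace hv,
        hv.formEmbedding_toFormSpace, inner_sub_right, ← hw, ← hw, ← he, sub_neg_eq_add]
    rw [magneticResolvent, ContinuousLinearMap.comp_apply, this, hu.formEmbedding_toFormSpace,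
      Lp.toLp_coeFn]
  · intro H
    set q := ContinuousLinearMap.adjoint (formEmbedding L K δ h) (u - w) with hq
    have hqu : formEmbedding L K δ h q = u := H
    obtain ⟨g₁, g₂, hu, hvq⟩ := exists_toFormSpace_eq q
    rw [← hqu]
    refine ⟨g₁, g₂, hu, fun v k₁ k₂ hv => ?_⟩
    have h1 := hu.inner_toFormSpace hv h
    rw [hvq, hq, ContinuousLinearMap.adjoint_inner_right, hv.formEmbedding_toFormSpace,
      inner_sub_right, ← hq, hw hv.grad.memLp, hqu] at h1
    rw [hw hv.grad.memLp, hqu]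
    linear_combination h1

/-- Such an `f` is orthogonal to the range of the embedding, which contains the test functions. -/
theorem adjoint_formEmbedding_injective {h : ℝ} (f : L2 L K)
    (hf : ContinuousLinearMap.adjoint (formEmbedding L K δ h) f = 0) : f = 0 := by
  refine (Lp.eq_zero_iff_ae_eq_zero).2 (ae_eq_zero_of_test (Lp.memLp f) fun ψ hψ => ?_)
  rw [integral_smul_eq_inner hψ.memLp_two]
  have h1 := (hψ.inFormDomain (δ := δ)).formEmbedding_toFormSpace h
  have : inner ℂ (formEmbedding L K δ h ((hψ.inFormDomain (δ := δ)).toFormSpace h)) f = 0 := by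
    rw [← ContinuousLinearMap.adjoint_inner_right, hf, inner_zero_right]
  rwa [h1] at this

end FormSpace

end GinzburgLandau

end

noncomputable section

open MeasureTheory Set Filter Topology
open scoped ContDiff ENNReal ComplexConjugate

namespace GinzburgLandau

/-! ### Spectrum of `𝓛` through the compact resolvent -/

section Resolvent

variable {L K δ : ℝ}

/-- The weak derivative differs from `D₁u` by `i h y u` with `|y| ≤ K`, so the Neumann estimate
carries over to the magnetic form norm. -/
theorem sum_inv_neumannWeight_mul_formEmbedding_le (hL : 0 < L) (hK : 0 < K) {h : ℝ}
    (q : formSpace L K δ h) (F : Finset (ℕ × ℕ)) :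
    ∑ j ∈ F, (neumannWeight L K j)⁻¹ * ‖inner ℂ (cosVec L K j) (formEmbedding L K δ h q)‖ ^ 2 ≤
      (2 + 2 * (|h| * K) ^ 2) * ‖q‖ ^ 2 := by
  set u : L2 L K := (q : L2Triple L K) 0 with hu
  set d : L2 L K := (q : L2Triple L K) 1 with hd
  set g : L2 L K := (q : L2Triple L K) 2 with hg
  have hm := memLp_sub_magnetic h (Lp.memLp u) (Lp.memLp d)
  have hdom : InFormDomain L K δ u hm.toLp g :=
    q.2.congr_gradient ae_eq_rfl hm.coeFn_toLp.symm ae_eq_rfl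
  refine (sum_inv_neumannWeight_mul_le hL hK hdom.grad F).trans ?_
  have hq : ‖q‖ ^ 2 = ‖u‖ ^ 2 + ‖d‖ ^ 2 + ‖g‖ ^ 2 := by
    rw [← Submodule.norm_coe, PiLp.norm_sq_eq_of_L2, Fin.sum_univ_three]
  have h1 : ‖d - hm.toLp‖ ≤ |h| * K * ‖u‖ := by
    refine Lp.norm_le_mul_norm_of_ae_le_mul ?_
    filter_upwards [Lp.coeFn_sub d hm.toLp, hm.coeFn_toLp,
      (ae_restrict_iff' measurableSet_rect).2 (Eventually.of_forall fun p hp => hp)] with p h1 h2 hp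
    rw [h1, Pi.sub_apply, h2, sub_sub_cancel]
    simp only [norm_mul, Complex.norm_I, Complex.norm_real, Real.norm_eq_abs, one_mul]
    have : |p.2| ≤ K := abs_le.2 ⟨hp.2.1.le, hp.2.2.le⟩
    gcongr
  have h2 : ‖hm.toLp‖ ≤ ‖d‖ + |h| * K * ‖u‖ := by
    calc ‖hm.toLp‖ = ‖d - (d - hm.toLp)‖ := by rw [sub_sub_cancel]
      _ ≤ ‖d‖ + ‖d - hm.toLp‖ := norm_sub_le _ _
      _ ≤ _ := by gcongr
  have h3 : ‖hm.toLp‖ ^ 2 ≤ 2 * ‖d‖ ^ 2 + 2 * (|h| * K) ^ 2 * ‖u‖ ^ 2 :=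
    calc ‖hm.toLp‖ ^ 2 ≤ (‖d‖ + |h| * K * ‖u‖) ^ 2 := by gcongr
      _ ≤ _ := by nlinarith [sq_nonneg (‖d‖ - |h| * K * ‖u‖)]
  rw [hq]
  nlinarith [sq_nonneg ‖u‖, sq_nonneg ‖g‖, mul_nonneg (sq_nonneg (|h| * K)) (sq_nonneg ‖d‖),
    mul_nonneg (sq_nonneg (|h| * K)) (sq_nonneg ‖g‖)]

theorem magneticResolvent_diagonal (hL : 0 < L) (hK : 0 < K) (h : ℝ) :
    IsCompactOperator (magneticResolvent L K δ h) ∧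
      ∃ (b : HilbertBasis ℕ ℂ (L2 L K)) (t : ℕ → ℝ), (∀ n, 0 < t n) ∧
        (∀ n y, inner ℂ (b n) (magneticResolvent L K δ h y) = t n * inner ℂ (b n) y) ∧
        Summable fun n => t n ^ 2 :=
  exists_hilbertBasis_eigenvectors_summable (not_finiteDimensional_L2 hL hK)
    adjoint_formEmbedding_injective (cosBasis hL hK) neumannWeight_pos neumannWeight_le_one
    (summable_neumannWeight_sq hL hK) (C := 2 + 2 * (|h| * K) ^ 2) (by positivity)
    (by rw [coe_cosBasis]; exact sum_inv_neumannWeight_mul_formEmbedding_le hL hK)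

variable {φ : ℝ × ℝ → ℝ}

theorem mem_potentialDomain (hφ : MemLp φ ∞ (rectMeasure L K)) (u : L2 L K) :
    u ∈ potentialDomain L K φ :=
  (Lp.memLp u).mul (p := ∞) (q := 2) (r := 2) hφ.ofReal

theorem ae_abs_le_toReal_eLpNorm (hφ : MemLp φ ∞ (rectMeasure L K)) :
    ∀ᵐ p ∂rectMeasure L K, |φ p| ≤ (eLpNorm φ ∞ (rectMeasure L K)).toReal := by
  filter_upwards [ae_le_eLpNormEssSup (f := φ) (μ := rectMeasure L K)] with p hp
  rw [eLpNorm_exponent_top]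
  have h2 : eLpNormEssSup φ (rectMeasure L K) ≠ ⊤ := by
    rw [← eLpNorm_exponent_top]; exact hφ.eLpNorm_ne_top
  have := ENNReal.toReal_mono h2 hp
  simpa using this

/-- Multiplication by a bounded potential as a bounded operator. -/
def potentialCLM (hφ : MemLp φ ∞ (rectMeasure L K)) : L2 L K →L[ℂ] L2 L K :=
  LinearMap.mkContinuous
    ((potentialMul L K φ).toFun ∘ₗ
      LinearMap.codRestrict (potentialDomain L K φ) LinearMap.id (mem_potentialDomain hφ))
    (eLpNorm φ ∞ (rectMeasure L K)).toReal fun u => by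
      refine Lp.norm_le_mul_norm_of_ae_le_mul ?_
      filter_upwards [MemLp.coeFn_toLp (mem_potentialDomain hφ u),
        ae_abs_le_toReal_eLpNorm hφ] with p hp hb
      refine (le_of_eq (congrArg norm hp)).trans ?_
      rw [norm_mul, Complex.norm_real]
      exact mul_le_mul_of_nonneg_right hb (norm_nonneg _)

theorem coeFn_potentialCLM (hφ : MemLp φ ∞ (rectMeasure L K)) (u : L2 L K) :
    potentialCLM hφ u =ᵐ[rectMeasure L K] fun p => (φ p : ℂ) * u p :=
  MemLp.coeFn_toLp (mem_potentialDomain hφ u)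

theorem magneticLaplacian_eq_iff {h : ℝ} {u w : L2 L K} :
    (∃ hu : u ∈ (magneticLaplacian L K δ h).domain, magneticLaplacian L K δ h ⟨u, hu⟩ = w) ↔
      IsMagneticLaplacian L K δ h u w := by
  have : (u, w) ∈ (magneticLaplacian L K δ h).graph ↔ IsMagneticLaplacian L K δ h u w := by
    rw [magneticLaplacian_graph]; rfl
  rw [← this, LinearPMap.mem_graph_iff]
  constructor
  · rintro ⟨hu, e⟩
    exact ⟨⟨u, hu⟩, rfl, e⟩
  · rintro ⟨⟨y, hy⟩, rfl, e⟩
    exact ⟨hy, e⟩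

/-- For bounded `φ` the potential is defined on all of `L²`, so the domain of `𝓛` is that of the
magnetic Laplacian. -/
theorem linearOp_eq_iff (hφ : MemLp φ ∞ (rectMeasure L K)) {h I : ℝ} {u w : L2 L K} :
    (∃ hu : u ∈ (linearOp L K δ h I φ).domain, linearOp L K δ h I φ ⟨u, hu⟩ = w) ↔
      IsMagneticLaplacian L K δ h u (w + (Complex.I * I) • potentialCLM hφ u) := by
  rw [← magneticLaplacian_eq_iff]
  constructor
  · rintro ⟨hu, e⟩
    refine ⟨hu.1, ?_⟩
    rw [← e]
    exact (sub_add_cancel _ _).symm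
  · rintro ⟨hu, e⟩
    refine ⟨⟨hu, mem_potentialDomain hφ u⟩, ?_⟩
    exact sub_eq_of_eq_add e

theorem linearOp_eq_iff_resolvent (hφ : MemLp φ ∞ (rectMeasure L K)) {h I : ℝ} {u w : L2 L K} :
    (∃ hu : u ∈ (linearOp L K δ h I φ).domain, linearOp L K δ h I φ ⟨u, hu⟩ = w) ↔
      magneticResolvent L K δ h (u - w - ((Complex.I * I) • potentialCLM hφ) u) = u := by
  rw [linearOp_eq_iff hφ, isMagneticLaplacian_iff, ← sub_sub]
  rfl

theorem mem_pointSpectrum_iff (hφ : MemLp φ ∞ (rectMeasure L K)) {h I : ℝ} {z : ℂ} :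
    z ∈ pointSpectrum (linearOp L K δ h I φ) ↔
      1 - z ∈ pencilEigenvalues (magneticResolvent L K δ h)
        ((Complex.I * I) • potentialCLM hφ) := by
  refine ⟨fun ⟨u, hu, e⟩ => ⟨u, hu, ?_⟩, fun ⟨u, hu, e⟩ => ?_⟩
  · have := (linearOp_eq_iff_resolvent hφ).1 ⟨u.2, e⟩
    rwa [sub_smul, one_smul]
  · rw [sub_smul, one_smul] at e
    obtain ⟨hm, e⟩ := (linearOp_eq_iff_resolvent hφ).2 e
    exact ⟨⟨u, hm⟩, hu, e⟩

theorem isEigenpair_iff (hφ : MemLp φ ∞ (rectMeasure L K)) {h I : ℝ} {lam : ℂ} {u : L2 L K} :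
    IsEigenpair L K δ h I φ lam u ↔ u ≠ 0 ∧
      IsMagneticLaplacian L K δ h u (-lam • u + (Complex.I * I) • potentialCLM hφ u) := by
  rw [IsEigenpair, linearOp_eq_iff hφ]

theorem exists_isEigenpair_iff (hφ : MemLp φ ∞ (rectMeasure L K)) {h I : ℝ} {lam : ℂ} :
    (∃ u, IsEigenpair L K δ h I φ lam u) ↔
      1 + lam ∈ pencilEigenvalues (magneticResolvent L K δ h)
        ((Complex.I * I) • potentialCLM hφ) := by
  refine exists_congr fun u => and_congr_right fun _ => ?_
  rw [linearOp_eq_iff_resolvent hφ, add_smul, one_smul, neg_smul, sub_neg_eq_add]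

/-- `z u - 𝓛 u = f` is equivalent to `u - T ((1 - z) u - B u) = T f`. If `z` is no eigenvalue, the
Fredholm alternative inverts the left side by some `S`, and `S T` is the resolvent. -/
theorem opSpectrum_eq_pointSpectrum (hL : 0 < L) (hK : 0 < K)
    (hφ : MemLp φ ∞ (rectMeasure L K)) (h I : ℝ) :
    opSpectrum (linearOp L K δ h I φ) = pointSpectrum (linearOp L K δ h I φ) := by
  refine Subset.antisymm (fun z hz => ?_) fun z hz => ?_
  · by_contra hp
    rw [mem_pointSpectrum_iff hφ] at hp
    set T := magneticResolvent L K δ h with hT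
    set B := (Complex.I * I) • potentialCLM hφ with hB
    have hTc : IsCompactOperator (T ∘L ((1 - z) • ContinuousLinearMap.id ℂ _ - B)) :=
      (magneticResolvent_diagonal hL hK h).1.comp_clm _
    obtain ⟨S, hS1, hS2⟩ := exists_inverse_of_isCompactOperator hTc fun u hu => by
      by_contra hu0
      exact hp ⟨u, hu0, hu⟩
    refine hz ⟨S ∘L T, fun f => ?_, fun u => ?_⟩
    · have h1 := hS1 (T f)
      have h2 : T ((S (T f)) - (z • S (T f) - f) - B (S (T f))) = S (T f) := by
        rw [sub_eq_iff_eq_add] at h1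
        conv_rhs => rw [h1]
        simp only [ContinuousLinearMap.comp_apply, _root_.sub_apply, _root_.smul_apply,
          ContinuousLinearMap.id_apply, map_sub, map_smul, sub_smul, one_smul]
        abel
      obtain ⟨hm, e⟩ := (linearOp_eq_iff_resolvent hφ).2 h2
      exact ⟨hm, (congrArg (z • S (T f) - ·) e).trans (sub_sub_cancel _ _)⟩
    · obtain ⟨u, hu⟩ := u
      obtain ⟨w, hw⟩ : ∃ w, linearOp L K δ h I φ ⟨u, hu⟩ = w := ⟨_, rfl⟩
      have h1 := (linearOp_eq_iff_resolvent hφ).1 ⟨hu, hw⟩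
      have h2 := hS2 u
      rw [hw]
      rw [← hT, ← hB] at h1
      simp only [ContinuousLinearMap.comp_apply, _root_.sub_apply, _root_.smul_apply,
          ContinuousLinearMap.id_apply] at h2 ⊢
      conv_rhs => rw [← h2]
      congr 1
      rw [eq_sub_iff_add_eq, ← map_add]
      conv_rhs => rw [← h1]
      congr 1
      rw [sub_smul, one_smul]
      abel
  · rintro ⟨R, -, hR⟩
    obtain ⟨u, hu, e⟩ := hz
    have := hR u
    rw [e, sub_self, map_zero] at this
    exact hu this.symm

end Resolvent

end GinzburgLandau

end

noncomputable section

open MeasureTheory Set Filter Topology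
open scoped ContDiff ENNReal ComplexConjugate

namespace GinzburgLandau

/-! ### A function with zero magnetic gradient and zero trace on the leads vanishes -/

section Constancy

variable {L K δ : ℝ}

theorem inner_cosVec_eq_zero_of_snd (hL : 0 < L) (hK : 0 < K) {u g₁ g₂ : L2 L K}
    (H : HasWeakGradient L K u g₁ g₂) (h2 : g₂ = 0) {q : ℕ × ℕ} (hq : q.2 ≠ 0) :
    inner ℂ (cosVec L K q) u = 0 := by
  have h := sum_freq_sq_mul_le_y hL hK H {q}
  rw [Finset.sum_singleton, h2, norm_zero] at h
  have hf := freq_pos hK hq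
  have h1 : ‖inner ℂ (cosVec L K q) u‖ ^ 2 ≤ 0 := by
    by_contra! h0
    have := mul_pos (pow_pos hf 2) h0
    simp at h
    linarith
  exact norm_eq_zero.1 (pow_eq_zero_iff two_ne_zero |>.1 (le_antisymm h1 (sq_nonneg _)))

/-- The hypothesis says that `u` does not depend on `y`; by Parseval, `β` enters only through its
mean. -/
theorem integral_mul_smul_eq_zero (hL : 0 < L) (hK : 0 < K) {u : L2 L K}
    (hu : ∀ q : ℕ × ℕ, q.2 ≠ 0 → inner ℂ (cosVec L K q) u = 0) {α β : ℝ → ℝ} (hα : Continuous α)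
    (hβ : Continuous β) (hβ0 : ∫ y in (-K)..K, β y = 0) :
    ∫ p in rect L K, (α p.1 * β p.2) • u p = 0 := by
  rw [← inner_prodLp hα hβ, ← (cosBasis hL hK).tsum_inner_mul_inner]
  refine (tsum_congr fun q => ?_).trans tsum_zero
  rw [coe_cosBasis]
  by_cases hq : q.2 = 0
  · obtain ⟨m, n⟩ := q
    obtain rfl : n = 0 := hq
    rw [cosVec, inner_smul_right, inner_prodLp_prodLp hL hK]
    simp [cosMode_zero, hβ0]
  · rw [hu q hq, mul_zero]

/-- A test function of product form which meets the boundary of the rectangle only in the leads. -/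
theorem isTestFunction_lead (hδK : δ < K) {α β : ℝ → ℝ} (hα : ContDiff ℝ ∞ α)
    (hβ : ContDiff ℝ ∞ β) (hαc : HasCompactSupport α) {r : ℝ} (hr : r < δ)
    (hβr : tsupport β ⊆ Icc (-r) r) :
    IsTestFunction (insulated L K δ)ᶜ fun p : ℝ × ℝ => α p.1 * β p.2 := by
  have hβc : HasCompactSupport β := isCompact_Icc.of_isClosed_subset (isClosed_tsupport β) hβr
  have hsub : tsupport (fun p : ℝ × ℝ => α p.1 * β p.2) ⊆ tsupport α ×ˢ tsupport β := by
    refine closure_minimal (fun p hp => ?_) ((isClosed_tsupport α).prod (isClosed_tsupport β))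
    rw [Function.mem_support, mul_ne_zero_iff] at hp
    exact ⟨subset_tsupport _ hp.1, subset_tsupport _ hp.2⟩
  refine ⟨by fun_prop, (hαc.prod hβc).of_isClosed_subset (isClosed_tsupport _) hsub,
    fun p hp => ?_⟩
  have hp2 := hβr (hsub hp).2
  have hp2' : |p.2| ≤ r := abs_le.2 hp2
  rintro ⟨hfr, hlead⟩
  rw [rect, frontier_prod_eq] at hfr
  rcases hfr with h | h
  · have hK' : -K < K := by linarith [abs_nonneg p.2]
    have h2 := h.2
    rw [frontier_Ioo hK'] at h2
    rcases h2 with h2 | h2 <;> rw [h2] at hp2 <;> linarith [hp2.1, hp2.2]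
  · by_cases hL : -L < L
    · have h1 := h.1
      rw [frontier_Ioo hL] at h1
      refine hlead ⟨?_, by linarith⟩
      rcases h1 with h1 | h1
      · rw [h1, abs_neg, abs_of_pos (by linarith)]
      · rw [h1, abs_of_pos (by linarith)]
    · have h1 := h.1
      rw [Ioo_eq_empty hL, frontier_empty] at h1
      exact h1

/-- The trace identity for product test functions supported near the leads. -/
theorem InFormDomain.integral_deriv_mul_lead (hδK : δ < K) {u g₁ g₂ : ℝ × ℝ → ℂ}
    (H : InFormDomain L K δ u g₁ g₂) {α β : ℝ → ℝ} (hα : ContDiff ℝ ∞ α) (hβ : ContDiff ℝ ∞ β)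
    {r : ℝ} (hr : r < δ) (hβr : tsupport β ⊆ Icc (-r) r) :
    ∫ p in rect L K, (deriv α p.1 * β p.2) • u p = - ∫ p in rect L K, (α p.1 * β p.2) • g₁ p := by
  have hχ0 : (0 : ℝ) < |L| + 1 := by positivity
  -- The trace condition asks for compact support in the plane. The bump is `1` around `[-L, L]`, so
  -- neither integral changes.
  let χ : ContDiffBump (0 : ℝ) := ⟨|L| + 1, |L| + 2, hχ0, by linarith⟩
  have hχ : ∀ x ∈ Ioo (-L) L, (fun x => χ x * α x) =ᶠ[𝓝 x] α := fun x hx => by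
    have : χ =ᶠ[𝓝 x] 1 := χ.eventuallyEq_one_of_mem_ball (by
      rw [mem_ball_zero_iff, Real.norm_eq_abs]
      have : |x| < |L| := (abs_lt.2 hx).trans_le (le_abs_self L)
      change |x| < |L| + 1
      linarith)
    filter_upwards [this] with y hy
    rw [hy, Pi.one_apply, one_mul]
  have hχα : ContDiff ℝ ∞ fun x => χ x * α x := χ.contDiff.mul hα
  have h := H.trace _ (isTestFunction_lead hδK hχα hβ χ.hasCompactSupport.mul_right hr hβr)
  refine Eq.trans ?_ (h.trans ?_)
  · refine setIntegral_congr_fun measurableSet_rect fun p hp => ?_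
    rw [fderiv_mul_prod_fst (hχα.differentiable (by simp)) (hβ.differentiable (by simp)),
      (hχ p.1 hp.1).deriv_eq]
  · congr 1
    refine setIntegral_congr_fun measurableSet_rect fun p hp => ?_
    rw [show χ p.1 * α p.1 = α p.1 from (hχ p.1 hp.1).self_of_nhds]

theorem exists_contDiff_deriv_eq_cosMode (ha : 0 < L) (m : ℕ) :
    ∃ α : ℝ → ℝ, ContDiff ℝ ∞ α ∧ deriv α = cosMode L m := by
  rcases Nat.eq_zero_or_pos m with rfl | hm
  · refine ⟨id, contDiff_id, ?_⟩
    ext x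
    rw [cosMode_zero, deriv_id]
  · have hf := freq_pos ha hm.ne'
    refine ⟨fun x => (freq L m)⁻¹ * sinMode L m x, contDiff_const.mul (contDiff_sinMode L m), ?_⟩
    ext x
    rw [((hasDerivAt_sinMode L m x).const_mul _).deriv]
    field_simp

/-- A function of the form domain whose magnetic gradient vanishes is zero. -/
theorem InFormDomain.eq_zero_of_gradient (hL : 0 < L) (hδ : 0 < δ) (hδK : δ < K) {h : ℝ}
    {u g₁ g₂ : L2 L K} (H : InFormDomain L K δ u g₁ g₂)
    (h1 : ∀ᵐ p ∂rectMeasure L K, g₁ p + Complex.I * h * p.2 * u p = 0) (h2 : g₂ = 0) : u = 0 := by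
  have hK : 0 < K := hδ.trans hδK
  have hu : ∀ q : ℕ × ℕ, q.2 ≠ 0 → inner ℂ (cosVec L K q) u = 0 := fun q hq =>
    inner_cosVec_eq_zero_of_snd hL hK H.grad h2 hq
  -- A bump in `y` supported inside the leads. It is even, so the magnetic term, which carries `b y
  -- * y`, integrates to zero against a function of `x` alone.
  let b : ContDiffBump (0 : ℝ) := ⟨δ / 4, δ / 2, by linarith, by linarith⟩
  have hbr : tsupport b ⊆ Icc (-(δ / 2)) (δ / 2) := by
    rw [b.tsupport_eq, Real.closedBall_eq_Icc]
    simp [b]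
  have hb0 : 0 < ∫ y in (-K)..K, b y := by
    refine intervalIntegral.integral_pos (by linarith) b.continuous.continuousOn
      (fun _ _ => b.nonneg) ⟨0, ⟨by linarith, hK.le⟩, b.pos_of_mem_ball ?_⟩
    exact Metric.mem_ball_self b.rOut_pos
  have hodd : ∫ y in (-K)..K, b y * y = 0 := by
    have h1 : ∫ y in (-K)..K, b (-y) * -y = ∫ y in (-K)..K, b y * y := by
      rw [intervalIntegral.integral_comp_neg (fun y => b y * y), neg_neg]
    have h2 : ∫ y in (-K)..K, b (-y) * -y = -∫ y in (-K)..K, b y * y := by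
      rw [← intervalIntegral.integral_neg]
      refine intervalIntegral.integral_congr fun y _ => ?_
      simp only [b.neg, mul_neg]
    linarith
  refine eq_zero_of_inner_cosVec hL hK fun q => ?_
  by_cases hq : q.2 = 0
  swap; · exact hu q hq
  obtain ⟨m, n⟩ := q
  obtain rfl : n = 0 := hq
  obtain ⟨α, hα, hαd⟩ := exists_contDiff_deriv_eq_cosMode hL m
  -- `α` need not vanish at `x = ± L`: there is no boundary term because the trace of `u` vanishes
  -- on the leads.
  have e1 := H.integral_deriv_mul_lead hδK hα b.contDiff (by linarith) hbr
  have e2 : ∫ p in rect L K, (α p.1 * b p.2) • g₁ p =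
      -(Complex.I * h) * ∫ p in rect L K, (α p.1 * (b p.2 * p.2)) • u p := by
    rw [← integral_const_mul]
    refine integral_congr_ae (h1.mono fun p hp => ?_)
    simp only [Complex.real_smul, eq_neg_of_add_eq_zero_left hp]
    push_cast
    ring
  rw [e2, integral_mul_smul_eq_zero hL hK hu hα.continuous (β := fun y => b y * y)
    (b.continuous.mul continuous_id) hodd, mul_zero, neg_zero,
    hαd] at e1
  -- The mean of `b`: replacing `b` by `c` leaves the integral against `u` unchanged and produces a
  -- cosine coefficient.
  set c := (∫ y in (-K)..K, b y) / (2 * K) with hc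
  have hc0 : c ≠ 0 := by positivity
  have e3 := integral_mul_smul_eq_zero hL hK hu (continuous_cosMode L m)
    (β := fun y => b y - c) (b.continuous.sub continuous_const) (by
      rw [intervalIntegral.integral_sub (b.continuous.intervalIntegrable _ _) (by simp)]
      simp [hc]
      field_simp
      ring)
  have e4 : ∫ p in rect L K, (cosMode L m p.1 * (b p.2 - c)) • u p =
      (∫ p in rect L K, (cosMode L m p.1 * b p.2) • u p) -
        c * ∫ p in rect L K, (cosMode L m p.1 * cosMode K 0 p.2) • u p := by
    have hi := (Lp.memLp u).integrable (q := 2) (by norm_num)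
    rw [← integral_const_mul, ← integral_sub]
    · refine integral_congr_ae (Eventually.of_forall fun p => ?_)
      simp only [Complex.real_smul, cosMode_zero]
      push_cast
      ring
    · refine integrable_continuous_smul hi (G := fun p => cosMode L m p.1 * b p.2) ?_
      exact ((continuous_cosMode L m).comp continuous_fst).mul (b.continuous.comp continuous_snd)
    · refine (integrable_continuous_smul hi
        (G := fun p => cosMode L m p.1 * cosMode K 0 p.2) ?_).const_mul _
      exact ((continuous_cosMode L m).comp continuous_fst).mul
        ((continuous_cosMode K 0).comp continuous_snd)
  rw [e3, e1, zero_sub, zero_eq_neg, mul_eq_zero, Complex.ofReal_eq_zero] at e4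
  rw [inner_cosVec, e4.resolve_left hc0, mul_zero]

end Constancy

/-! ### Energy identity and bounds for the eigenvalues -/

section Eigenvalues

variable {L K δ h I : ℝ} {φ : ℝ × ℝ → ℝ}

theorem integral_mul_conj_self (f : ℝ × ℝ → ℂ) :
    ∫ p in rect L K, f p * conj (f p) = ((∫ p in rect L K, ‖f p‖ ^ 2 : ℝ) : ℂ) := by
  rw [← integral_complex_ofReal]
  refine integral_congr_ae (Eventually.of_forall fun p => ?_)
  simp only [Complex.mul_conj, Complex.normSq_eq_norm_sq]

theorem magneticForm_self {u g₁ g₂ : ℝ × ℝ → ℂ} (hu : InFormDomain L K δ u g₁ g₂) (h : ℝ) :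
    magneticForm L K h u g₁ g₂ u g₁ g₂ =
      ((∫ p in rect L K, ‖g₁ p + Complex.I * h * p.2 * u p‖ ^ 2) +
        ∫ p in rect L K, ‖g₂ p‖ ^ 2 : ℝ) := by
  rw [magneticForm, integral_add, integral_mul_conj_self, integral_mul_conj_self,
    Complex.ofReal_add]
  · exact integrable_mul_conj (memLp_magnetic h hu.grad.memLp hu.grad.memLp_x)
      (memLp_magnetic h hu.grad.memLp hu.grad.memLp_x)
  · exact integrable_mul_conj hu.grad.memLp_y hu.grad.memLp_y

theorem integrable_norm_sq_of_memLp {f : ℝ × ℝ → ℂ} (hf : MemLp f 2 (rectMeasure L K)) :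
    Integrable (fun p => ‖f p‖ ^ 2) (rectMeasure L K) := by
  simpa using hf.integrable_norm_pow two_ne_zero

theorem ae_eq_zero_of_integral_norm_sq {f : ℝ × ℝ → ℂ} (hf : MemLp f 2 (rectMeasure L K))
    (h : ∫ p in rect L K, ‖f p‖ ^ 2 = 0) : f =ᵐ[rectMeasure L K] 0 := by
  rw [integral_eq_zero_iff_of_nonneg (fun p => by positivity) (integrable_norm_sq_of_memLp hf)] at h
  exact h.mono fun p hp => by simpa using hp

theorem integral_norm_sq_pos {u : L2 L K} (hu : u ≠ 0) : 0 < ∫ p in rect L K, ‖u p‖ ^ 2 := by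
  refine (integral_nonneg fun p => by positivity).lt_of_ne fun h0 => hu ?_
  exact (Lp.eq_zero_iff_ae_eq_zero).2 (ae_eq_zero_of_integral_norm_sq (Lp.memLp u) h0.symm)

/-- The energy identity of an eigenpair. -/
theorem exists_energy_identity (hφ : MemLp φ ∞ (rectMeasure L K)) {lam : ℂ} {u : L2 L K}
    (hu : IsEigenpair L K δ h I φ lam u) :
    ∃ g₁ g₂ : L2 L K, InFormDomain L K δ u g₁ g₂ ∧
      lam.re * ∫ p in rect L K, ‖u p‖ ^ 2 =
        (∫ p in rect L K, ‖g₁ p + Complex.I * h * p.2 * u p‖ ^ 2) +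
          ∫ p in rect L K, ‖g₂ p‖ ^ 2 ∧
      lam.im * ∫ p in rect L K, ‖u p‖ ^ 2 = I * ∫ p in rect L K, φ p * ‖u p‖ ^ 2 := by
  obtain ⟨hu0, G₁, G₂, hdom, e⟩ := (isEigenpair_iff hφ).1 hu
  have hdom' : InFormDomain L K δ u hdom.grad.memLp_x.toLp hdom.grad.memLp_y.toLp :=
    hdom.congr_gradient ae_eq_rfl hdom.grad.memLp_x.coeFn_toLp.symm
      hdom.grad.memLp_y.coeFn_toLp.symm
  have hm := magneticForm_self hdom h
  -- Testing with `u` itself gives `-∫ |Du|² = -λ ∫ |u|² + i I ∫ φ |u|²`, to be split into real and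
  -- imaginary parts.
  have e' := e _ _ _ hdom
  have hiu := integrable_norm_sq_of_memLp (Lp.memLp u)
  have hφu : Integrable (fun p => φ p * ‖u p‖ ^ 2) (rectMeasure L K) :=
    hiu.bdd_mul hφ.1 (ae_abs_le_toReal_eLpNorm hφ)
  have hw : ∫ p in rect L K, (-lam • u + (Complex.I * I) • potentialCLM hφ u) p * conj (u p) =
      -lam * (∫ p in rect L K, ‖u p‖ ^ 2 : ℝ) +
        Complex.I * I * (∫ p in rect L K, φ p * ‖u p‖ ^ 2 : ℝ) := by
    rw [← integral_complex_ofReal, ← integral_complex_ofReal, ← integral_const_mul,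
      ← integral_const_mul, ← integral_add (hiu.ofReal.const_mul _) (hφu.ofReal.const_mul _)]
    refine integral_congr_ae ?_
    filter_upwards [Lp.coeFn_add (-lam • u) ((Complex.I * I) • potentialCLM hφ u),
      Lp.coeFn_smul (-lam) u, Lp.coeFn_smul (Complex.I * I) (potentialCLM hφ u),
      coeFn_potentialCLM hφ u] with p h1 h2 h3 h4
    rw [h1, Pi.add_apply, h2, h3, Pi.smul_apply, Pi.smul_apply, h4]
    have : u p * conj (u p) = ((‖u p‖ ^ 2 : ℝ) : ℂ) := by
      rw [Complex.mul_conj, Complex.normSq_eq_norm_sq]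
    push_cast at this ⊢
    simp only [smul_eq_mul]
    linear_combination (-lam + Complex.I * I * φ p) * this
  rw [hw, hm] at e'
  refine ⟨_, _, hdom', ?_, ?_⟩
  · have h1 : ∫ p in rect L K, ‖(MemLp.toLp G₁ hdom.grad.memLp_x : L2 L K) p + Complex.I * h * p.2 * u p‖ ^ 2 =
        ∫ p in rect L K, ‖G₁ p + Complex.I * h * p.2 * u p‖ ^ 2 :=
      integral_congr_ae (hdom.grad.memLp_x.coeFn_toLp.mono fun p hp => by simp only [hp])
    have h2 : ∫ p in rect L K, ‖(MemLp.toLp G₂ hdom.grad.memLp_y : L2 L K) p‖ ^ 2 = ∫ p in rect L K, ‖G₂ p‖ ^ 2 :=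
      integral_congr_ae (hdom.grad.memLp_y.coeFn_toLp.mono fun p hp => by simp only [hp])
    rw [h1, h2]
    have := congrArg Complex.re e'
    simp only [Complex.neg_re, Complex.ofReal_re, Complex.add_re, Complex.mul_re, Complex.I_re,
      Complex.I_im, Complex.ofReal_im, Complex.mul_im] at this
    linarith
  · have := congrArg Complex.im e'
    simp only [Complex.neg_im, Complex.neg_re, Complex.ofReal_re, Complex.add_im, Complex.mul_re,
      Complex.I_re, Complex.I_im, Complex.ofReal_im, Complex.mul_im] at this
    linarith

/-- A nonpositive real part would force the whole magnetic gradient to vanish, and the condition on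
the leads then gives `u = 0`. -/
theorem IsEigenpair.re_pos (hL : 0 < L) (hδ : 0 < δ) (hδK : δ < K)
    (hφ : MemLp φ ∞ (rectMeasure L K)) {lam : ℂ} {u : L2 L K}
    (hu : IsEigenpair L K δ h I φ lam u) : 0 < lam.re := by
  obtain ⟨g₁, g₂, hdom, e, -⟩ := exists_energy_identity hφ hu
  have hpos := integral_norm_sq_pos hu.1
  by_contra! hre
  have h0 : lam.re * ∫ p in rect L K, ‖u p‖ ^ 2 ≤ 0 := mul_nonpos_of_nonpos_of_nonneg hre hpos.le
  have h1 : 0 ≤ ∫ p in rect L K, ‖g₁ p + Complex.I * h * p.2 * u p‖ ^ 2 :=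
    integral_nonneg fun p => by positivity
  have h2 : 0 ≤ ∫ p in rect L K, ‖g₂ p‖ ^ 2 := integral_nonneg fun p => by positivity
  refine hu.1 (hdom.eq_zero_of_gradient hL hδ hδK (ae_eq_zero_of_integral_norm_sq
    (memLp_magnetic h hdom.grad.memLp hdom.grad.memLp_x) (by linarith)) ?_)
  exact (Lp.eq_zero_iff_ae_eq_zero).2 (ae_eq_zero_of_integral_norm_sq (Lp.memLp g₂) (by linarith))

/-- Strictness comes from `hlt`: equality would make the nonnegative function `(M - |φ|) |u|²`
vanish almost everywhere, and `u` with it. -/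
theorem IsEigenpair.abs_im_lt (hI : 0 < I) (hφ : MemLp φ ∞ (rectMeasure L K))
    (hlt : ∀ᵐ p ∂rectMeasure L K, |φ p| < (eLpNorm φ ∞ (rectMeasure L K)).toReal)
    {lam : ℂ} {u : L2 L K} (hu : IsEigenpair L K δ h I φ lam u) :
    |lam.im| < (eLpNorm φ ∞ (rectMeasure L K)).toReal * I := by
  obtain ⟨g₁, g₂, hdom, -, e⟩ := exists_energy_identity hφ hu
  have hpos := integral_norm_sq_pos hu.1
  set M := (eLpNorm φ ∞ (rectMeasure L K)).toReal
  have hiu := integrable_norm_sq_of_memLp (Lp.memLp u)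
  have hφu : Integrable (fun p => φ p * ‖u p‖ ^ 2) (rectMeasure L K) :=
    hiu.bdd_mul hφ.1 (ae_abs_le_toReal_eLpNorm hφ)
  have hφu' : Integrable (fun p => |φ p| * ‖u p‖ ^ 2) (rectMeasure L K) := by
    refine hφu.norm.congr (Eventually.of_forall fun p => ?_)
    simp
  have h1 : |∫ p in rect L K, φ p * ‖u p‖ ^ 2| ≤ ∫ p in rect L K, |φ p| * ‖u p‖ ^ 2 := by
    refine (abs_integral_le_integral_abs).trans (le_of_eq ?_)
    refine integral_congr_ae (Eventually.of_forall fun p => ?_)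
    simp [abs_mul]
  have h2 : ∫ p in rect L K, |φ p| * ‖u p‖ ^ 2 < M * ∫ p in rect L K, ‖u p‖ ^ 2 := by
    rw [← integral_const_mul]
    have hnn : 0 ≤ᵐ[rectMeasure L K] fun p => M * ‖u p‖ ^ 2 - |φ p| * ‖u p‖ ^ 2 := by
      filter_upwards [hlt] with p hp
      have := mul_le_mul_of_nonneg_right hp.le (sq_nonneg ‖u p‖)
      simpa using this
    refine sub_pos.1 ?_
    rw [← integral_sub (hiu.const_mul M) hφu']
    refine (integral_nonneg_of_ae hnn).lt_of_ne fun h0 => hu.1 ?_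
    rw [eq_comm, integral_eq_zero_iff_of_nonneg_ae hnn ((hiu.const_mul M).sub hφu')] at h0
    refine (Lp.eq_zero_iff_ae_eq_zero).2 ?_
    filter_upwards [h0, hlt] with p hp hp'
    have : (M - |φ p|) * ‖u p‖ ^ 2 = 0 := by rw [sub_mul]; exact hp
    simpa [(sub_pos.2 hp').ne'] using this
  have h3 : |lam.im| * ∫ p in rect L K, ‖u p‖ ^ 2 =
      I * |∫ p in rect L K, φ p * ‖u p‖ ^ 2| := by
    have := congrArg abs e
    rwa [abs_mul, abs_mul, abs_of_pos hpos, abs_of_pos hI] at this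
  refine lt_of_mul_lt_mul_right ?_ hpos.le
  rw [h3, mul_comm M, mul_assoc]
  exact mul_lt_mul_of_pos_left (h1.trans_lt h2) hI

end Eigenvalues

end GinzburgLandau

end

noncomputable section

open MeasureTheory Set Filter Topology
open scoped ContDiff ENNReal ComplexConjugate

namespace GinzburgLandau

/-! ### Reflection symmetry -/

section Reflection

variable {L K δ h I : ℝ} {φ : ℝ × ℝ → ℝ}

/-- The reflection `(x, y) ↦ (-x, y)`. -/
def reflect : (ℝ × ℝ) ≃L[ℝ] ℝ × ℝ :=
  (ContinuousLinearEquiv.neg ℝ).prodCongr (ContinuousLinearEquiv.refl ℝ ℝ)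

theorem reflect_apply (p : ℝ × ℝ) : reflect p = (-p.1, p.2) := rfl

theorem reflect_reflect (p : ℝ × ℝ) : reflect (reflect p) = p := by simp [reflect_apply]

theorem reflect_mem_rect_iff {p : ℝ × ℝ} : reflect p ∈ rect L K ↔ p ∈ rect L K := by
  simp only [rect, reflect_apply, mem_prod, mem_Ioo]
  constructor <;> rintro ⟨⟨a, b⟩, c⟩ <;> exact ⟨⟨by linarith, by linarith⟩, c⟩

theorem preimage_reflect_rect : reflect ⁻¹' rect L K = rect L K :=
  Set.ext fun _ => reflect_mem_rect_iff

theorem preimage_reflect_insulated : reflect ⁻¹' insulated L K δ = insulated L K δ := by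
  rw [insulated, preimage_sdiff]
  congr 1
  · have := reflect.toHomeomorph.preimage_frontier (rect L K)
    refine this.trans (congrArg frontier preimage_reflect_rect)
  · ext p
    simp [leads, reflect_apply]

theorem measurePreserving_reflect (L K : ℝ) :
    MeasurePreserving reflect (rectMeasure L K) (rectMeasure L K) := by
  have h := (Measure.measurePreserving_neg (volume : Measure ℝ)).prod
    (MeasurePreserving.id (volume : Measure ℝ))
  have h' := h.restrict_preimage (measurableSet_rect (L := L) (K := K))
  have hs : Prod.map Neg.neg id ⁻¹' rect L K = rect L K := preimage_reflect_rect
  rw [hs] at h'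
  exact h'

theorem integral_comp_reflect {E : Type*} [NormedAddCommGroup E] [NormedSpace ℝ E]
    (f : ℝ × ℝ → E) : ∫ p in rect L K, f (reflect p) = ∫ p in rect L K, f p :=
  (measurePreserving_reflect L K).integral_comp
    reflect.toHomeomorph.measurableEmbedding f

theorem IsTestFunction.reflect {U : Set (ℝ × ℝ)} {ψ : ℝ × ℝ → ℝ} (hψ : IsTestFunction U ψ) :
    IsTestFunction (reflect ⁻¹' U) fun p => ψ (GinzburgLandau.reflect p) where
  smooth := hψ.smooth.comp GinzburgLandau.reflect.contDiff
  compact := hψ.compact.comp_homeomorph GinzburgLandau.reflect.toHomeomorph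
  subset := (tsupport_comp_subset_preimage ψ GinzburgLandau.reflect.continuous).trans
    (preimage_mono hψ.subset)

theorem fderiv_comp_reflect (ψ : ℝ × ℝ → ℝ) (p e : ℝ × ℝ) :
    fderiv ℝ (fun p => ψ (reflect p)) p e = fderiv ℝ ψ (reflect p) (reflect e) :=
  congrArg (fun A : ℝ × ℝ →L[ℝ] ℝ => A e) (reflect.comp_right_fderiv (f := ψ) (x := p))

theorem integral_smul_conj_reflect (F : ℝ × ℝ → ℝ) (f : ℝ × ℝ → ℂ) :
    ∫ p in rect L K, F p • conj (f (reflect p)) =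
      conj (∫ p in rect L K, F (reflect p) • f p) := by
  rw [← integral_comp_reflect, ← integral_conj]
  refine integral_congr_ae (Eventually.of_forall fun p => ?_)
  simp [reflect_reflect]

theorem memLp_conj_reflect {f : ℝ × ℝ → ℂ} (hf : MemLp f 2 (rectMeasure L K)) :
    MemLp (fun p => conj (f (reflect p))) 2 (rectMeasure L K) :=
  (hf.comp_measurePreserving (measurePreserving_reflect L K)).star

theorem InFormDomain.reflect {u g₁ g₂ : ℝ × ℝ → ℂ} (H : InFormDomain L K δ u g₁ g₂) :
    InFormDomain L K δ (fun p => conj (u (GinzburgLandau.reflect p)))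
      (fun p => -conj (g₁ (GinzburgLandau.reflect p)))
      fun p => conj (g₂ (GinzburgLandau.reflect p)) := by
  have hx : ∀ ψ : ℝ × ℝ → ℝ, (∫ p in rect L K, fderiv ℝ (fun p => ψ (GinzburgLandau.reflect p)) p
      (1, 0) • u p = -∫ p in rect L K, ψ (GinzburgLandau.reflect p) • g₁ p) →
      ∫ p in rect L K, fderiv ℝ ψ p (1, 0) • conj (u (GinzburgLandau.reflect p)) =
        -∫ p in rect L K, ψ p • -conj (g₁ (GinzburgLandau.reflect p)) := fun ψ e => by
    simp only [smul_neg, integral_neg, neg_neg]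
    rw [integral_smul_conj_reflect, integral_smul_conj_reflect]
    congr 1
    rw [← neg_inj, ← e, ← integral_neg]
    refine integral_congr_ae (Eventually.of_forall fun p => ?_)
    have : GinzburgLandau.reflect (1, 0) = -(1, 0) := by simp [reflect_apply]
    simp only [fderiv_comp_reflect, this, map_neg, neg_smul]
  refine ⟨⟨memLp_conj_reflect H.grad.memLp, (memLp_conj_reflect H.grad.memLp_x).neg,
    memLp_conj_reflect H.grad.memLp_y, fun ψ hψ => hx ψ (H.grad.weak_x _ ?_), fun ψ hψ => ?_⟩,
    fun ψ hψ => hx ψ (H.trace _ ?_)⟩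
  · have := hψ.reflect
    rwa [preimage_reflect_rect] at this
  · have h1 := hψ.reflect
    rw [preimage_reflect_rect] at h1
    have e := H.grad.weak_y _ h1
    rw [integral_smul_conj_reflect, integral_smul_conj_reflect, ← map_neg, ← e]
    congr 1
    refine integral_congr_ae (Eventually.of_forall fun p => ?_)
    have : GinzburgLandau.reflect (0, 1) = (0, 1) := by simp [reflect_apply]
    simp only [fderiv_comp_reflect, this]
  · have := hψ.reflect
    rwa [preimage_compl, preimage_reflect_insulated] at this

/-- Reflection reverses `∂ₓ` and conjugation reverses `i h y`, so `D₁` just changes sign and `D₂` is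
unaffected. -/
theorem magneticForm_reflect (u g₁ g₂ v k₁ k₂ : ℝ × ℝ → ℂ) :
    magneticForm L K h (fun p => conj (u (reflect p))) (fun p => -conj (g₁ (reflect p)))
      (fun p => conj (g₂ (reflect p))) v k₁ k₂ =
    conj (magneticForm L K h u g₁ g₂ (fun p => conj (v (reflect p)))
      (fun p => -conj (k₁ (reflect p))) fun p => conj (k₂ (reflect p))) := by
  unfold magneticForm
  rw [← integral_comp_reflect, ← integral_conj]
  refine integral_congr_ae (Eventually.of_forall fun p => ?_)
  simp only [reflect_reflect, map_add, map_mul, map_neg, Complex.conj_conj, Complex.conj_I,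
    Complex.conj_ofReal]
  simp only [reflect_apply]
  ring

theorem coeFn_ptReflection (u : L2 L K) :
    ptReflection u =ᵐ[rectMeasure L K] fun p => conj (u (reflect p)) :=
  MemLp.coeFn_toLp (memLp_ptReflection u)

theorem IsMagneticLaplacian.ptReflection {u w : L2 L K} (H : IsMagneticLaplacian L K δ h u w) :
    IsMagneticLaplacian L K δ h (ptReflection u) (ptReflection w) := by
  obtain ⟨g₁, g₂, hu, e⟩ := H
  refine ⟨_, _, hu.reflect.congr (coeFn_ptReflection u).symm, fun v k₁ k₂ hv => ?_⟩
  rw [← magneticForm_congr h (coeFn_ptReflection u).symm, magneticForm_reflect, ← map_neg,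
    e _ _ _ hv.reflect, ← integral_conj, ← integral_comp_reflect]
  refine integral_congr_ae ?_
  filter_upwards [coeFn_ptReflection w] with p hp
  rw [hp]
  simp [reflect_reflect]

theorem ae_comp_reflect {P : ℝ × ℝ → Prop} (hP : ∀ᵐ p ∂rectMeasure L K, P p) :
    ∀ᵐ p ∂rectMeasure L K, P (reflect p) :=
  (measurePreserving_reflect L K).quasiMeasurePreserving.ae hP

theorem ptReflection_eq_zero {u : L2 L K} (hu : ptReflection u = 0) : u = 0 := by
  rw [Lp.eq_zero_iff_ae_eq_zero] at hu ⊢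
  filter_upwards [ae_comp_reflect ((coeFn_ptReflection u).symm.trans hu)] with p hp
  simpa [reflect_reflect] using hp

/-- Conjugation changes the sign of `i I φ`, and the oddness of `φ` changes it back. -/
theorem IsEigenpair.ptReflection (hφ : MemLp φ ∞ (rectMeasure L K))
    (hodd : ∀ᵐ p ∂rectMeasure L K, φ (reflect p) = -φ p) {lam : ℂ} {u : L2 L K}
    (hu : IsEigenpair L K δ h I φ lam u) :
    IsEigenpair L K δ h I φ (conj lam) (ptReflection u) := by
  rw [isEigenpair_iff hφ] at hu ⊢
  refine ⟨fun h0 => hu.1 (ptReflection_eq_zero h0), ?_⟩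
  convert hu.2.ptReflection using 1
  refine Lp.ext ?_
  filter_upwards [hodd, coeFn_ptReflection u,
    coeFn_ptReflection (-lam • u + (Complex.I * I) • potentialCLM hφ u),
    Lp.coeFn_add (-conj lam • GinzburgLandau.ptReflection u)
      ((Complex.I * I) • potentialCLM hφ (GinzburgLandau.ptReflection u)),
    Lp.coeFn_smul (-conj lam) (GinzburgLandau.ptReflection u),
    Lp.coeFn_smul (Complex.I * I) (potentialCLM hφ (GinzburgLandau.ptReflection u)),
    coeFn_potentialCLM hφ (GinzburgLandau.ptReflection u),
    ae_comp_reflect (Lp.coeFn_add (-lam • u) ((Complex.I * I) • potentialCLM hφ u)),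
    ae_comp_reflect (Lp.coeFn_smul (-lam) u),
    ae_comp_reflect (Lp.coeFn_smul (Complex.I * I) (potentialCLM hφ u)),
    ae_comp_reflect (coeFn_potentialCLM hφ u)] with p h0 h1 h2 h3 h4 h5 h6 h7 h8 h9 h10
  rw [h3, Pi.add_apply, h4, h5, Pi.smul_apply, Pi.smul_apply, h6, h1, h2, h7, Pi.add_apply, h8, h9,
    Pi.smul_apply, Pi.smul_apply, h10, h0]
  simp

end Reflection

/-! ### Listing the eigenvalues by real part -/

section Enumeration

variable {L K δ h I : ℝ} {φ : ℝ × ℝ → ℝ}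

/-- The eigenvalues form a sequence ordered by real part. -/
theorem exists_enumeration_eigenvalues (hL : 0 < L) (hδ : 0 < δ) (hδK : δ < K) (hI : 0 < I)
    (hφ : MemLp φ ∞ (rectMeasure L K))
    (hlt : ∀ᵐ p ∂rectMeasure L K, |φ p| < (eLpNorm φ ∞ (rectMeasure L K)).toReal) :
    ∃ e : ℕ → ℂ, Function.Injective e ∧
      Set.range e = {lam : ℂ | ∃ u, IsEigenpair L K δ h I φ lam u} ∧
      0 < (e 0).re ∧ Monotone fun n => (e n).re := by
  have hK : 0 < K := hδ.trans hδK
  obtain ⟨hT, b, t, ht, hTb, hsum⟩ := magneticResolvent_diagonal (δ := δ) hL hK h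
  set B := (Complex.I * I) • potentialCLM hφ
  set P := pencilEigenvalues (magneticResolvent L K δ h) B with hP
  set S := {lam : ℂ | ∃ u, IsEigenpair L K δ h I φ lam u} with hS
  have hSP : ∀ lam, lam ∈ S ↔ 1 + lam ∈ P := fun lam => exists_isEigenpair_iff hφ
  have hPinf : P.Infinite := infinite_pencilEigenvalues B hT b ht hTb hsum
  have hinj : Function.Injective fun lam : ℂ => 1 + lam := add_right_injective 1
  have hSpre : S = (fun lam : ℂ => 1 + lam) ⁻¹' P := Set.ext hSP
  have hSinf : S.Infinite := by
    rw [hSpre]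
    exact hPinf.preimage fun z _ => ⟨z - 1, by ring⟩
  have hre : ∀ lam ∈ S, 0 < lam.re := fun lam ⟨u, hu⟩ => hu.re_pos hL hδ hδK hφ
  set M := (eLpNorm φ ∞ (rectMeasure L K)).toReal
  have him : ∀ lam ∈ S, |lam.im| < M * I := fun lam ⟨u, hu⟩ => hu.abs_im_lt hI hφ hlt
  -- It would make `-1` an eigenvalue, of negative real part.
  have h0 : (0 : ℂ) ∉ P := fun h => by
    have := hre (-1) ((hSP _).2 (by simpa using h))
    norm_num at this
  -- The eigenvalues lie in a horizontal half strip, so a bound on the real part confines them to a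
  -- disc.
  have hfin : ∀ r, {z ∈ S | z.re ≤ r}.Finite := fun r => by
    refine ((finite_pencilEigenvalues_inter hT h0 (1 + |r| + M * I)).preimage
      hinj.injOn).subset fun z hz => ⟨(hSP z).1 hz.1, ?_⟩
    have h1 : ‖z‖ ≤ |z.re| + |z.im| := Complex.norm_le_abs_re_add_abs_im z
    have h2 : |z.re| ≤ |r| := by
      rw [abs_of_pos (hre z hz.1)]
      exact hz.2.trans (le_abs_self r)
    have h3 := him z hz.1
    have h4 : ‖1 + z‖ ≤ 1 + ‖z‖ := (norm_add_le _ _).trans (by simp)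
    linarith
  obtain ⟨e, he1, he2, he3⟩ := exists_enumeration_monotone_re hSinf hfin
  exact ⟨e, he1, he2, hre _ (he2 ▸ mem_range_self 0), he3⟩

end Enumeration

end GinzburgLandau

end

noncomputable section

open MeasureTheory Set Filter Topology
open scoped ContDiff ENNReal ComplexConjugate

namespace GinzburgLandau

/-! ### The strong maximum principle -/

section MaximumPrinciple

variable {L K : ℝ}

/-- The weak form of the Laplace equation in the rectangle. -/
def WeaklyHarmonic (L K : ℝ) (F : ℝ × ℝ → ℝ) : Prop :=
  ∀ η, IsTestFunction (rect L K) η →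
    ∫ p in rect L K, (fderiv ℝ (fun q => fderiv ℝ η q (1, 0)) p (1, 0) +
      fderiv ℝ (fun q => fderiv ℝ η q (0, 1)) p (0, 1)) * F p = 0

theorem IsTestFunction.fderiv_apply {U : Set (ℝ × ℝ)} {ψ : ℝ × ℝ → ℝ} (hψ : IsTestFunction U ψ)
    (e : ℝ × ℝ) : IsTestFunction U fun p => fderiv ℝ ψ p e where
  smooth := (hψ.smooth.fderiv_right (m := ∞) (by simp)).clm_apply contDiff_const
  compact := hψ.compact.fderiv_apply ℝ e
  subset := (tsupport_fderiv_apply_subset ℝ e).trans hψ.subset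

theorem IsTestFunction.integral_fderiv {ψ : ℝ × ℝ → ℝ} (hψ : IsTestFunction (rect L K) ψ)
    (e : ℝ × ℝ) : ∫ p in rect L K, fderiv ℝ ψ p e = 0 := by
  have hψ1 : ∀ p ∉ rect L K, fderiv ℝ ψ p e = 0 := fun p hp => by
    rw [fderiv_of_notMem_tsupport ℝ (fun h => hp (hψ.subset h))]; rfl
  rw [setIntegral_eq_integral_of_forall_compl_eq_zero hψ1]
  have h := integral_mul_fderiv_eq_neg_fderiv_mul_of_integrable (μ := (volume : Measure (ℝ × ℝ)))
    (f := fun _ => (1 : ℝ)) (g := ψ) (v := e) (by simp)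
    (((hψ.continuous_fderiv e).integrable_of_hasCompactSupport
        (hψ.compact.fderiv_apply ℝ e)).const_mul 1)
    ((hψ.smooth.continuous.integrable_of_hasCompactSupport hψ.compact).const_mul 1)
    (fun x _ => differentiableAt_const _)
    (fun x _ => (hψ.smooth.differentiable (by simp)).differentiableAt)
  simpa using h

theorem weaklyHarmonic_const (c : ℝ) : WeaklyHarmonic L K fun _ => c := fun η hη => by
  rw [integral_mul_const, integral_add, (hη.fderiv_apply _).integral_fderiv,
    (hη.fderiv_apply _).integral_fderiv, add_zero, zero_mul]
  · exact ((hη.fderiv_apply _).memLp_fderiv _).integrable (by norm_num)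
  · exact ((hη.fderiv_apply _).memLp_fderiv _).integrable (by norm_num)

theorem IsTestFunction.integrable_laplacian_mul {η F : ℝ × ℝ → ℝ}
    (hη : IsTestFunction (rect L K) η) (hF : MemLp F 2 (rectMeasure L K)) :
    Integrable (fun p => (fderiv ℝ (fun q => fderiv ℝ η q (1, 0)) p (1, 0) +
      fderiv ℝ (fun q => fderiv ℝ η q (0, 1)) p (0, 1)) * F p) (rectMeasure L K) :=
  (((hη.fderiv_apply _).memLp_fderiv _).add ((hη.fderiv_apply _).memLp_fderiv _)).integrable_mul hF

theorem WeaklyHarmonic.sub {F G : ℝ × ℝ → ℝ} (hF : WeaklyHarmonic L K F)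
    (hG : WeaklyHarmonic L K G) (hF2 : MemLp F 2 (rectMeasure L K))
    (hG2 : MemLp G 2 (rectMeasure L K)) : WeaklyHarmonic L K fun p => F p - G p := fun η hη => by
  simp only [mul_sub]
  rw [integral_sub (hη.integrable_laplacian_mul hF2) (hη.integrable_laplacian_mul hG2), hF η hη,
    hG η hη, sub_zero]

/-- The square of the Euclidean distance to a point. -/
def sqDist (c p : ℝ × ℝ) : ℝ := (p.1 - c.1) ^ 2 + (p.2 - c.2) ^ 2

theorem sqDist_nonneg (c p : ℝ × ℝ) : 0 ≤ sqDist c p := by unfold sqDist; positivity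

theorem continuous_sqDist (c : ℝ × ℝ) : Continuous (sqDist c) := by unfold sqDist; fun_prop

theorem contDiff_sqDist (c : ℝ × ℝ) : ContDiff ℝ ∞ (sqDist c) := by unfold sqDist; fun_prop

theorem dist_sq_le_sqDist (c p : ℝ × ℝ) : dist p c ^ 2 ≤ sqDist c p := by
  unfold sqDist
  rw [Prod.dist_eq, Real.dist_eq, Real.dist_eq]
  rcases max_cases |p.1 - c.1| |p.2 - c.2| with h | h <;> rw [h.1, sq_abs] <;> nlinarith

theorem hasFDerivAt_sqDist (c p : ℝ × ℝ) : HasFDerivAt (sqDist c)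
    ((2 * (p.1 - c.1)) • ContinuousLinearMap.fst ℝ ℝ ℝ +
      (2 * (p.2 - c.2)) • ContinuousLinearMap.snd ℝ ℝ ℝ) p := by
  have h1 : HasFDerivAt (fun p : ℝ × ℝ => (p.1 - c.1) ^ 2)
      ((2 * (p.1 - c.1)) • ContinuousLinearMap.fst ℝ ℝ ℝ) p := by
    have h := (((hasDerivAt_id' p.1).sub_const c.1).pow 2).comp_hasFDerivAt p
      (hasFDerivAt_fst (𝕜 := ℝ) (p := p))
    exact h.congr_fderiv (by simp)
  have h2 : HasFDerivAt (fun p : ℝ × ℝ => (p.2 - c.2) ^ 2)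
      ((2 * (p.2 - c.2)) • ContinuousLinearMap.snd ℝ ℝ ℝ) p := by
    have h := (((hasDerivAt_id' p.2).sub_const c.2).pow 2).comp_hasFDerivAt p
      (hasFDerivAt_snd (𝕜 := ℝ) (p := p))
    exact h.congr_fderiv (by simp)
  exact h1.add h2

theorem hasFDerivAt_radial {f : ℝ → ℝ} (hf : Differentiable ℝ f) (l : ℝ) (c p : ℝ × ℝ) :
    HasFDerivAt (fun p => f (l * sqDist c p))
      (deriv f (l * sqDist c p) • l • ((2 * (p.1 - c.1)) • ContinuousLinearMap.fst ℝ ℝ ℝ +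
        (2 * (p.2 - c.2)) • ContinuousLinearMap.snd ℝ ℝ ℝ)) p :=
  (hf _).hasDerivAt.comp_hasFDerivAt p ((hasFDerivAt_sqDist c p).const_mul l)

theorem fderiv_fderiv_radial_fst {f : ℝ → ℝ} (hf : ContDiff ℝ ∞ f) (l : ℝ) (c p : ℝ × ℝ) :
    fderiv ℝ (fun q => fderiv ℝ (fun p => f (l * sqDist c p)) q (1, 0)) p (1, 0) =
      2 * l * deriv f (l * sqDist c p) +
        (2 * l * (p.1 - c.1)) ^ 2 * deriv (deriv f) (l * sqDist c p) := by
  have hd : ∀ q, fderiv ℝ (fun p => f (l * sqDist c p)) q (1, 0) =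
      deriv f (l * sqDist c q) * (2 * l * (q.1 - c.1)) := fun q => by
    rw [(hasFDerivAt_radial (hf.differentiable (by simp)) l c q).fderiv]
    simp [-mul_eq_mul_left_iff]
    ring
  simp only [hd]
  have h1 := hasFDerivAt_radial (f := deriv f)
    ((contDiff_infty_iff_deriv.1 hf).2.differentiable (by simp)) l c p
  have h2 : HasFDerivAt (fun q : ℝ × ℝ => 2 * l * (q.1 - c.1))
      ((2 * l) • ContinuousLinearMap.fst ℝ ℝ ℝ) p :=
    (hasFDerivAt_fst.sub_const c.1).const_mul (2 * l)
  rw [(h1.fun_mul h2).fderiv]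
  simp
  ring

theorem fderiv_fderiv_radial_snd {f : ℝ → ℝ} (hf : ContDiff ℝ ∞ f) (l : ℝ) (c p : ℝ × ℝ) :
    fderiv ℝ (fun q => fderiv ℝ (fun p => f (l * sqDist c p)) q (0, 1)) p (0, 1) =
      2 * l * deriv f (l * sqDist c p) +
        (2 * l * (p.2 - c.2)) ^ 2 * deriv (deriv f) (l * sqDist c p) := by
  have hd : ∀ q, fderiv ℝ (fun p => f (l * sqDist c p)) q (0, 1) =
      deriv f (l * sqDist c q) * (2 * l * (q.2 - c.2)) := fun q => by
    rw [(hasFDerivAt_radial (hf.differentiable (by simp)) l c q).fderiv]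
    simp [-mul_eq_mul_left_iff]
    ring
  simp only [hd]
  have h1 := hasFDerivAt_radial (f := deriv f)
    ((contDiff_infty_iff_deriv.1 hf).2.differentiable (by simp)) l c p
  have h2 : HasFDerivAt (fun q : ℝ × ℝ => 2 * l * (q.2 - c.2))
      ((2 * l) • ContinuousLinearMap.snd ℝ ℝ ℝ) p :=
    (hasFDerivAt_snd.sub_const c.2).const_mul (2 * l)
  rw [(h1.fun_mul h2).fderiv]
  simp
  ring

/-- A radial profile supported in the unit disc. -/
def profile (s : ℝ) : ℝ := expNegInvGlue (1 - s)

theorem contDiff_profile : ContDiff ℝ ∞ profile := by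
  have : ContDiff ℝ ∞ expNegInvGlue := expNegInvGlue.contDiff (n := ⊤)
  exact this.comp (by fun_prop)

theorem profile_eq_zero {s : ℝ} (hs : 1 ≤ s) : profile s = 0 :=
  expNegInvGlue.zero_of_nonpos (by linarith)

theorem deriv_profile (s : ℝ) : deriv profile s = -((1 - s)⁻¹ ^ 2 * expNegInvGlue (1 - s)) := by
  have h := expNegInvGlue.hasDerivAt_polynomial_eval_inv_mul 1 (1 - s)
  simp only [Polynomial.eval_one, one_mul, Polynomial.derivative_one, sub_zero, mul_one,
    Polynomial.eval_pow, Polynomial.eval_X] at h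
  have h2 := h.comp_const_sub 1 s
  exact h2.deriv

theorem deriv_profile_nonpos (s : ℝ) : deriv profile s ≤ 0 := by
  rw [deriv_profile]
  have := expNegInvGlue.nonneg (1 - s)
  exact neg_nonpos.2 (by positivity)

theorem deriv_profile_neg {s : ℝ} (hs : s < 1) : deriv profile s < 0 := by
  rw [deriv_profile]
  have h1 := expNegInvGlue.pos_of_pos (sub_pos.2 hs)
  have h2 := sub_pos.2 hs
  exact neg_neg_of_pos (by positivity)

theorem deriv_profile_eq_zero {s : ℝ} (hs : 1 ≤ s) : deriv profile s = 0 := by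
  rw [deriv_profile, expNegInvGlue.zero_of_nonpos (by linarith), mul_zero, neg_zero]

theorem contDiff_deriv_profile : ContDiff ℝ ∞ (deriv profile) :=
  (contDiff_infty_iff_deriv.1 contDiff_profile).2

theorem continuous_deriv_profile_sqDist (l : ℝ) (c : ℝ × ℝ) :
    Continuous fun p => deriv profile (l * sqDist c p) :=
  contDiff_deriv_profile.continuous.comp (continuous_const.mul (continuous_sqDist c))

theorem deriv_deriv_profile_eq_zero {s : ℝ} (hs : 1 < s) : deriv (deriv profile) s = 0 := by
  have : deriv profile =ᶠ[𝓝 s] fun _ => 0 := by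
    filter_upwards [lt_mem_nhds hs] with t ht using deriv_profile_eq_zero ht.le
  rw [this.deriv_eq, deriv_const]

/-- A bound uniform in the scale `l`, used to differentiate the radial averages under the integral
sign. -/
theorem exists_abs_profile_le : ∃ C, ∀ s, 0 ≤ s →
    |deriv profile s + s * deriv (deriv profile) s| ≤ C := by
  have hc : Continuous fun s => deriv profile s + s * deriv (deriv profile) s :=
    contDiff_deriv_profile.continuous.add
      (continuous_id.mul (contDiff_deriv_profile.continuous_deriv (by simp)))
  obtain ⟨C, hC⟩ := (isCompact_Icc (a := (0 : ℝ)) (b := 1)).exists_bound_of_continuousOn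
    hc.continuousOn
  refine ⟨|C|, fun s hs => ?_⟩
  by_cases h1 : s ≤ 1
  · exact (hC s ⟨hs, h1⟩).trans (le_abs_self C)
  · rw [deriv_profile_eq_zero (not_le.1 h1).le, deriv_deriv_profile_eq_zero (not_le.1 h1)]
    simp

theorem exists_isTestFunction_radial {c : ℝ × ℝ} (hc : c ∈ rect L K) :
    ∃ l₀ : ℝ, 0 < l₀ ∧ ∀ l, l₀ < l →
      IsTestFunction (rect L K) fun p => profile (l * sqDist c p) := by
  obtain ⟨ε, hε, hball⟩ := Metric.isOpen_iff.1 isOpen_rect c hc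
  refine ⟨(ε ^ 2)⁻¹, by positivity, fun l hl => ?_⟩
  have hl0 : 0 < l := lt_trans (by positivity) hl
  have hcl : IsClosed {p : ℝ × ℝ | l * sqDist c p ≤ 1} :=
    isClosed_le (continuous_const.mul (continuous_sqDist c)) continuous_const
  have hts : tsupport (fun p => profile (l * sqDist c p)) ⊆ {p | l * sqDist c p ≤ 1} := by
    refine closure_minimal (fun p hp => ?_) hcl
    by_contra h
    exact hp (profile_eq_zero (not_le.1 h).le)
  have hsub : {p : ℝ × ℝ | l * sqDist c p ≤ 1} ⊆ Metric.ball c ε := fun p hp => by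
    have h1 : sqDist c p < ε ^ 2 := by
      have h2 : sqDist c p ≤ l⁻¹ := by
        rw [← one_div, le_div_iff₀ hl0, mul_comm]; exact hp
      exact h2.trans_lt (inv_lt_of_inv_lt₀ (by positivity) hl)
    exact lt_of_pow_lt_pow_left₀ 2 hε.le ((dist_sq_le_sqDist c p).trans_lt h1)
  refine ⟨contDiff_profile.comp (contDiff_const.mul (contDiff_sqDist c)), ?_,
    hts.trans (hsub.trans hball)⟩
  exact Metric.isCompact_of_isClosed_isBounded (isClosed_tsupport _)
    (Metric.isBounded_ball.subset (hts.trans hsub))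

/-- The scale invariant radial averages of a weakly harmonic function are constant. -/
theorem WeaklyHarmonic.exists_integral_eq {F : ℝ × ℝ → ℝ} (hF : WeaklyHarmonic L K F)
    (hF2 : MemLp F 2 (rectMeasure L K)) {c : ℝ × ℝ} (hc : c ∈ rect L K) :
    ∃ l₀ a : ℝ, 0 < l₀ ∧ ∀ l, l₀ < l →
      ∫ p in rect L K, l * deriv profile (l * sqDist c p) * F p = a := by
  have hFi : Integrable F (rectMeasure L K) := hF2.integrable (by norm_num)
  obtain ⟨l₀, hl₀, htest⟩ := exists_isTestFunction_radial hc
  obtain ⟨C, hC⟩ := exists_abs_profile_le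
  have hcont := fun l => continuous_deriv_profile_sqDist l c
  have hcont2 : ∀ l : ℝ, Continuous fun p => deriv (deriv profile) (l * sqDist c p) := fun l =>
    (contDiff_deriv_profile.continuous_deriv (by simp)).comp
      (continuous_const.mul (continuous_sqDist c))
  -- In dimension two, with `ρ = sqDist c p`, the Laplacian of `profile (l * ρ)` is `4 * l` times
  -- the `l`-derivative of `l * deriv profile (l * ρ)`. Weak harmonicity therefore makes the
  -- derivative of the average zero.
  have hder : ∀ l, l₀ < l →
      HasDerivAt (fun l => ∫ p in rect L K, l * deriv profile (l * sqDist c p) * F p) 0 l := by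
    intro l hl
    have hl0 : 0 < l := hl₀.trans hl
    have h := (hasDerivAt_integral_of_dominated_loc_of_deriv_le (μ := rectMeasure L K)
      (s := Ioi 0) (Ioi_mem_nhds hl0) (x₀ := l) (bound := fun p => C * ‖F p‖)
      (F := fun l p => l * deriv profile (l * sqDist c p) * F p)
      (F' := fun l p => (deriv profile (l * sqDist c p) +
        l * sqDist c p * deriv (deriv profile) (l * sqDist c p)) * F p)
      (Eventually.of_forall fun l =>
        ((continuous_const.mul (hcont l)).aestronglyMeasurable).mul hFi.1) ?_ ?_ ?_
      (hFi.norm.const_mul C) ?_).2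
    · refine h.congr_deriv ?_
      have := hF _ (htest l hl)
      simp only [fderiv_fderiv_radial_fst contDiff_profile,
        fderiv_fderiv_radial_snd contDiff_profile] at this
      have h2 : ∫ p in rect L K, 4 * l * ((deriv profile (l * sqDist c p) +
        l * sqDist c p * deriv (deriv profile) (l * sqDist c p)) * F p) = 0 := by
        rw [← this]
        refine integral_congr_ae (Eventually.of_forall fun p => ?_)
        simp only [sqDist]
        ring
      rw [integral_const_mul] at h2
      exact (mul_eq_zero.1 h2).resolve_left (by positivity)
    · exact (memLp_of_continuous (continuous_const.mul (hcont l)) 2).integrable_mul hF2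
    · exact (((hcont l).add ((continuous_const.mul (continuous_sqDist c)).mul
        (hcont2 l))).aestronglyMeasurable).mul hFi.1
    · refine Eventually.of_forall fun p l hl => ?_
      rw [norm_mul]
      exact mul_le_mul_of_nonneg_right (hC _ (mul_nonneg (le_of_lt hl) (sqDist_nonneg c p)))
        (norm_nonneg _)
    · refine Eventually.of_forall fun p l hl => ?_
      have h1 : HasDerivAt (fun l => deriv profile (l * sqDist c p))
          (deriv (deriv profile) (l * sqDist c p) * sqDist c p) l :=
        (contDiff_deriv_profile.differentiable (by simp) _).hasDerivAt.comp l
          (hasDerivAt_mul_const _)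
      refine (((hasDerivAt_id' l).mul h1).mul_const (F p)).congr_deriv ?_
      ring
  obtain ⟨a, ha⟩ := isOpen_Ioi.exists_is_const_of_deriv_eq_zero (isPreconnected_Ioi (a := l₀))
    (fun l hl => (hder l hl).differentiableAt.differentiableWithinAt)
    (fun l hl => (hder l hl).deriv)
  exact ⟨l₀, a, hl₀, fun l hl => ha l hl⟩

theorem abs_mul_deriv_profile_le {F : ℝ × ℝ → ℝ} {c : ℝ × ℝ} {ε r l : ℝ} (hr : 0 < r)
    (hF : ∀ p, dist p c < r → |F p| ≤ ε) (hl : (r ^ 2)⁻¹ < l) (p : ℝ × ℝ) :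
    |l * deriv profile (l * sqDist c p) * F p| ≤ ε * -(l * deriv profile (l * sqDist c p)) := by
  have hl0 : 0 < l := lt_trans (by positivity) hl
  have hn := deriv_profile_nonpos (l * sqDist c p)
  rw [abs_mul, abs_of_nonpos (mul_nonpos_of_nonneg_of_nonpos hl0.le hn), mul_comm ε]
  by_cases hp : dist p c < r
  · exact mul_le_mul_of_nonneg_left (hF p hp)
      (neg_nonneg.2 (mul_nonpos_of_nonneg_of_nonpos hl0.le hn))
  · have h1 : r ^ 2 ≤ sqDist c p :=
      (pow_le_pow_left₀ hr.le (not_lt.1 hp) 2).trans (dist_sq_le_sqDist c p)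
    have h2 : 1 ≤ l * sqDist c p := by
      calc 1 = (r ^ 2)⁻¹ * r ^ 2 := by field_simp
        _ ≤ l * sqDist c p := by gcongr
    rw [deriv_profile_eq_zero h2]
    simp

/-- A mean value property of weakly harmonic functions. -/
theorem WeaklyHarmonic.exists_integral_sub_eq_zero {F : ℝ × ℝ → ℝ} (hF : WeaklyHarmonic L K F)
    (hFc : Continuous F) (hF2 : MemLp F 2 (rectMeasure L K)) {c : ℝ × ℝ} (hc : c ∈ rect L K) :
    ∃ l : ℝ, 0 < l ∧ ∫ p in rect L K, l * deriv profile (l * sqDist c p) * (F p - F c) = 0 := by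
  have hG : WeaklyHarmonic L K fun p => F p - F c :=
    hF.sub (weaklyHarmonic_const (F c)) hF2 (memLp_const _)
  obtain ⟨l₁, a, hl₁, ha⟩ := hG.exists_integral_eq (hF2.sub (memLp_const _)) hc
  obtain ⟨l₂, b, hl₂, hb⟩ := (weaklyHarmonic_const (L := L) (K := K) 1).exists_integral_eq
    (memLp_const _) hc
  refine ⟨l₁ + 1, by linarith, (ha _ (by linarith)).trans ?_⟩
  -- As `l` grows the kernel concentrates at `c`, where `F - F c` is small, while its total mass
  -- keeps the value `b`.
  have key : ∀ ε > 0, |a| ≤ ε * -b := fun ε hε => by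
    obtain ⟨r, hr, hrF⟩ := Metric.continuous_iff.1 hFc c ε hε
    obtain ⟨l, hl⟩ := exists_gt (max (max l₁ l₂) (r ^ 2)⁻¹)
    have h1 : l₁ < l := ((le_max_left _ _).trans (le_max_left _ _)).trans_lt hl
    have h2 : l₂ < l := ((le_max_right _ _).trans (le_max_left _ _)).trans_lt hl
    have h3 : (r ^ 2)⁻¹ < l := (le_max_right _ _).trans_lt hl
    rw [← ha l h1, ← hb l h2, ← integral_neg, ← integral_const_mul]
    refine (abs_integral_le_integral_abs).trans ?_
    refine integral_mono_of_nonneg (Eventually.of_forall fun p => abs_nonneg _) ?_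
      (Eventually.of_forall fun p => ?_)
    · simp only [mul_one]
      exact ((memLp_of_continuous (continuous_const.mul
        (continuous_deriv_profile_sqDist l c)) 1).integrable le_rfl).neg.const_mul _
    · simp only [mul_one]
      exact abs_mul_deriv_profile_le hr (fun p hp => (hrF p hp).le) h3 p
  have hlim : Tendsto (fun ε : ℝ => ε * -b) (𝓝[>] 0) (𝓝 0) := by
    have : Tendsto (fun ε : ℝ => ε * -b) (𝓝 0) (𝓝 (0 * -b)) := tendsto_id.mul_const _
    rw [zero_mul] at this
    exact this.mono_left nhdsWithin_le_nhds
  have := ge_of_tendsto hlim (by filter_upwards [self_mem_nhdsWithin] with ε hε using key ε hε)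
  exact abs_eq_zero.1 (le_antisymm this (abs_nonneg a))

/-- The strong maximum principle. -/
theorem WeaklyHarmonic.eq_of_isMax {F : ℝ × ℝ → ℝ} (hF : WeaklyHarmonic L K F)
    (hFc : Continuous F) (hF2 : MemLp F 2 (rectMeasure L K)) {M : ℝ} (hM : ∀ p ∈ rect L K, F p ≤ M)
    {c : ℝ × ℝ} (hc : c ∈ rect L K) (hcM : F c = M) : ∀ p ∈ rect L K, F p = M := by
  -- The kernel is strictly negative near `c` and never positive, so a zero average of `F - M ≤ 0`
  -- forces `F = M` nearby. Connectedness of the rectangle then spreads the set where `F = M`.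
  have hloc : ∀ c ∈ rect L K, F c = M → ∀ᶠ p in 𝓝 c, F p = M := fun c hc hcM => by
    obtain ⟨l, hl, h0⟩ := hF.exists_integral_sub_eq_zero hFc hF2 hc
    have hcont : Continuous fun p => l * deriv profile (l * sqDist c p) * (F p - F c) :=
      (continuous_const.mul (continuous_deriv_profile_sqDist l c)).mul (hFc.sub continuous_const)
    have hnn : 0 ≤ᵐ[rectMeasure L K]
        fun p => l * deriv profile (l * sqDist c p) * (F p - F c) := by
      refine (ae_restrict_iff' measurableSet_rect).2 (Eventually.of_forall fun p hp => ?_)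
      refine mul_nonneg_of_nonpos_of_nonpos
        (mul_nonpos_of_nonneg_of_nonpos hl.le (deriv_profile_nonpos _)) ?_
      have := hM p hp
      linarith
    rw [integral_eq_zero_iff_of_nonneg_ae hnn ((memLp_of_continuous hcont 1).integrable le_rfl)]
      at h0
    have heq := Measure.eqOn_open_of_ae_eq h0 isOpen_rect hcont.continuousOn
      continuousOn_const
    have h1 : ∀ᶠ p in 𝓝 c, l * sqDist c p < 1 := by
      refine (continuous_const.mul (continuous_sqDist c)).continuousAt.eventually_lt
        continuousAt_const ?_
      simp [sqDist]
    filter_upwards [h1, isOpen_rect.mem_nhds hc] with p hp hp'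
    have h2 := heq hp'
    simp only [Pi.zero_apply, mul_eq_zero, hl.ne', (deriv_profile_neg hp).ne, false_or] at h2
    linarith
  have hu : IsOpen {p | p ∈ rect L K ∧ F p = M} := isOpen_iff_mem_nhds.2 fun p hp =>
    (hloc p hp.1 hp.2).and (isOpen_rect.mem_nhds hp.1) |>.mono fun q hq => ⟨hq.2, hq.1⟩
  have hv : IsOpen {p | F p ≠ M} := isOpen_ne_fun hFc continuous_const
  have hpre : IsPreconnected (rect L K) := isPreconnected_Ioo.prod isPreconnected_Ioo
  have := hpre.subset_left_of_subset_union hu hv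
    (disjoint_left.2 fun p hp hp' => hp' hp.2)
    (fun p hp => (em (F p = M)).imp (fun h => ⟨hp, h⟩) fun h => h) ⟨c, hc, hc, hcM⟩
  exact fun p hp => (this hp).2

end MaximumPrinciple

end GinzburgLandau

end

noncomputable section

open MeasureTheory Set Filter Topology
open scoped ContDiff ENNReal ComplexConjugate

namespace GinzburgLandau

/-! ### The cosine series of the normal potential -/

section Potential

variable {L K δ : ℝ} {φ : ℝ × ℝ → ℝ}

theorem cosMode_at_left (a : ℝ) (m : ℕ) : cosMode a m (-a) = 1 := by simp [cosMode]

theorem cosMode_at_right {a : ℝ} (ha : 0 < a) (m : ℕ) : cosMode a m a = (-1) ^ m := by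
  rw [cosMode, ← two_mul, freq_mul ha, Real.cos_nat_mul_pi]

theorem IsNormalPotential.memLp (hφ : IsNormalPotential L K δ φ) :
    MemLp φ 2 (rectMeasure L K) :=
  let ⟨⟨_, _, H, _⟩, _⟩ := hφ
  H.memLp

theorem deriv_cosMode (a : ℝ) (m : ℕ) : deriv (cosMode a m) = fun x => -freq a m * sinMode a m x :=
  funext fun x => (hasDerivAt_cosMode a m x).deriv

theorem deriv_sinMode (a : ℝ) (m : ℕ) : deriv (sinMode a m) = fun x => freq a m * cosMode a m x :=
  funext fun x => (hasDerivAt_sinMode a m x).deriv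

/-- The Neumann problem in terms of the cosine coefficients. -/
theorem IsNormalPotential.freq_mul_coefficient (hL : 0 < L) (hK : 0 < K)
    (hφ : IsNormalPotential L K δ φ) (m n : ℕ) :
    (freq L m ^ 2 + freq K n ^ 2) * ∫ p in rect L K, (cosMode L m p.1 * cosMode K n p.2) * φ p =
      (1 - (-1) ^ m) * ∫ y in (-δ)..δ, cosMode K n y := by
  obtain ⟨⟨g₁, g₂, H, e⟩, -⟩ := hφ
  -- The sine factors vanish on the relevant sides, so `e1` and `e2` have no boundary terms; the
  -- Neumann data enter only through `e3`.
  have e1 := H.integral_deriv_mul_x (contDiff_sinMode L m) (contDiff_cosMode K n)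
    (fun x hx => abs_sinMode_le hL m hx)
  have e2 := H.integral_deriv_mul_y (contDiff_cosMode L m) (contDiff_sinMode K n)
    (fun x hx => abs_sinMode_le hK n hx)
  have e3 := e (fun p => cosMode L m p.1 * cosMode K n p.2)
    (((contDiff_cosMode L m).comp contDiff_fst).mul ((contDiff_cosMode K n).comp contDiff_snd))
  have hd := fun a m => (contDiff_cosMode a m).differentiable (n := ∞) (by simp)
  simp only [fderiv_mul_prod_fst (hd L m) (hd K n), fderiv_mul_prod_snd (hd L m) (hd K n),
    deriv_cosMode, cosMode_at_left, cosMode_at_right hL] at e3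
  simp only [deriv_sinMode, smul_eq_mul] at e1 e2
  have i1 : Integrable (fun p : ℝ × ℝ => (sinMode L m p.1 * cosMode K n p.2) * g₁ p)
      (rectMeasure L K) := (memLp_of_continuous (((continuous_sinMode L m).comp continuous_fst).mul
        ((continuous_cosMode K n).comp continuous_snd)) 2).integrable_mul H.memLp_x
  have i2 : Integrable (fun p : ℝ × ℝ => (cosMode L m p.1 * sinMode K n p.2) * g₂ p)
      (rectMeasure L K) := (memLp_of_continuous (((continuous_cosMode L m).comp continuous_fst).mul
        ((continuous_sinMode K n).comp continuous_snd)) 2).integrable_mul H.memLp_y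
  have h1 : ∫ p in rect L K, freq L m * cosMode L m p.1 * cosMode K n p.2 * φ p =
      freq L m * ∫ p in rect L K, (cosMode L m p.1 * cosMode K n p.2) * φ p := by
    rw [← integral_const_mul]
    exact integral_congr_ae (Eventually.of_forall fun p => by ring)
  have h2 : ∫ p in rect L K, cosMode L m p.1 * (freq K n * cosMode K n p.2) * φ p =
      freq K n * ∫ p in rect L K, (cosMode L m p.1 * cosMode K n p.2) * φ p := by
    rw [← integral_const_mul]
    exact integral_congr_ae (Eventually.of_forall fun p => by ring)
  have h3 : ∫ p in rect L K, (g₁ p * (-freq L m * sinMode L m p.1 * cosMode K n p.2) +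
      g₂ p * (cosMode L m p.1 * (-freq K n * sinMode K n p.2))) =
      -freq L m * (∫ p in rect L K, (sinMode L m p.1 * cosMode K n p.2) * g₁ p) +
        -freq K n * ∫ p in rect L K, (cosMode L m p.1 * sinMode K n p.2) * g₂ p := by
    rw [← integral_const_mul, ← integral_const_mul,
      ← integral_add (i1.const_mul _) (i2.const_mul _)]
    exact integral_congr_ae (Eventually.of_forall fun p => by ring)
  have h4 : ∫ y in (-δ)..δ, (1 * cosMode K n y - (-1) ^ m * cosMode K n y) =
      (1 - (-1) ^ m) * ∫ y in (-δ)..δ, cosMode K n y := by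
    rw [← intervalIntegral.integral_const_mul]
    exact intervalIntegral.integral_congr fun y _ => by ring
  rw [h1] at e1
  rw [h2] at e2
  rw [h3, h4] at e3
  rw [← e3]
  linear_combination freq L m * e1 + freq K n * e2

/-- The data at the two sides cancel for even `m`; the constant mode, where the frequency factor is
zero, is covered by the mean-zero normalization. -/
theorem IsNormalPotential.coefficient_eq_zero (hL : 0 < L) (hK : 0 < K)
    (hφ : IsNormalPotential L K δ φ) {m : ℕ} (hm : Even m) (n : ℕ) :
    ∫ p in rect L K, (cosMode L m p.1 * cosMode K n p.2) * φ p = 0 := by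
  have h := hφ.freq_mul_coefficient hL hK m n
  rw [hm.neg_one_pow, sub_self, zero_mul] at h
  by_cases h0 : m = 0 ∧ n = 0
  · obtain ⟨rfl, rfl⟩ := h0
    simpa [cosMode_zero] using hφ.2
  · refine (mul_eq_zero.1 h).resolve_left ?_
    rcases not_and_or.1 h0 with h0 | h0
    · have := freq_pos hL h0
      positivity
    · have := freq_pos hK h0
      positivity

/-- The length of the lead bounds the integral by `2 * δ` and the antiderivative bounds it by `2 /
freq K n`; `n + 1` covers both at once. -/
theorem abs_integral_cosMode_mul_le (hK : 0 < K) (hδ : 0 < δ) (n : ℕ) :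
    (n + 1) * |∫ y in (-δ)..δ, cosMode K n y| ≤ (2 + 2 * δ * freq K 1) / freq K 1 := by
  have hf := freq_pos hK one_ne_zero
  have h1 : |∫ y in (-δ)..δ, cosMode K n y| ≤ 2 * δ := by
    have := intervalIntegral.norm_integral_le_of_norm_le_const (a := -δ) (b := δ)
      (f := cosMode K n) (C := 1) fun y _ => abs_cosMode_le_one K n y
    rw [abs_of_pos (by linarith)] at this
    refine this.trans (by linarith)
  have h2 : freq K n * |∫ y in (-δ)..δ, cosMode K n y| ≤ 2 := by
    have : freq K n * ∫ y in (-δ)..δ, cosMode K n y = sinMode K n δ - sinMode K n (-δ) := by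
      rw [← intervalIntegral.integral_const_mul]
      refine intervalIntegral.integral_eq_sub_of_hasDerivAt
        (fun y _ => hasDerivAt_sinMode K n y) ?_
      exact (continuous_const.mul (continuous_cosMode K n)).intervalIntegrable _ _
    rw [← abs_of_nonneg (freq_nonneg hK n), ← abs_mul, this]
    refine (abs_sub _ _).trans ?_
    have h3 : |sinMode K n δ| ≤ 1 := Real.abs_sin_le_one _
    have h4 : |sinMode K n (-δ)| ≤ 1 := Real.abs_sin_le_one _
    linarith
  have h3 : freq K n = n * freq K 1 := by unfold freq; push_cast; ring
  rw [le_div_iff₀ hf]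
  rw [h3] at h2
  nlinarith

/-- Separates the variables in the decay `1 / ((m² + n²) n)` of the coefficients while keeping the
exponent `3 / 2 > 1` in each. -/
theorem mul_rpow_le {a b : ℝ} (ha : 0 ≤ a) (hb : 0 ≤ b) :
    a ^ (3 / 2 : ℝ) * b ^ (3 / 2 : ℝ) ≤ (a ^ 2 + b ^ 2) * b := by
  have h : ∀ x : ℝ, 0 ≤ x → x ^ (3 / 2 : ℝ) = √x ^ 3 := fun x hx => by
    rw [Real.sqrt_eq_rpow, ← Real.rpow_natCast, ← Real.rpow_mul hx]
    norm_num
  rw [h a ha, h b hb]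
  obtain ⟨s, hs, rfl⟩ : ∃ s, 0 ≤ s ∧ a = s ^ 2 := ⟨√a, Real.sqrt_nonneg a, (Real.sq_sqrt ha).symm⟩
  obtain ⟨t, ht, rfl⟩ : ∃ s, 0 ≤ s ∧ b = s ^ 2 := ⟨√b, Real.sqrt_nonneg b, (Real.sq_sqrt hb).symm⟩
  rw [Real.sqrt_sq hs, Real.sqrt_sq ht]
  have key : s ^ 3 * t ≤ s ^ 4 + t ^ 4 := by
    rcases le_total s t with hst | hst
    · have : s ^ 3 * t ≤ t ^ 3 * t := by gcongr
      nlinarith [pow_nonneg hs 4]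
    · have : s ^ 3 * t ≤ s ^ 3 * s := by gcongr
      nlinarith [pow_nonneg ht 4]
  calc s ^ 3 * t ^ 3 = (s ^ 3 * t) * t ^ 2 := by ring
    _ ≤ (s ^ 4 + t ^ 4) * t ^ 2 := by gcongr
    _ = _ := by ring

/-- The cosine coefficients of the normal potential are absolutely summable. -/
theorem IsNormalPotential.exists_abs_coefficient_le (hL : 0 < L) (hδ : 0 < δ) (hK : 0 < K)
    (hφ : IsNormalPotential L K δ φ) : ∃ D, ∀ m n : ℕ,
    |∫ p in rect L K, (cosMode L m p.1 * cosMode K n p.2) * φ p| ≤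
      D * (((m : ℝ) ^ (3 / 2 : ℝ))⁻¹ * (((n + 1 : ℕ) : ℝ) ^ (3 / 2 : ℝ))⁻¹) := by
  have hfL := freq_pos hL one_ne_zero
  have hfK := freq_pos hK one_ne_zero
  set C := (2 + 2 * δ * freq K 1) / freq K 1
  set κ := min (freq L 1 ^ 2) (freq K 1 ^ 2) with hκ
  have hκ0 : 0 < κ := lt_min (by positivity) (by positivity)
  have hC : 0 ≤ C := by positivity
  refine ⟨8 * C / κ, fun m n => ?_⟩
  -- At `m = 0` the inverse on the right has the default value `0`, so the coefficient must vanish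
  -- there, as it does for every even `m`.
  rcases Nat.eq_zero_or_pos m with rfl | hm
  · rw [hφ.coefficient_eq_zero hL hK Even.zero n, abs_zero]
    positivity
  set A := ∫ p in rect L K, (cosMode L m p.1 * cosMode K n p.2) * φ p
  have hm1 : (1 : ℝ) ≤ m := by exact_mod_cast hm
  have h1 : (freq L m ^ 2 + freq K n ^ 2) * |A| ≤ 2 * |∫ y in (-δ)..δ, cosMode K n y| := by
    have h := congrArg abs (hφ.freq_mul_coefficient hL hK m n)
    rw [abs_mul, abs_mul, abs_of_nonneg (by positivity)] at h
    rw [h]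
    gcongr
    refine (abs_sub _ _).trans ?_
    simp
    norm_num
  have h2 := abs_integral_cosMode_mul_le hK hδ n
  have h3 : κ * (m ^ 2 + n ^ 2) ≤ freq L m ^ 2 + freq K n ^ 2 := by
    have e1 : freq L m = m * freq L 1 := by unfold freq; push_cast; ring
    have e2 : freq K n = n * freq K 1 := by unfold freq; push_cast; ring
    rw [e1, e2, mul_pow, mul_pow, mul_add]
    have := min_le_left (freq L 1 ^ 2) (freq K 1 ^ 2)
    have := min_le_right (freq L 1 ^ 2) (freq K 1 ^ 2)
    rw [mul_comm κ, mul_comm κ]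
    gcongr
  have h4 : ((m : ℝ) ^ 2 + ((n + 1 : ℕ) : ℝ) ^ 2) ≤ 4 * (m ^ 2 + n ^ 2) := by
    push_cast
    nlinarith [sq_nonneg ((n : ℝ) - 1)]
  have h5 := mul_rpow_le (a := (m : ℝ)) (b := ((n + 1 : ℕ) : ℝ)) (by positivity) (by positivity)
  have hn1 : (0 : ℝ) < ((n + 1 : ℕ) : ℝ) := by positivity
  have hw : 0 < (m : ℝ) ^ (3 / 2 : ℝ) * ((n + 1 : ℕ) : ℝ) ^ (3 / 2 : ℝ) := by positivity
  rw [← mul_inv, ← div_eq_mul_inv, le_div_iff₀ hw, le_div_iff₀ hκ0]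
  calc |A| * ((m : ℝ) ^ (3 / 2 : ℝ) * ((n + 1 : ℕ) : ℝ) ^ (3 / 2 : ℝ)) * κ
      ≤ |A| * (4 * (m ^ 2 + n ^ 2) * ((n + 1 : ℕ) : ℝ)) * κ := by
        refine mul_le_mul_of_nonneg_right (mul_le_mul_of_nonneg_left ?_ (abs_nonneg A)) hκ0.le
        exact h5.trans (mul_le_mul_of_nonneg_right h4 hn1.le)
    _ = 4 * ((n + 1 : ℕ) : ℝ) * (κ * (m ^ 2 + n ^ 2) * |A|) := by ring
    _ ≤ 4 * ((n + 1 : ℕ) : ℝ) * ((freq L m ^ 2 + freq K n ^ 2) * |A|) := by gcongr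
    _ ≤ 4 * ((n + 1 : ℕ) : ℝ) * (2 * |∫ y in (-δ)..δ, cosMode K n y|) := by gcongr
    _ = 8 * ((n + 1) * |∫ y in (-δ)..δ, cosMode K n y|) := by push_cast; ring
    _ ≤ 8 * C := by gcongr

theorem summable_rpow_mul_rpow : Summable fun q : ℕ × ℕ =>
    ((q.1 : ℝ) ^ (3 / 2 : ℝ))⁻¹ * (((q.2 + 1 : ℕ) : ℝ) ^ (3 / 2 : ℝ))⁻¹ := by
  have h : Summable fun n : ℕ => ((n : ℝ) ^ (3 / 2 : ℝ))⁻¹ :=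
    Real.summable_nat_rpow_inv.2 (by norm_num)
  exact h.mul_of_nonneg ((summable_nat_add_iff 1).2 h) (fun _ => by positivity)
    fun _ => by positivity

/-- The normalized product of cosine modes as a bounded continuous function. -/
def cosBCF (L K : ℝ) (q : ℕ × ℕ) : BoundedContinuousFunction (ℝ × ℝ) ℂ :=
  BoundedContinuousFunction.ofNormedAddCommGroup
    (fun p => (((√(modeNorm L q.1 * modeNorm K q.2))⁻¹ : ℝ) : ℂ) *
      ((cosMode L q.1 p.1 * cosMode K q.2 p.2 : ℝ) : ℂ))
    (continuous_const.mul (Complex.continuous_ofReal.comp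
      (((continuous_cosMode L q.1).comp continuous_fst).mul
        ((continuous_cosMode K q.2).comp continuous_snd))))
    (√(modeNorm L q.1 * modeNorm K q.2))⁻¹ fun p => by
      rw [norm_mul, Complex.norm_real, Complex.norm_real, Real.norm_eq_abs, Real.norm_eq_abs,
        abs_of_nonneg (by positivity), abs_mul]
      exact mul_le_of_le_one_right (by positivity)
        (mul_le_one₀ (abs_cosMode_le_one _ _ _) (abs_nonneg _) (abs_cosMode_le_one _ _ _))

theorem norm_cosBCF_le (q : ℕ × ℕ) : ‖cosBCF L K q‖ ≤ (√(modeNorm L q.1 * modeNorm K q.2))⁻¹ :=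
  BoundedContinuousFunction.norm_ofNormedAddCommGroup_le _ (by positivity) _

theorem toLp_cosBCF (q : ℕ × ℕ) :
    BoundedContinuousFunction.toLp 2 (rectMeasure L K) ℂ (cosBCF L K q) = cosVec L K q := by
  refine Lp.ext ?_
  have h1 := BoundedContinuousFunction.coeFn_toLp (p := 2) (rectMeasure L K) ℂ (cosBCF L K q)
  have h2 := Lp.coeFn_smul (((√(modeNorm L q.1 * modeNorm K q.2))⁻¹ : ℝ) : ℂ)
    (prodLp L K (continuous_cosMode L q.1) (continuous_cosMode K q.2))
  have h3 := MemLp.coeFn_toLp (memLp_of_continuous (L := L) (K := K)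
    (f := fun p : ℝ × ℝ => ((cosMode L q.1 p.1 * cosMode K q.2 p.2 : ℝ) : ℂ))
    (Complex.continuous_ofReal.comp (((continuous_cosMode L q.1).comp continuous_fst).mul
        ((continuous_cosMode K q.2).comp continuous_snd))) 2)
  filter_upwards [h1, h2, h3] with p h1 h2 h3
  rw [h1, cosVec, h2, Pi.smul_apply, prodLp, h3]
  rfl

theorem modeNorm_ge {a : ℝ} (ha : 0 < a) (m : ℕ) : a ≤ modeNorm a m := by
  unfold modeNorm
  split_ifs <;> linarith

/-- The normal potential is bounded and continuous, and odd in `x`. -/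
theorem IsNormalPotential.exists_continuous (hL : 0 < L) (hδ : 0 < δ) (hK : 0 < K)
    (hφ : IsNormalPotential L K δ φ) : ∃ F : ℝ × ℝ → ℝ, Continuous F ∧ (∃ C, ∀ p, |F p| ≤ C) ∧
      φ =ᵐ[rectMeasure L K] F ∧ ∀ p, F (-p.1, p.2) = -F p := by
  obtain ⟨D, hD⟩ := hφ.exists_abs_coefficient_le hL hδ hK
  set Φ : L2 L K := (hφ.memLp.ofReal (K := ℂ)).toLp with hΦ
  have hcoef : ∀ q, inner ℂ (cosVec L K q) Φ =
      (((√(modeNorm L q.1 * modeNorm K q.2))⁻¹ *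
        ∫ p in rect L K, (cosMode L q.1 p.1 * cosMode K q.2 p.2) * φ p : ℝ) : ℂ) := fun q => by
    rw [inner_cosVec, Complex.ofReal_mul, ← integral_complex_ofReal]
    congr 1
    refine integral_congr_ae ?_
    filter_upwards [(hφ.memLp.ofReal (K := ℂ)).coeFn_toLp] with p hp
    rw [hp, Complex.real_smul]
    simp
  let f : ℕ × ℕ → BoundedContinuousFunction (ℝ × ℝ) ℂ := fun q =>
    inner ℂ (cosVec L K q) Φ • cosBCF L K q
  have hsum : Summable f := by
    refine Summable.of_norm_bounded (summable_rpow_mul_rpow.mul_left ((L * K)⁻¹ * D)) fun q => ?_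
    have hN : L * K ≤ modeNorm L q.1 * modeNorm K q.2 :=
      mul_le_mul (modeNorm_ge hL _) (modeNorm_ge hK _) hK.le (modeNorm_pos hL _).le
    have hN0 : 0 < modeNorm L q.1 * modeNorm K q.2 := lt_of_lt_of_le (by positivity) hN
    rw [norm_smul, hcoef, Complex.norm_real, Real.norm_eq_abs, abs_mul,
      abs_of_nonneg (by positivity)]
    calc _ ≤ (√(modeNorm L q.1 * modeNorm K q.2))⁻¹ *
          |∫ p in rect L K, (cosMode L q.1 p.1 * cosMode K q.2 p.2) * φ p| *
          (√(modeNorm L q.1 * modeNorm K q.2))⁻¹ := by gcongr; exact norm_cosBCF_le q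
      _ = (modeNorm L q.1 * modeNorm K q.2)⁻¹ *
          |∫ p in rect L K, (cosMode L q.1 p.1 * cosMode K q.2 p.2) * φ p| := by
        rw [mul_right_comm, ← mul_inv, Real.mul_self_sqrt hN0.le]
      _ ≤ (L * K)⁻¹ * (D * _) := by
        gcongr
        exact hD q.1 q.2
      _ = _ := by ring
  obtain ⟨G, hG⟩ := hsum
  -- The uniformly convergent series also converges in `L²`, where it is the expansion of `φ` in the
  -- cosine basis.
  have hGΦ : BoundedContinuousFunction.toLp 2 (rectMeasure L K) ℂ G = Φ := by
    have h1 := hG.mapL (BoundedContinuousFunction.toLp 2 (rectMeasure L K) ℂ)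
    have h2 := (cosBasis hL hK).hasSum_repr Φ
    simp only [HilbertBasis.repr_apply_apply, coe_cosBasis] at h2
    simp only [f, map_smul, toLp_cosBCF] at h1
    exact h1.unique h2
  have hae : φ =ᵐ[rectMeasure L K] fun p => (G p).re := by
    have h1 := BoundedContinuousFunction.coeFn_toLp (p := 2) (rectMeasure L K) ℂ G
    rw [hGΦ] at h1
    filter_upwards [h1, (hφ.memLp.ofReal (K := ℂ)).coeFn_toLp] with p h1 h2
    rw [← h1, h2]
    simp
  refine ⟨fun p => (G p).re, Complex.continuous_re.comp G.continuous,
    ⟨‖G‖, fun p => (Complex.abs_re_le_norm _).trans (G.norm_coe_le_norm p)⟩, hae, fun p => ?_⟩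
  have heval : ∀ p, HasSum (fun q => f q p) (G p) := fun p =>
    hG.mapL (BoundedContinuousFunction.evalCLM ℂ p)
  -- Modes of even index in `x` are absent, and those of odd index are odd in `x`.
  have hodd : ∀ q, f q (-p.1, p.2) = -f q p := fun q => by
    rcases Nat.even_or_odd q.1 with hq | hq
    · simp [f, hcoef, hφ.coefficient_eq_zero hL hK hq]
    · change inner ℂ (cosVec L K q) Φ * (_ * ((cosMode L q.1 (-p.1) * cosMode K q.2 p.2 : ℝ) : ℂ))
        = -(inner ℂ (cosVec L K q) Φ * (_ * ((cosMode L q.1 p.1 * cosMode K q.2 p.2 : ℝ) : ℂ)))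
      rw [cosMode_neg hL, hq.neg_one_pow]
      push_cast
      ring
  have h := heval (-p.1, p.2)
  simp only [hodd] at h
  exact (congrArg Complex.re (h.unique (heval p).neg)).trans (Complex.neg_re _)

/-- Test functions supported inside the rectangle do not see the Neumann data. -/
theorem IsNormalPotential.weaklyHarmonic (hφ : IsNormalPotential L K δ φ) :
    WeaklyHarmonic L K φ := by
  obtain ⟨⟨g₁, g₂, H, e⟩, -⟩ := hφ
  intro η hη
  have hη0 : ∀ y, η (-L, y) - η (L, y) = 0 := fun y => by
    have h0 : ∀ p ∉ rect L K, η p = 0 := fun p hp =>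
      image_eq_zero_of_notMem_tsupport fun h => hp (hη.subset h)
    rw [h0 _ (by simp [rect]), h0 _ (by simp [rect]), sub_zero]
  have e1 := H.weak_x _ (hη.fderiv_apply (1, 0))
  have e2 := H.weak_y _ (hη.fderiv_apply (0, 1))
  have e3 := e η hη.smooth
  simp only [hη0, intervalIntegral.integral_zero] at e3
  simp only [smul_eq_mul] at e1 e2
  have i : ∀ (ψ : ℝ × ℝ → ℝ) (g : ℝ × ℝ → ℝ) (v : ℝ × ℝ), IsTestFunction (rect L K) ψ →
      MemLp g 2 (rectMeasure L K) → Integrable (fun p => fderiv ℝ ψ p v * g p) (rectMeasure L K) :=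
    fun ψ g v hψ hg => (hψ.memLp_fderiv v).integrable_mul hg
  simp only [add_mul]
  rw [integral_add (i _ _ _ (hη.fderiv_apply _) H.memLp) (i _ _ _ (hη.fderiv_apply _) H.memLp),
    e1, e2, ← neg_add, ← integral_add (i _ _ _ hη H.memLp_x) (i _ _ _ hη H.memLp_y), neg_eq_zero]
  refine Eq.trans ?_ e3
  exact integral_congr_ae (Eventually.of_forall fun p => by ring)

/-- The normal potential is bounded. -/
theorem IsNormalPotential.memLp_top (hL : 0 < L) (hδ : 0 < δ) (hK : 0 < K)
    (hφ : IsNormalPotential L K δ φ) : MemLp φ ⊤ (rectMeasure L K) := by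
  obtain ⟨F, hF, ⟨C, hC⟩, hae, -⟩ := hφ.exists_continuous hL hδ hK
  exact (MemLp.of_bound hF.aestronglyMeasurable C (Eventually.of_forall hC)).ae_eq hae.symm

/-- The normal potential is odd in `x`. -/
theorem IsNormalPotential.ae_odd (hL : 0 < L) (hδ : 0 < δ) (hK : 0 < K)
    (hφ : IsNormalPotential L K δ φ) : ∃ F : ℝ × ℝ → ℝ, φ =ᵐ[rectMeasure L K] F ∧
      ∀ p, F (-p.1, p.2) = -F p :=
  let ⟨F, _, _, hae, hodd⟩ := hφ.exists_continuous hL hδ hK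
  ⟨F, hae, hodd⟩

/-- The coefficient at `(1, 0)` is a nonzero multiple of `δ`, whereas a constant has none there. -/
theorem IsNormalPotential.not_ae_const (hL : 0 < L) (hδ : 0 < δ) (hK : 0 < K)
    (hφ : IsNormalPotential L K δ φ) (c : ℝ) : ¬ φ =ᵐ[rectMeasure L K] fun _ => c := fun hae => by
  have h := hφ.freq_mul_coefficient hL hK 1 0
  have h0 : ∫ p in rect L K, (cosMode L 1 p.1 * cosMode K 0 p.2) * φ p = 0 := by
    have h1 : ∫ p in rect L K, (cosMode L 1 p.1 * cosMode K 0 p.2) * φ p =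
        ∫ p in rect L K, cosMode L 1 p.1 * (fun _ => c) p.2 :=
      integral_congr_ae (hae.mono fun p hp => by simp only [hp, cosMode_zero, mul_one])
    have h2 := integral_cosMode_mul hL 1 0
    simp only [cosMode_zero, mul_one] at h2
    rw [h1, integral_prod_rect hL hK (cosMode L 1) fun _ => c, h2]
    simp
  rw [h0] at h
  simp [cosMode_zero] at h
  linarith

/-- The normal potential does not attain its supremum norm in the rectangle. -/
theorem IsNormalPotential.ae_abs_lt (hL : 0 < L) (hδ : 0 < δ) (hδK : δ < K)
    (hφ : IsNormalPotential L K δ φ) :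
    ∀ᵐ p ∂rectMeasure L K, |φ p| < (eLpNorm φ ⊤ (rectMeasure L K)).toReal := by
  have hK : 0 < K := hδ.trans hδK
  have hm := hφ.memLp_top hL hδ hK
  obtain ⟨F, hF, -, hae, -⟩ := hφ.exists_continuous hL hδ hK
  set M := (eLpNorm φ ⊤ (rectMeasure L K)).toReal
  have hF2 : MemLp F 2 (rectMeasure L K) := memLp_of_continuous hF 2
  have hM : ∀ p ∈ rect L K, |F p| ≤ M := by
    -- The bound `|F| ≤ M` is written as an equality, because equality of continuous functions
    -- almost everywhere extends to every point of an open set.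
    have h1 : (fun p => max |F p| M) =ᵐ[rectMeasure L K] fun _ => M := by
      filter_upwards [hae, ae_le_eLpNormEssSup (f := φ) (μ := rectMeasure L K)] with p hp hb
      have h2 : eLpNormEssSup φ (rectMeasure L K) ≠ ⊤ := by
        rw [← eLpNorm_exponent_top]; exact hm.eLpNorm_ne_top
      have := ENNReal.toReal_mono h2 hb
      rw [← hp]
      refine max_eq_right ?_
      simpa [M, eLpNorm_exponent_top] using this
    have h2 := Measure.eqOn_open_of_ae_eq h1 isOpen_rect
      (hF.abs.max continuous_const).continuousOn continuousOn_const
    exact fun p hp => max_eq_right_iff.1 (h2 hp)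
  have hh : WeaklyHarmonic L K F := fun η hη => by
    refine Eq.trans ?_ (hφ.weaklyHarmonic η hη)
    exact integral_congr_ae (hae.mono fun p hp => by simp only [hp])
  have hh' : WeaklyHarmonic L K fun p => -F p := fun η hη => by
    simp only [mul_neg, integral_neg, hh η hη, neg_zero]
  have hc : ∀ c, ¬ ∀ p ∈ rect L K, F p = c := fun c hFc =>
    hφ.not_ae_const hL hδ hK c (hae.trans
      ((ae_restrict_iff' measurableSet_rect).2 (Eventually.of_forall hFc)))
  filter_upwards [hae, (ae_restrict_iff' measurableSet_rect).2
    (Eventually.of_forall fun p (hp : p ∈ rect L K) => hp)] with p hp hpr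
  rw [hp]
  refine (hM p hpr).lt_of_ne fun heq => ?_
  rcases abs_choice (F p) with h | h
  · exact hc M (hh.eq_of_isMax hF hF2 (fun q hq => (le_abs_self _).trans (hM q hq)) hpr
      (h.symm.trans heq))
  · refine hc (-M) fun q hq => neg_eq_iff_eq_neg.1 (hh'.eq_of_isMax hF.neg hF2.neg
      (fun q hq => (neg_le_abs _).trans (hM q hq)) hpr (h.symm.trans heq) q hq)

end Potential

end GinzburgLandau

end

theorem mainTheorem2 (L K δ h I : ℝ) (hL : 0 < L) (hδ : 0 < δ) (hδK : δ < K) (hh : 0 ≤ h)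
    (hI : 0 < I) (φ : ℝ × ℝ → ℝ) (hφ : GinzburgLandau.IsNormalPotential L K δ φ) :
    -- the spectrum consists only of eigenvalues
    GinzburgLandau.opSpectrum (GinzburgLandau.linearOp L K δ h I φ) =
        GinzburgLandau.pointSpectrum (GinzburgLandau.linearOp L K δ h I φ) ∧
    -- bounds for the eigenvalues, in which the norm is finite
    MemLp φ ∞ (GinzburgLandau.rectMeasure L K) ∧
    (∀ (lam : ℂ) (u : GinzburgLandau.L2 L K), GinzburgLandau.IsEigenpair L K δ h I φ lam u →
      0 < lam.re ∧
        |lam.im| < (eLpNorm φ ∞ (GinzburgLandau.rectMeasure L K)).toReal * I) ∧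
    -- the eigenvalues form a sequence with nondecreasing real parts
    (∃ e : ℕ → ℂ, Function.Injective e ∧
      Set.range e = {lam : ℂ | ∃ u, GinzburgLandau.IsEigenpair L K δ h I φ lam u} ∧
      0 < (e 0).re ∧ Monotone fun n => (e n).re) ∧
    -- PT-symmetry
    (∀ (lam : ℂ) (u : GinzburgLandau.L2 L K), GinzburgLandau.IsEigenpair L K δ h I φ lam u →
      GinzburgLandau.IsEigenpair L K δ h I φ (conj lam) (GinzburgLandau.ptReflection u)) := by
  have hK : 0 < K := hδ.trans hδK
  have hm : MemLp φ ∞ (GinzburgLandau.rectMeasure L K) := hφ.memLp_top hL hδ hK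
  have hlt := hφ.ae_abs_lt hL hδ hδK
  refine ⟨GinzburgLandau.opSpectrum_eq_pointSpectrum hL hK hm h I, hm,
    fun lam u hu => ⟨hu.re_pos hL hδ hδK hm, hu.abs_im_lt hI hm hlt⟩,
    GinzburgLandau.exists_enumeration_eigenvalues hL hδ hδK hI hm hlt,
    fun lam u hu => hu.ptReflection hm ?_⟩
  obtain ⟨F, hae, hodd⟩ := hφ.ae_odd hL hδ hK
  filter_upwards [hae, GinzburgLandau.ae_comp_reflect hae] with p h1 h2
  rw [h2, GinzburgLandau.reflect_apply, hodd, h1]
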